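/- **Theorem.** There exist a compactly generated totally disconnected locally compact (Hausdorff) group $G$ and a closed cocompact subgroup $H\le G$, itself compactly generated (and totally disconnected locally compact), such that $G$ and $H$ are both abstractly simple, $G$ contains a lattice, and $H$ contains no lattice. Explicit examples are as follows. Let $\Omega$ be a finite set with at least three elements and let $T$ be the regular tree of degree $|\Omega|$, with a colouring of its edges by $\Omega$ such that at every vertex each colour occurs exactly once. For $g\in\mathrm{Aut}(T)$ and a vertex $v$ let $\sigma(g,v)\in\mathrm{Sym}(\Omega)$ be the permutation of the colours induced by $g$ from the edges at $v$ to the edges at $gv$. For $F\le F'\le\mathrm{Sym}(\Omega)$ let $U(F)$ be the group of all $g$ with $\sigma(g,v)\in F$ for all $v$, and let $G(F,F')$ be the group of all $g$ with $\sigma(g,v)\in F'$ for all $v$ and $\sigma(g,v)\in F$ for all but finitely many $v$, with the group topology for which the inclusion of $U(F)$ (with the permutation topology on vertices) is continuous and open. Let $N(F,F')\le G(F,F')$ be the subgroup generated by the derived subgroups $[G(F,F')_e,G(F,F')_e]$ of the pointwise stabilizers of the edges $e$ of $T$, with the subspace topology. Let $q\equiv 1 \pmod 4$ be a power of a prime $p$,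 let $n\ge 1$ and $\Omega=\mathbb F_q^n$. Let $F'=\mathbb F_q^n\rtimes \mathrm{GL}(n,q)$ be the affine group and let $F\le F'$ be the subgroup of the affine maps whose linear part has a determinant that is a square. Put $H=N(F,F')$ and $G=N(\mathrm{Alt}(\Omega),\mathrm{Sym}(\Omega))$. Then $G$ and $H$ are compactly generated totally disconnected locally compact groups, $H\le G$, the inclusion $H\to G$ is a closed embedding with cocompact image, $G$ and $H$ are abstractly simple, and $H$ contains no lattice. If moreover $p\equiv 3\pmod 4$ (for instance $q=9$), then $G$ contains a lattice. Here a lattice in a locally compact group $G$ is a discrete subgroup $\Gamma$ such that $G/\Gamma$ carries a non-zero finite $G$-invariant regular Borel measure. -/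

import Mathlib

open scoped Pointwise

/-! ### Locally compact groups and their lattices -/

/-- A Hausdorff, totally disconnected, locally compact topological group that is generated by a
compact subset. -/
structure IsCompactlyGeneratedTDLC (G : Type*) [Group G] [TopologicalSpace G] : Prop where
  isTopologicalGroup : IsTopologicalGroup G
  t2Space : T2Space G
  totallyDisconnectedSpace : TotallyDisconnectedSpace G
  locallyCompactSpace : LocallyCompactSpace G
  exists_isCompact_closure_eq_top : ∃ S : Set G, IsCompact S ∧ Subgroup.closure S = ⊤

/-- A lattice in `G`: a discrete subgroup `Γ` such that `G ⧸ Γ` carries a non-zero finite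
regular Borel measure that is invariant under the left translations by `G`. -/
def IsLattice {G : Type*} [Group G] [TopologicalSpace G] (Γ : Subgroup G) : Prop :=
  DiscreteTopology Γ ∧
    letI : MeasurableSpace (G ⧸ Γ) := borel (G ⧸ Γ)
    ∃ μ : MeasureTheory.Measure (G ⧸ Γ), μ ≠ 0 ∧ MeasureTheory.IsFiniteMeasure μ ∧ μ.Regular ∧
      MeasureTheory.SMulInvariantMeasure G (G ⧸ Γ) μ

/-- The group `G` contains a lattice. -/
def HasLattice (G : Type*) [Group G] [TopologicalSpace G] : Prop :=
  ∃ Γ : Subgroup G, IsLattice Γ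

namespace LocalAction

section Tree

variable (Ω : Type*)

/-- The vertices of the regular tree with edges coloured by `Ω`: the words in `Ω` without two equal
consecutive letters. Such a word is the list of colours met on the way from the vertex to the
root `[]`. -/
def Vert : Type _ := {l : List Ω // l.IsChain (· ≠ ·)}

variable {Ω}

open Classical in
/-- The neighbour of the vertex `v` along the edge of colour `a`: remove the first letter of `v`
if it is `a`, and put `a` in front of `v` otherwise. -/
noncomputable def step (a : Ω) (v : Vert Ω) : Vert Ω :=
  if h : v.1.head? = some a then ⟨v.1.tail, v.2.tail⟩
  else ⟨a :: v.1, List.isChain_cons.2 ⟨fun b hb hab => h (by rw [hab]; exact hb), v.2⟩⟩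

theorem step_step (a : Ω) (v : Vert Ω) : step a (step a v) = v := by
  obtain ⟨l, hl⟩ := v
  apply Subtype.ext
  rcases l with _ | ⟨b, l⟩
  · simp [step]
  · by_cases hb : b = a
    · subst hb
      have : l.head? ≠ some b := by
        intro h
        rw [List.isChain_cons] at hl
        exact hl.1 b h rfl
      simp [step, this]
    · simp [step, hb]

theorem length_step (a : Ω) (v : Vert Ω) :
    (step a v).1.length + 1 = v.1.length ∨ (step a v).1.length = v.1.length + 1 := by
  obtain ⟨l, hl⟩ := v
  rcases l with _ | ⟨b, l⟩
  · simp [step]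
  · by_cases hb : b = a
    · simp [step, hb]
    · simp [step, hb]

theorem step_ne (a : Ω) (v : Vert Ω) : step a v ≠ v := by
  intro h
  have := length_step a v
  rw [h] at this
  omega

theorem step_left_injective (v : Vert Ω) : Function.Injective fun a : Ω => step a v := by
  intro a b h
  obtain ⟨l, hl⟩ := v
  rcases l with _ | ⟨c, l⟩
  · simpa [step, Vert] using congrArg Subtype.val h
  · by_cases ha : c = a <;> by_cases hb : c = b
    · exact ha.symm.trans hb
    · subst ha
      have := congrArg List.length (congrArg Subtype.val h)
      simp [step, hb] at this
      omega
    · subst hb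
      have := congrArg List.length (congrArg Subtype.val h)
      simp [step, ha] at this
      omega
    · have := congrArg Subtype.val h
      simpa [step, ha, hb] using this

variable (Ω) in
/-- The regular tree of degree `|Ω|`. Its edges are the pairs `{v, step a v}`, and the edge
`{v, step a v}` has the colour `a`. -/
def tree : SimpleGraph (Vert Ω) where
  Adj v w := ∃ a, step a v = w
  symm := ⟨by rintro v _ ⟨a, rfl⟩; exact ⟨a, step_step a v⟩⟩
  loopless := ⟨by rintro v ⟨a, ha⟩; exact step_ne a v ha⟩

/-- The bijection from the colours to the neighbours of `v`. Its inverse sends a neighbour `w` of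
`v` to the colour of the edge `{v, w}`. -/
noncomputable def nbr (v : Vert Ω) : Ω ≃ (tree Ω).neighborSet v :=
  Equiv.ofBijective (fun a => ⟨step a v, ⟨a, rfl⟩⟩)
    ⟨fun _ _ h => step_left_injective v (congrArg Subtype.val h),
      fun ⟨_, a, ha⟩ => ⟨a, Subtype.ext ha⟩⟩

variable (Ω) in
/-- The automorphism group of the tree. -/
abbrev TreeAut : Type _ := tree Ω ≃g tree Ω

/-- The local permutation of the automorphism `g` at the vertex `v`: the colour `a` goes to the
colour of the image under `g` of the edge of colour `a` at `v`. -/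
noncomputable def localPerm (g : TreeAut Ω) (v : Vert Ω) : Equiv.Perm Ω :=
  ((nbr v).trans (g.mapNeighborSet v)).trans (nbr (g v)).symm

theorem step_localPerm (g : TreeAut Ω) (v : Vert Ω) (a : Ω) :
    step (localPerm g v a) (g v) = g (step a v) := by
  have h : nbr (g v) (localPerm g v a) = g.mapNeighborSet v (nbr v a) := by
    simp [localPerm]
  exact congrArg Subtype.val h

theorem localPerm_eq_of {g : TreeAut Ω} {v : Vert Ω} {s : Equiv.Perm Ω}
    (h : ∀ a, step (s a) (g v) = g (step a v)) : localPerm g v = s := by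
  ext a
  exact step_left_injective (g v) ((step_localPerm g v a).trans (h a).symm)

@[simp]
theorem localPerm_one (v : Vert Ω) : localPerm (1 : TreeAut Ω) v = 1 :=
  localPerm_eq_of fun _ => rfl

theorem localPerm_mul (g h : TreeAut Ω) (v : Vert Ω) :
    localPerm (g * h) v = localPerm g (h v) * localPerm h v :=
  localPerm_eq_of fun a => by
    rw [Equiv.Perm.mul_apply, RelIso.mul_apply, RelIso.mul_apply, step_localPerm, step_localPerm]

theorem localPerm_inv (g : TreeAut Ω) (v : Vert Ω) :
    localPerm g⁻¹ v = (localPerm g (g⁻¹ v))⁻¹ := by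
  have h := localPerm_mul g g⁻¹ v
  rw [mul_inv_cancel, localPerm_one] at h
  exact eq_inv_of_mul_eq_one_right h.symm

end Tree

section Groups

variable {Ω : Type*}

/-- The Burger-Mozes group `U(F)`: all local permutations are in `F`. -/
def U (F : Subgroup (Equiv.Perm Ω)) : Subgroup (TreeAut Ω) where
  carrier := {g | ∀ v, localPerm g v ∈ F}
  one_mem' v := by rw [localPerm_one]; exact F.one_mem
  mul_mem' {g h} hg hh v := by rw [localPerm_mul]; exact F.mul_mem (hg _) (hh _)
  inv_mem' {g} hg v := by rw [localPerm_inv]; exact F.inv_mem (hg _)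

/-- The group `G(F)`: all but finitely many local permutations are in `F`. -/
def GAlmost (F : Subgroup (Equiv.Perm Ω)) : Subgroup (TreeAut Ω) where
  carrier := {g | {v | localPerm g v ∉ F}.Finite}
  one_mem' := by simp [F.one_mem]
  mul_mem' {g h} hg hh := by
    refine (hh.union (Set.Finite.preimage (f := h) h.injective.injOn hg)).subset ?_
    intro v hv
    by_contra hc
    simp only [Set.mem_union, Set.mem_ofPred_eq, Set.mem_preimage, not_or, not_not] at hc
    exact hv (by rw [localPerm_mul]; exact F.mul_mem hc.2 hc.1)
  inv_mem' {g} hg := by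
    refine (Set.Finite.preimage (f := (g⁻¹ : TreeAut Ω)) (g⁻¹).injective.injOn hg).subset ?_
    intro v hv hc
    exact hv (by rw [localPerm_inv]; exact F.inv_mem hc)

/-- The group `G(F, F')`: all local permutations are in `F'`, and all but finitely many
are in `F`. -/
def G (F F' : Subgroup (Equiv.Perm Ω)) : Subgroup (TreeAut Ω) := GAlmost F ⊓ U F'

/-- The pointwise stabilizer in `Aut(T)` of a set of vertices. -/
def fixing (S : Set (Vert Ω)) : Subgroup (TreeAut Ω) where
  carrier := {g | ∀ v ∈ S, g v = v}
  one_mem' _ _ := rfl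
  mul_mem' {g h} hg hh v hv := by rw [RelIso.mul_apply, hh v hv, hg v hv]
  inv_mem' {g} hg v hv := by
    have h := congrArg (g⁻¹ : TreeAut Ω) (hg v hv)
    rw [RelIso.inv_apply_self] at h
    exact h.symm

/-- The subgroup `N(F, F')` of `G(F, F')` generated by the derived subgroups of the pointwise
stabilizers in `G(F, F')` of the edges of the tree. -/
def N (F F' : Subgroup (Equiv.Perm Ω)) : Subgroup (TreeAut Ω) :=
  ⨆ (v : Vert Ω) (w : Vert Ω) (_ : (tree Ω).Adj v w),
    ⁅G F F' ⊓ fixing {v, w}, G F F' ⊓ fixing {v, w}⁆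

theorem N_le_G (F F' : Subgroup (Equiv.Perm Ω)) : N F F' ≤ G F F' :=
  iSup_le fun _ => iSup_le fun _ => iSup_le fun _ =>
    (Subgroup.commutator_le_self _).trans inf_le_left

/-- The key fact behind the topology of `G(F, F')`: it commensurates the pointwise stabilizers in
`U(F)` of finite sets of vertices. -/
theorem exists_conj_mem [Finite Ω] {F : Subgroup (Equiv.Perm Ω)} {g : TreeAut Ω}
    (hg : g ∈ GAlmost F) {S : Set (Vert Ω)} (hS : S.Finite) :
    ∃ S' : Set (Vert Ω), S'.Finite ∧ ∀ u ∈ U F ⊓ fixing S', g * u * g⁻¹ ∈ U F ⊓ fixing S := by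
  have hg : {v | localPerm g v ∉ F}.Finite := hg
  refine ⟨(g ⁻¹' S) ∪ ({v | localPerm g v ∉ F} ∪
    ⋃ a : Ω, step a '' {v | localPerm g v ∉ F}),
    (hS.preimage g.injective.injOn).union
      (hg.union (Set.finite_iUnion fun a => hg.image _)), ?_⟩
  rintro u ⟨huF, hu⟩
  refine ⟨fun v => ?_, fun v hv => ?_⟩
  · obtain ⟨w, rfl⟩ : ∃ w, g w = v := ⟨g⁻¹ v, RelIso.apply_inv_self g v⟩
    rw [localPerm_mul, localPerm_mul, localPerm_inv, RelIso.inv_apply_self]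
    by_cases hw : localPerm g w ∈ F
    · have huw : localPerm g (u w) ∈ F := by
        by_contra hc
        have h1 : u (u w) = u w := hu (u w) (Or.inr (Or.inl hc))
        rw [u.injective h1] at hc
        exact hc hw
      exact F.mul_mem (F.mul_mem huw (huF w)) (F.inv_mem hw)
    · have h1 : u w = w := hu w (Or.inr (Or.inl hw))
      have h2 : localPerm u w = 1 := localPerm_eq_of fun a => by
        rw [h1]
        exact (hu (step a w)
          (Or.inr (Or.inr (Set.mem_iUnion.2 ⟨a, w, hw, rfl⟩)))).symm
      rw [h1, h2, mul_one, mul_inv_cancel]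
      exact F.one_mem
  · rw [RelIso.mul_apply, RelIso.mul_apply]
    have h1 : u (g⁻¹ v) = g⁻¹ v := by
      refine hu _ (Or.inl ?_)
      rw [Set.mem_preimage, RelIso.apply_inv_self]
      exact hv
    rw [h1, RelIso.apply_inv_self]

/-- The neighbourhoods of the identity in `G(F, F')`: the pointwise stabilizers in `U(F)` of the
finite sets of vertices. They are a basis of neighbourhoods of the identity in `U(F)` for the
permutation topology. -/
@[reducible]
def basisG [Finite Ω] (F F' : Subgroup (Equiv.Perm Ω)) : GroupFilterBasis (G F F') where
  sets := {V | ∃ S : Set (Vert Ω), S.Finite ∧ V = {g : G F F' | (g : TreeAut Ω) ∈ U F ⊓ fixing S}}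
  nonempty := ⟨_, ∅, Set.finite_empty, rfl⟩
  inter_sets := by
    rintro _ _ ⟨S, hS, rfl⟩ ⟨T, hT, rfl⟩
    exact ⟨_, ⟨S ∪ T, hS.union hT, rfl⟩, fun g hg =>
      ⟨⟨hg.1, fun v hv => hg.2 v (Or.inl hv)⟩, ⟨hg.1, fun v hv => hg.2 v (Or.inr hv)⟩⟩⟩
  one' := by
    rintro _ ⟨S, hS, rfl⟩
    exact (U F ⊓ fixing S).one_mem
  mul' := by
    rintro _ ⟨S, hS, rfl⟩
    refine ⟨_, ⟨S, hS, rfl⟩, ?_⟩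
    rintro _ ⟨g, hg, h, hh, rfl⟩
    exact (U F ⊓ fixing S).mul_mem hg hh
  inv' := by
    rintro _ ⟨S, hS, rfl⟩
    exact ⟨_, ⟨S, hS, rfl⟩, fun g hg => (U F ⊓ fixing S).inv_mem hg⟩
  conj' := by
    rintro g _ ⟨S, hS, rfl⟩
    obtain ⟨S', hS', h⟩ := exists_conj_mem g.2.1 hS
    exact ⟨_, ⟨S', hS', rfl⟩, fun u hu => h u hu⟩

/-- The group topology on `G(F, F')` for which (when `F ≤ F'`) the inclusion of `U(F)`, with the
permutation topology, is continuous and open. -/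
instance [Finite Ω] (F F' : Subgroup (Equiv.Perm Ω)) : TopologicalSpace (G F F') :=
  (basisG F F').topology

instance [Finite Ω] (F F' : Subgroup (Equiv.Perm Ω)) : IsTopologicalGroup (G F F') :=
  (basisG F F').isTopologicalGroup

/-- The topology on `N(F, F')` is the subspace topology from `G(F, F')`. -/
instance [Finite Ω] (F F' : Subgroup (Equiv.Perm Ω)) : TopologicalSpace (N F F') :=
  TopologicalSpace.induced (Subgroup.inclusion (N_le_G F F')) inferInstance

instance [Finite Ω] (F F' : Subgroup (Equiv.Perm Ω)) : IsTopologicalGroup (N F F') :=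
  topologicalGroup_induced _

end Groups

section Affine

open Matrix

variable (n : ℕ) (K : Type*) [Field K]

/-- The group of the permutations `x ↦ A x + b` of `Kⁿ` with `A` in `GL(n, K)`. -/
def affine : Subgroup (Equiv.Perm (Fin n → K)) where
  carrier := {s | ∃ (A : GL (Fin n) K) (b : Fin n → K), ∀ x, s x = A.1 *ᵥ x + b}
  one_mem' := ⟨1, 0, by simp⟩
  mul_mem' := by
    rintro s t ⟨A, b, hs⟩ ⟨B, c, ht⟩
    exact ⟨A * B, A.1 *ᵥ c + b, fun x => by
      simp [hs, ht, mulVec_add, mulVec_mulVec, add_assoc]⟩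
  inv_mem' := by
    rintro s ⟨A, b, hs⟩
    refine ⟨A⁻¹, -((A⁻¹).1 *ᵥ b), fun x => s.injective ?_⟩
    rw [show s (s⁻¹ x) = x from s.apply_symm_apply x, hs, mulVec_add, mulVec_neg, mulVec_mulVec, mulVec_mulVec,
      ← Units.val_mul, mul_inv_cancel]
    simp

/-- The group of the permutations `x ↦ A x + b` of `Kⁿ` with `A` in `GL(n, K)` and `det A` a
square in `K`. -/
def squareAffine : Subgroup (Equiv.Perm (Fin n → K)) where
  carrier := {s | ∃ (A : GL (Fin n) K) (b : Fin n → K),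
    IsSquare A.1.det ∧ ∀ x, s x = A.1 *ᵥ x + b}
  one_mem' := ⟨1, 0, by simp⟩
  mul_mem' := by
    rintro s t ⟨A, b, hA, hs⟩ ⟨B, c, hB, ht⟩
    exact ⟨A * B, A.1 *ᵥ c + b, by
      rw [Units.val_mul, det_mul]; exact hA.mul hB, fun x => by
      simp [hs, ht, mulVec_add, mulVec_mulVec, add_assoc]⟩
  inv_mem' := by
    rintro s ⟨A, b, hA, hs⟩
    refine ⟨A⁻¹, -((A⁻¹).1 *ᵥ b), ?_, fun x => s.injective ?_⟩
    · rw [coe_units_inv, det_nonsing_inv, Ring.inverse_eq_inv']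
      exact hA.inv
    · rw [show s (s⁻¹ x) = x from s.apply_symm_apply x, hs, mulVec_add, mulVec_neg, mulVec_mulVec, mulVec_mulVec,
        ← Units.val_mul, mul_inv_cancel]
      simp

end Affine

end LocalAction

open scoped Pointwise

set_option linter.unusedSectionVars false

/-! Both groups are of the form N(F, A), where F is the set of even permutations in A. For the
affine group this follows from Zolotarev's lemma: the sign of x ↦ Mx + b is the quadratic character
of det M (`sign_linPerm`), translations being of odd order.

Under mild conditions (`IsAmple`), N(F, A) has an explicit description (`IsAmple.N_eq`). It is the
group `evenAut A` of the type-preserving automorphisms with local permutations in A, finitely many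
of them odd, and evenly many odd ones on each of the two classes of vertices. One inclusion holds
because these parities are homomorphisms to an abelian group. For the other, a subgroup normalized
by U(F) that contains the commutators of elements of U(F) supported in a half-tree contains the
type-preserving part of U(F) (`mem_of_mem_U`). Elements that are odd at exactly two vertices
(`exists_pair`) then generate the rest. A double commutator puts the commutators of half-tree
elements into every nontrivial normal subgroup, and the same generation criterion gives simplicity.

By this description, A ≤ A' gives N(F, A) ≤ N(F', A'). The image is closed because it is cut out by
local conditions. It is cocompact because the signs of any element of the larger group can be
cancelled by an element of the smaller one, which leaves an element of a compact vertex stabilizer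
(`exists_mul_mem`).

Lattice: suppose A contains a group A' whose even part acts freely and transitively on the colours.
Then `evenAut A'` is a complement in N(F, A) of the compact open stabilizer in U(F) of an edge.
Simple nonabelian groups are unimodular, so a countable complement of a compact open subgroup is a
lattice. For Sym(Ω) one takes the translations of Ω together with an odd additive involution. When p
≡ 3 (mod 4), negating one coordinate over the prime field is such an involution.

No lattice: when q ≡ 1 (mod 4), affine involutions have determinant ±1, a square, and are even. Let
Γ be a lattice, B_n the stabilizer in U(F) of the ball of radius n, s_n the number of vertices at
distance n from the root, d the degree, and m_n the measure of the image of B_n in the quotient by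
Γ. For large n, Γ meets B_n trivially. It then meets the larger group `levelStab`, in which odd
local permutations are allowed on the sphere, trivially as well: an element of the intersection has
its square in B_n, so it acts by involutions on the sphere and is even there. Hence 2^(s_n - 1)
translates of B_n have disjoint images, and 2^(s_n - 1) m_n is bounded. But point stabilizers in F
have at most 2^(d-3) elements, so m_n ≤ 2^((d-3) s_n) m_(n+1), while s_(n+1) ≥ (d-1) s_n. So 2^(s_n)
m_n at least doubles with n, a contradiction (`false_of_growth`). -/

namespace LocalAction

/-! ### Words, portraits and the construction of tree automorphisms -/

section Words

variable {Ω : Type*}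

/-- The root of the tree: the empty word. -/
def root : Vert Ω := ⟨[], List.isChain_nil⟩

theorem root_val : (root : Vert Ω).1 = [] := rfl

theorem eq_root_iff {v : Vert Ω} : v = root ↔ v.1 = [] :=
  ⟨fun h => by rw [h]; rfl, fun h => Subtype.ext h⟩

theorem step_val_of_ne {a : Ω} {v : Vert Ω} (h : v.1.head? ≠ some a) :
    (step a v).1 = a :: v.1 := by
  simp [step, h]

theorem step_val_of_eq {a : Ω} {v : Vert Ω} (h : v.1.head? = some a) :
    (step a v).1 = v.1.tail := by
  simp [step, h]

theorem head?_step_of_ne {a : Ω} {v : Vert Ω} (h : v.1.head? ≠ some a) :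
    (step a v).1.head? = some a := by
  rw [step_val_of_ne h, List.head?_cons]

theorem head?_step_of_eq {a : Ω} {v : Vert Ω} (h : v.1.head? = some a) :
    (step a v).1.head? ≠ some a := by
  intro h'
  have h1 := step_val_of_eq h'
  rw [step_step, step_val_of_eq h] at h1
  have h2 := congrArg List.length h1
  have h3 : v.1 ≠ [] := fun h0 => by simp [h0] at h
  have h4 := List.length_pos_of_ne_nil h3
  simp at h2
  have h5 : v.1.tail = [] := List.eq_nil_of_length_eq_zero (by simp; omega)
  rw [step_val_of_eq h, h5] at h'
  simp at h'

/-- Induction along the words. -/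
theorem Vert.induction {P : Vert Ω → Prop} (h0 : P root)
    (hs : ∀ a v, v.1.head? ≠ some a → P v → P (step a v)) (v : Vert Ω) : P v := by
  obtain ⟨l, hl⟩ := v
  induction l with
  | nil => exact h0
  | cons a l ih =>
    have hl' := List.isChain_cons.1 hl
    have hne : (⟨l, hl'.2⟩ : Vert Ω).1.head? ≠ some a := fun h => hl'.1 a h rfl
    have h := hs a ⟨l, hl'.2⟩ hne (ih hl'.2)
    have he : step a ⟨l, hl'.2⟩ = (⟨a :: l, hl⟩ : Vert Ω) := Subtype.ext (step_val_of_ne hne)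
    rwa [he] at h

/-- Induction along the paths of the tree. -/
theorem Vert.step_induction {P : Vert Ω → Prop} (h0 : P root)
    (hs : ∀ a v, P v → P (step a v)) (v : Vert Ω) : P v :=
  Vert.induction h0 (fun a v _ => hs a v) v

theorem exists_step_eq {v : Vert Ω} (h : v ≠ root) :
    ∃ a u, u.1.head? ≠ some a ∧ step a u = v := by
  induction v using Vert.induction with
  | h0 => exact absurd rfl h
  | hs a u hu _ => exact ⟨a, u, hu, rfl⟩

theorem length_step_mod_two (a : Ω) (v : Vert Ω) :
    (step a v).1.length % 2 = (v.1.length + 1) % 2 := by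
  have := length_step a v
  omega

theorem apply_step (g : TreeAut Ω) (a : Ω) (v : Vert Ω) :
    g (step a v) = step (localPerm g v a) (g v) :=
  (step_localPerm g v a).symm

/-- The image edge has a single colour, read from either end. This is the only compatibility
condition on a family of local permutations, see `exists_aut_of_portrait`. -/
theorem localPerm_step (g : TreeAut Ω) (a : Ω) (v : Vert Ω) :
    localPerm g (step a v) a = localPerm g v a := by
  apply step_left_injective (g (step a v))
  simp only [step_localPerm, step_step]
  rw [apply_step, step_step]

/-- An automorphism that agrees with `h` at a vertex and at its neighbours has the same local
permutation there. -/
theorem localPerm_congr {g h : TreeAut Ω} {v : Vert Ω} (hv : g v = h v)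
    (hn : ∀ a, g (step a v) = h (step a v)) : localPerm g v = localPerm h v :=
  localPerm_eq_of fun a => by rw [hv, hn, step_localPerm]

/-- An automorphism of the tree from a bijection that moves the coloured edges by
permutations of the colours. -/
def autOfStep (f : Equiv.Perm (Vert Ω)) (s : Vert Ω → Equiv.Perm Ω)
    (hf : ∀ a v, f (step a v) = step (s v a) (f v)) : TreeAut Ω where
  toEquiv := f
  map_rel_iff' := by
    intro v w
    constructor
    · rintro ⟨b, hb⟩
      refine ⟨(s v).symm b, f.injective ?_⟩
      rw [hf, Equiv.apply_symm_apply, hb]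
    · rintro ⟨a, rfl⟩
      exact ⟨s v a, (hf a v).symm⟩

theorem localPerm_autOfStep (f : Equiv.Perm (Vert Ω)) (s : Vert Ω → Equiv.Perm Ω)
    (hf : ∀ a v, f (step a v) = step (s v a) (f v)) (v : Vert Ω) :
    localPerm (autOfStep f s hf) v = s v :=
  localPerm_eq_of fun a => (hf a v).symm

open Classical in
/-- The map of the words that starts at `w` and follows the portrait `s`. -/
noncomputable def walk (w : Vert Ω) (s : Vert Ω → Equiv.Perm Ω) : List Ω → Vert Ω
  | [] => w
  | a :: l => step (if h : l.IsChain (· ≠ ·) then s ⟨l, h⟩ a else a) (walk w s l)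

/-- When the step lengthens the word this is the recursion defining `walk`. Otherwise the same edge
is read from its other end, where `hs` gives the same colour. -/
theorem walk_step (w : Vert Ω) {s : Vert Ω → Equiv.Perm Ω}
    (hs : ∀ a v, s (step a v) a = s v a) (a : Ω) (v : Vert Ω) :
    walk w s (step a v).1 = step (s v a) (walk w s v.1) := by
  have key : ∀ a v, v.1.head? ≠ some a →
      walk w s (step a v).1 = step (s v a) (walk w s v.1) := by
    intro a v h
    rw [step_val_of_ne h, walk, dif_pos v.2]
    rfl
  by_cases h : v.1.head? = some a
  · have h1 := key a (step a v) (head?_step_of_eq h)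
    rw [step_step, hs] at h1
    rw [h1, step_step]
  · exact key a v h

/-- The tree is a Cayley graph of a free product of groups of order two. The colour-preserving map
exchanging the ends of an edge is an involution, hence bijective. -/
theorem exists_translation_step (a : Ω) :
    ∃ g ∈ U (⊥ : Subgroup (Equiv.Perm Ω)), g root = step a root := by
  let f : Vert Ω → Vert Ω := fun v => walk (step a root) (fun _ => 1) v.1
  have hf : ∀ b v, f (step b v) = step b (f v) := fun b v =>
    walk_step _ (fun _ _ => rfl) b v
  have hr : f root = step a root := rfl
  have hff : Function.Involutive f := by
    intro v
    induction v using Vert.induction with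
    | h0 => rw [hr, hf, hr, step_step]
    | hs b v _ ih => rw [hf, hf, ih]
  refine ⟨autOfStep (Function.Involutive.toPerm f hff) (fun _ => 1) hf, fun v => ?_, hr⟩
  exact (localPerm_autOfStep (Function.Involutive.toPerm f hff) (fun _ => 1) hf v).symm ▸ one_mem _

theorem U_mono {F F' : Subgroup (Equiv.Perm Ω)} (h : F ≤ F') : U F ≤ U F' :=
  fun _ hg v => h (hg v)

theorem mem_U_bot {g : TreeAut Ω} :
    g ∈ U (⊥ : Subgroup (Equiv.Perm Ω)) ↔ ∀ v, localPerm g v = 1 :=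
  Iff.rfl

theorem exists_translation (w : Vert Ω) :
    ∃ g ∈ U (⊥ : Subgroup (Equiv.Perm Ω)), g root = w := by
  induction w using Vert.induction with
  | h0 => exact ⟨1, one_mem _, rfl⟩
  | hs a v _ ih =>
    obtain ⟨g, hg, hgv⟩ := ih
    obtain ⟨h, hh, hhr⟩ := exists_translation_step a
    refine ⟨g * h, mul_mem hg hh, ?_⟩
    rw [RelIso.mul_apply, hhr, apply_step, mem_U_bot.1 hg, hgv]
    rfl

/-- The automorphism that preserves the colours and moves the root to `w`. -/
noncomputable def transl (w : Vert Ω) : TreeAut Ω := (exists_translation w).choose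

theorem transl_mem_U (F : Subgroup (Equiv.Perm Ω)) (w : Vert Ω) : transl w ∈ U F :=
  U_mono bot_le (exists_translation w).choose_spec.1

@[simp]
theorem transl_root (w : Vert Ω) : transl w root = w := (exists_translation w).choose_spec.2

@[simp]
theorem localPerm_transl (w v : Vert Ω) : localPerm (transl w) v = 1 :=
  (exists_translation w).choose_spec.1 v

theorem transl_step (w : Vert Ω) (a : Ω) (v : Vert Ω) :
    transl w (step a v) = step a (transl w v) := by
  rw [apply_step, localPerm_transl]
  rfl

@[simp]
theorem localPerm_transl_inv (w v : Vert Ω) : localPerm (transl w)⁻¹ v = 1 := by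
  rw [localPerm_inv, localPerm_transl, inv_one]

theorem transl_inv_apply (w : Vert Ω) : (transl w)⁻¹ w = root := by
  have := RelIso.inv_apply_self (transl w) root
  rwa [transl_root] at this

/-- A map of the tree that fixes the root and follows a portrait preserves the lengths
and moves the heads by the portrait. -/
theorem exists_aut_of_portrait (s : Vert Ω → Equiv.Perm Ω)
    (hs : ∀ a v, s (step a v) a = s v a) :
    ∃ g : TreeAut Ω, g root = root ∧ ∀ v, localPerm g v = s v := by
  let f : Vert Ω → Vert Ω := fun v => walk root s v.1
  have hf : ∀ b v, f (step b v) = step (s v b) (f v) := fun b v => walk_step _ hs b v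
  have hr : f root = root := rfl
  -- The colour towards the root is moved by the portrait, so steps away from the root go to steps
  -- away from the root. This gives `hcons`, from which injectivity is read off letter by letter.
  have hhead : ∀ v, (f v).1.head? = v.1.head?.map (s v) := by
    intro v
    induction v using Vert.induction with
    | h0 => rfl
    | hs a v hv ih =>
      have h1 : (f v).1.head? ≠ some (s v a) := by
        rw [ih]
        cases hd : v.1.head? with
        | none => simp
        | some b =>
          simp only [Option.map_some, ne_eq, Option.some.injEq, EmbeddingLike.apply_eq_iff_eq]
          rintro rfl
          exact hv hd
      rw [hf, head?_step_of_ne h1, head?_step_of_ne hv, Option.map_some, hs]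
  have hcons : ∀ a v, v.1.head? ≠ some a → (f (step a v)).1 = s v a :: (f v).1 := by
    intro a v hv
    rw [hf, step_val_of_ne]
    rw [hhead]
    cases hd : v.1.head? with
    | none => simp
    | some b =>
      simp only [Option.map_some, ne_eq, Option.some.injEq, EmbeddingLike.apply_eq_iff_eq]
      rintro rfl
      exact hv hd
  have hinj : Function.Injective f := by
    intro v
    induction v using Vert.induction with
    | h0 =>
      intro w hw
      by_contra hne
      obtain ⟨a, u, hu, rfl⟩ := exists_step_eq (Ne.symm hne)
      have h1 := hcons a u hu
      rw [← hw, hr, root_val] at h1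
      simp at h1
    | hs a v hv ih =>
      intro w hw
      have hwr : w ≠ root := by
        rintro rfl
        have h1 := hcons a v hv
        rw [hw, hr, root_val] at h1
        simp at h1
      obtain ⟨b, u, hu, rfl⟩ := exists_step_eq hwr
      have h1 := congrArg Subtype.val hw
      rw [hcons a v hv, hcons b u hu, List.cons.injEq] at h1
      have h2 := ih (Subtype.ext h1.2)
      subst h2
      rw [(s v).injective h1.1]
  have hsurj : Function.Surjective f := by
    intro w
    induction w using Vert.induction with
    | h0 => exact ⟨root, hr⟩
    | hs b w _ ih =>
      obtain ⟨v, rfl⟩ := ih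
      exact ⟨step ((s v).symm b) v, by rw [hf, Equiv.apply_symm_apply]⟩
  exact ⟨autOfStep (Equiv.ofBijective f ⟨hinj, hsurj⟩) s hf, hr, fun v =>
    localPerm_autOfStep _ _ _ v⟩

/-- Automorphisms that fix the root can be built from the root outwards: the local permutation
at the root is arbitrary, and the one at a vertex can be chosen freely among those with the
prescribed value on the colour of the edge towards the root. -/
theorem exists_aut_of_rule (s₀ : Equiv.Perm Ω) (ρ : Vert Ω → Ω → Ω → Equiv.Perm Ω)
    (hρ : ∀ v a b, ρ v a b a = b) :
    ∃ g : TreeAut Ω, g root = root ∧ localPerm g root = s₀ ∧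
      ∀ a v, v.1.head? ≠ some a →
        localPerm g (step a v) = ρ (step a v) a (localPerm g v a) := by
  classical
  -- Recursion from the root outwards; the value on words that are not reduced is a dummy.
  let S : List Ω → Equiv.Perm Ω := fun l => List.rec s₀ (fun a l s =>
    if h : (a :: l).IsChain (· ≠ ·) then ρ ⟨a :: l, h⟩ a (s a) else s) l
  let s : Vert Ω → Equiv.Perm Ω := fun v => S v.1
  have key : ∀ a v, v.1.head? ≠ some a → s (step a v) = ρ (step a v) a (s v a) := by
    intro a v hv
    have hval := step_val_of_ne hv
    have hch : (a :: v.1).IsChain (· ≠ ·) := hval ▸ (step a v).2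
    have he : step a v = ⟨a :: v.1, hch⟩ := Subtype.ext hval
    rw [he]
    change S (a :: v.1) = _
    change (if h : (a :: v.1).IsChain (· ≠ ·) then ρ ⟨a :: v.1, h⟩ a (S v.1 a) else S v.1) = _
    rw [dif_pos hch]
  have hs : ∀ a v, s (step a v) a = s v a := by
    intro a v
    by_cases h : v.1.head? = some a
    · have h1 := key a (step a v) (head?_step_of_eq h)
      rw [step_step] at h1
      rw [h1, hρ]
    · rw [key a v h, hρ]
  obtain ⟨g, hg, hgs⟩ := exists_aut_of_portrait s hs
  refine ⟨g, hg, hgs root, fun a v hv => ?_⟩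
  rw [hgs, hgs, key a v hv]

/-- The set of the words with the last letter `a`, which is the half-tree beyond the edge of
colour `a` at the root. -/
def branch (a : Ω) : Set (Vert Ω) := {v | v.1.getLast? = some a}

theorem mem_branch {a : Ω} {v : Vert Ω} : v ∈ branch a ↔ v.1.getLast? = some a := Iff.rfl

theorem root_notMem_branch (a : Ω) : root ∉ branch a := by
  simp [mem_branch, root_val]

theorem getLast?_step_of_ne {a : Ω} {v : Vert Ω} (h : v.1.head? ≠ some a) :
    (step a v).1.getLast? = some (v.1.getLast?.getD a) := by
  rw [step_val_of_ne h, List.getLast?_cons]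

theorem getLast?_step_root (a : Ω) : (step a (root : Vert Ω)).1.getLast? = some a := by
  rw [getLast?_step_of_ne (by simp [root_val])]
  simp [root_val]

theorem step_root_mem_branch (a : Ω) : step a root ∈ branch a := getLast?_step_root a

theorem exists_mem_branch {v : Vert Ω} (h : v ≠ root) : ∃ a, v ∈ branch a := by
  have : v.1 ≠ [] := fun h' => h (eq_root_iff.2 h')
  exact ⟨v.1.getLast this, List.getLast?_eq_some_getLast this⟩

/-- The last letter changes only at the root. -/
theorem step_mem_branch_iff {a b : Ω} {v : Vert Ω} (h : v ≠ root) (h' : step b v ≠ root) :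
    step b v ∈ branch a ↔ v ∈ branch a := by
  have key : ∀ (v : Vert Ω), v ≠ root → v.1.head? ≠ some b →
      (step b v ∈ branch a ↔ v ∈ branch a) := by
    intro v h hv
    obtain ⟨c, hc⟩ := exists_mem_branch h
    rw [mem_branch] at hc
    rw [mem_branch, mem_branch, getLast?_step_of_ne hv, hc]
    simp
  by_cases hv : v.1.head? = some b
  · have := key (step b v) h' (head?_step_of_eq hv)
    rw [step_step] at this
    exact this.symm
  · exact key v h hv

theorem step_eq_root_iff {a : Ω} {v : Vert Ω} : step a v = root ↔ v = step a root := by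
  constructor
  · intro h
    rw [← h, step_step]
  · rintro rfl
    exact step_step a root

/-- If the image of the first edge of colour `a` at the root leads away from the root, then so do
the images of all further edges of the half-tree `branch a`. -/
theorem apply_mem_branch (g : TreeAut Ω) {a : Ω}
    (ha : (g root).1.head? ≠ some (localPerm g root a)) {v : Vert Ω} (hv : v ∈ branch a) :
    (g v).1.getLast? = (step (localPerm g root a) (g root)).1.getLast? ∧
      (g v).1.head? = v.1.head?.map (localPerm g v) := by
  induction v using Vert.induction with
  | h0 => exact absurd hv (root_notMem_branch a)
  | hs b v hb ih =>
    rw [head?_step_of_ne hb, Option.map_some, localPerm_step, apply_step]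
    by_cases hr : v = root
    · subst hr
      rw [mem_branch, getLast?_step_root, Option.some.injEq] at hv
      subst hv
      exact ⟨rfl, head?_step_of_ne ha⟩
    · have hne : step b v ≠ root := fun h => by
        have := congrArg Subtype.val h
        rw [step_val_of_ne hb, root_val] at this
        simp at this
      obtain ⟨ih1, ih2⟩ := ih ((step_mem_branch_iff hr hne).1 hv)
      have h1 : (g v).1.head? ≠ some (localPerm g v b) := by
        rw [ih2]
        cases hd : v.1.head? with
        | none => simp
        | some c =>
          simp only [Option.map_some, ne_eq, Option.some.injEq, EmbeddingLike.apply_eq_iff_eq]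
          rintro rfl
          exact hb hd
      refine ⟨?_, head?_step_of_ne h1⟩
      rw [getLast?_step_of_ne h1, ih1, getLast?_step_of_ne ha]
      rfl

theorem apply_mem_branch_of_root {g : TreeAut Ω} (hg : g root = root) {a : Ω} {v : Vert Ω}
    (hv : v ∈ branch a) : g v ∈ branch (localPerm g root a) := by
  have h := (apply_mem_branch g (a := a) (by rw [hg]; simp [root_val]) hv).1
  rw [hg, getLast?_step_root] at h
  exact h

end Words

end LocalAction

namespace LocalAction

/-! ### Type-preserving automorphisms and prescribed actions on spheres -/

section Types

variable {Ω : Type*}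

theorem length_step_of_ne {a : Ω} {v : Vert Ω} (h : v.1.head? ≠ some a) :
    (step a v).1.length = v.1.length + 1 := by
  rw [step_val_of_ne h, List.length_cons]

/-- A step changes the parity of both lengths, so an automorphism preserves or exchanges the two
classes of vertices as a whole. -/
theorem length_apply_add_mod_two (g : TreeAut Ω) (v : Vert Ω) :
    ((g v).1.length + v.1.length) % 2 = (g root).1.length % 2 := by
  induction v using Vert.step_induction with
  | h0 => simp [root_val]
  | hs a v ih =>
    have h1 := length_step_mod_two a v
    have h2 := length_step_mod_two (localPerm g v a) (g v)
    rw [apply_step]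
    omega

variable (Ω) in
/-- The automorphisms of the tree that preserve the parity of the distance to the root. -/
def typePreserving : Subgroup (TreeAut Ω) where
  carrier := {g | ∀ v, (g v).1.length % 2 = v.1.length % 2}
  one_mem' _ := rfl
  mul_mem' {g h} hg hh v := by rw [RelIso.mul_apply, hg, hh]
  inv_mem' {g} hg v := by rw [← hg (g⁻¹ v), RelIso.apply_inv_self]

theorem mem_typePreserving_of_apply {g : TreeAut Ω} {v : Vert Ω}
    (h : (g v).1.length % 2 = v.1.length % 2) : g ∈ typePreserving Ω := by
  intro w
  have h1 := length_apply_add_mod_two g v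
  have h2 := length_apply_add_mod_two g w
  omega

theorem mem_typePreserving_of_fixed {g : TreeAut Ω} {v : Vert Ω} (h : g v = v) :
    g ∈ typePreserving Ω :=
  mem_typePreserving_of_apply (v := v) (by rw [h])

theorem transl_mem_typePreserving {w : Vert Ω} (h : w.1.length % 2 = 0) :
    transl w ∈ typePreserving Ω :=
  mem_typePreserving_of_apply (v := root) (by rw [transl_root, h]; rfl)

/-- A homomorphism-like cancellation: if the local permutations of an automorphism fixing the
root are trivial off a half-tree, then so is the automorphism. -/
theorem mem_fixing_compl_branch {g : TreeAut Ω} (hg : g root = root) {a : Ω}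
    (h : ∀ v, v ∉ branch a → localPerm g v = 1) : g ∈ fixing (branch a)ᶜ := by
  intro v hv
  induction v using Vert.induction with
  | h0 => exact hg
  | hs b v hb ih =>
    have hne : step b v ≠ root := fun h => by
      have := congrArg Subtype.val h
      rw [step_val_of_ne hb, root_val] at this
      simp at this
    have hv' : v ∉ branch a := by
      by_cases hr : v = root
      · rw [hr]; exact root_notMem_branch a
      · exact fun h => hv ((step_mem_branch_iff hr hne).2 h)
    rw [apply_step, h v hv', ih hv']
    rfl

/-- Automorphisms that are trivial in the ball of radius `n` and have prescribed local
permutations on the sphere of radius `n`. -/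
theorem exists_aut_of_level {F : Subgroup (Equiv.Perm Ω)} (hF : ∀ a b, ∃ s ∈ F, s a = b)
    {n : ℕ} (hn : 1 ≤ n) (τ : Vert Ω → Equiv.Perm Ω)
    (hτ : ∀ a v, v.1.head? ≠ some a → v.1.length + 1 = n → τ (step a v) a = a) :
    ∃ g : TreeAut Ω, (∀ v, v.1.length ≤ n → g v = v) ∧
      (∀ v, v.1.length < n → localPerm g v = 1) ∧
      (∀ v, v.1.length = n → localPerm g v = τ v) ∧
      (∀ v, n < v.1.length → localPerm g v ∈ F) ∧
      ∀ a v, v.1.head? ≠ some a → n ≤ v.1.length → localPerm g v a = a →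
        localPerm g (step a v) = 1 := by
  classical
  choose f hfF hf using hF
  -- The rule needs a value for all pairs of colours. The test `τ v a = b` uses τ only where it is
  -- compatible; otherwise the identity is preferred, and an element of F serves when a ≠ b.
  obtain ⟨g, hg, hg1, hg2⟩ := exists_aut_of_rule (Ω := Ω) 1
    (fun v a b => if v.1.length = n ∧ τ v a = b then τ v else if a = b then 1 else f a b) (by
      intro v a b
      split_ifs with h1 h2
      · exact h1.2
      · exact h2
      · exact hf a b)
  have hlow : ∀ v, v.1.length < n → localPerm g v = 1 := by
    intro v
    induction v using Vert.induction with
    | h0 => exact fun _ => hg1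
    | hs a v hv ih =>
      intro hl
      rw [length_step_of_ne hv] at hl
      rw [hg2 a v hv, ih (by omega), if_neg, if_pos (Equiv.Perm.one_apply a).symm]
      rw [length_step_of_ne hv]
      omega
  refine ⟨g, ?_, hlow, ?_, ?_, ?_⟩
  · intro v
    induction v using Vert.induction with
    | h0 => exact fun _ => hg
    | hs a v hv ih =>
      intro hl
      rw [length_step_of_ne hv] at hl
      rw [apply_step, hlow v (by omega), ih (by omega)]
      rfl
  · intro v hv
    have hr : v ≠ root := by
      rintro rfl
      rw [root_val, List.length_nil] at hv
      omega
    obtain ⟨a, u, hu, rfl⟩ := exists_step_eq hr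
    have hl := hv
    rw [length_step_of_ne hu] at hl
    rw [hg2 a u hu, hlow u (by omega), if_pos]
    exact ⟨hv, hτ a u hu hl⟩
  · intro v hv
    have hr : v ≠ root := by
      rintro rfl
      rw [root_val, List.length_nil] at hv
      omega
    obtain ⟨a, u, hu, rfl⟩ := exists_step_eq hr
    rw [hg2 a u hu, if_neg (by omega)]
    split_ifs
    · exact one_mem _
    · exact hfF _ _
  · intro a v hv hl h
    rw [hg2 a v hv, if_neg, if_pos h.symm]
    rw [length_step_of_ne hv]
    omega

end Types

/-! ### Signs of local permutations and the parity description -/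

section Signs

variable {Ω : Type*} [Fintype Ω] [DecidableEq Ω]

/-- The sign of the local permutation of `g` at `v`. -/
noncomputable def sgn (g : TreeAut Ω) (v : Vert Ω) : ℤˣ := Equiv.Perm.sign (localPerm g v)

theorem sgn_one (v : Vert Ω) : sgn (1 : TreeAut Ω) v = 1 := by
  rw [sgn, localPerm_one, map_one]

theorem sgn_mul (g h : TreeAut Ω) (v : Vert Ω) : sgn (g * h) v = sgn g (h v) * sgn h v := by
  rw [sgn, localPerm_mul, map_mul]
  rfl

theorem sgn_inv (g : TreeAut Ω) (v : Vert Ω) : sgn g⁻¹ v = sgn g (g⁻¹ v) := by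
  rw [sgn, localPerm_inv, map_inv, Int.units_inv_eq_self]
  rfl

/-- The vertices at which the local permutation of `g` is odd. -/
def oddSet (g : TreeAut Ω) : Set (Vert Ω) := {v | sgn g v ≠ 1}

theorem mem_oddSet {g : TreeAut Ω} {v : Vert Ω} : v ∈ oddSet g ↔ sgn g v ≠ 1 := Iff.rfl

theorem oddSet_mul_finite {g h : TreeAut Ω} (hg : (oddSet g).Finite) (hh : (oddSet h).Finite) :
    (oddSet (g * h)).Finite := by
  refine (hh.union (Set.Finite.preimage (f := h) h.injective.injOn hg)).subset ?_
  intro v hv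
  by_contra hc
  simp only [Set.mem_union, Set.mem_preimage, mem_oddSet, not_or, not_not] at hc
  exact hv (by rw [sgn_mul, hc.1, hc.2, one_mul])

theorem oddSet_inv_finite {g : TreeAut Ω} (hg : (oddSet g).Finite) : (oddSet g⁻¹).Finite := by
  refine (Set.Finite.preimage (f := (g⁻¹ : TreeAut Ω)) (g⁻¹).injective.injOn hg).subset ?_
  intro v hv
  rwa [mem_oddSet, sgn_inv] at hv

/-- The product of the signs of the local permutations of `g` at the vertices whose distance to the
root has the parity `i`. -/
noncomputable def parity (i : ℕ) (g : TreeAut Ω) : ℤˣ :=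
  ∏ᶠ v : Vert Ω, if v.1.length % 2 = i then sgn g v else 1

theorem parity_eq_one_of_oddSet {i : ℕ} {g : TreeAut Ω} (h : ∀ v, sgn g v = 1) :
    parity i g = 1 := by
  rw [parity]
  simp [h]

/-- Take the product of the cocycle identity `sgn_mul` over a class of vertices. Since h preserves
the class, the factors of g can be reindexed by h. -/
theorem parity_mul {i : ℕ} {g h : TreeAut Ω} (hg : (oddSet g).Finite) (hh : (oddSet h).Finite)
    (ht : h ∈ typePreserving Ω) : parity i (g * h) = parity i g * parity i h := by
  have key : ∀ k : TreeAut Ω, (oddSet k).Finite →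
      (Function.mulSupport fun v : Vert Ω => if v.1.length % 2 = i then sgn k v else 1).Finite := by
    intro k hk
    refine hk.subset fun v hv => ?_
    rw [Function.mem_mulSupport] at hv
    by_contra h1
    rw [mem_oddSet, not_not] at h1
    simp [h1] at hv
  have h1 : parity i g = ∏ᶠ v : Vert Ω, if (h v).1.length % 2 = i then sgn g (h v) else 1 :=
    (finprod_comp_equiv h.toEquiv (f := fun v : Vert Ω =>
      if v.1.length % 2 = i then sgn g v else 1)).symm
  rw [h1, parity, parity, ← finprod_mul_distrib]
  · refine finprod_congr fun v => ?_
    rw [sgn_mul, ht v]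
    split_ifs
    · rfl
    · simp
  · exact (key g hg).preimage (f := fun v => h v) h.injective.injOn
  · exact key h hh

theorem parity_eq_neg_one {g : TreeAut Ω} {v : Vert Ω} (hv : sgn g v ≠ 1)
    (h : ∀ w, w.1.length % 2 = v.1.length % 2 → w ≠ v → sgn g w = 1) :
    parity (v.1.length % 2) g ≠ 1 := by
  rw [parity, finprod_eq_single _ v, if_pos rfl]
  · exact hv
  · intro w hw
    split_ifs with h1
    · exact h w h1 hw
    · rfl

/-- The type-preserving automorphisms with all local permutations in `A`, of which an even number of
odd ones at the vertices of either type. -/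
def evenAut (A : Subgroup (Equiv.Perm Ω)) : Subgroup (TreeAut Ω) where
  carrier := {g | (∀ v, localPerm g v ∈ A) ∧ (oddSet g).Finite ∧ g ∈ typePreserving Ω ∧
    ∀ i, parity i g = 1}
  one_mem' := by
    refine ⟨fun v => by rw [localPerm_one]; exact one_mem _, ?_, one_mem _, fun i => ?_⟩
    · simp [oddSet, sgn_one]
    · exact parity_eq_one_of_oddSet sgn_one
  mul_mem' {g h} hg hh := by
    refine ⟨(U A).mul_mem hg.1 hh.1, oddSet_mul_finite hg.2.1 hh.2.1,
      mul_mem hg.2.2.1 hh.2.2.1, fun i => ?_⟩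
    rw [parity_mul hg.2.1 hh.2.1 hh.2.2.1, hg.2.2.2, hh.2.2.2, one_mul]
  inv_mem' {g} hg := by
    have hf := oddSet_inv_finite hg.2.1
    refine ⟨(U A).inv_mem hg.1, hf, inv_mem hg.2.2.1, fun i => ?_⟩
    have h := parity_mul (i := i) hg.2.1 hf (inv_mem hg.2.2.1)
    rw [mul_inv_cancel, hg.2.2.2, one_mul] at h
    rw [← h]
    exact parity_eq_one_of_oddSet sgn_one

theorem mem_evenAut {A : Subgroup (Equiv.Perm Ω)} {g : TreeAut Ω} :
    g ∈ evenAut A ↔ (∀ v, localPerm g v ∈ A) ∧ (oddSet g).Finite ∧ g ∈ typePreserving Ω ∧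
      ∀ i, parity i g = 1 := Iff.rfl

/-- `F` consists of the even permutations in `A`, it is transitive, and the point stabilizers in `A`
contain odd permutations. -/
structure IsEvenPart (F A : Subgroup (Equiv.Perm Ω)) : Prop where
  mem_iff : ∀ s, s ∈ F ↔ s ∈ A ∧ Equiv.Perm.sign s = 1
  exists_apply_eq : ∀ a b, ∃ s ∈ F, s a = b
  exists_odd : ∀ a, ∃ s ∈ A, s a = a ∧ Equiv.Perm.sign s = -1

namespace IsEvenPart

variable {F A : Subgroup (Equiv.Perm Ω)} (h : IsEvenPart F A)
include h

theorem le : F ≤ A := fun _ hs => ((h.mem_iff _).1 hs).1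

theorem U_le : U F ≤ U A := U_mono h.le

theorem sgn_eq_one {g : TreeAut Ω} (hg : g ∈ U F) (v : Vert Ω) : sgn g v = 1 :=
  ((h.mem_iff _).1 (hg v)).2

theorem mem_U_iff {g : TreeAut Ω} : g ∈ U F ↔ g ∈ U A ∧ ∀ v, sgn g v = 1 :=
  ⟨fun hg => ⟨h.U_le hg, h.sgn_eq_one hg⟩, fun hg v => (h.mem_iff _).2 ⟨hg.1 v, hg.2 v⟩⟩

theorem mem_G_iff {g : TreeAut Ω} : g ∈ G F A ↔ (oddSet g).Finite ∧ g ∈ U A := by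
  have : ∀ hg : g ∈ U A, {v | localPerm g v ∉ F} = oddSet g := fun hg => by
    ext v
    simp only [Set.mem_ofPred_eq, h.mem_iff, mem_oddSet, not_and]
    exact ⟨fun h1 => h1 (hg v), fun h1 _ => h1⟩
  constructor
  · rintro ⟨h1, h2⟩
    exact ⟨this h2 ▸ h1, h2⟩
  · rintro ⟨h1, h2⟩
    exact ⟨by rw [← this h2] at h1; exact h1, h2⟩

theorem U_le_G : U F ≤ G F A := fun g hg => by
  rw [h.mem_G_iff]
  refine ⟨?_, h.U_le hg⟩
  simp [oddSet, h.sgn_eq_one hg]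

theorem mem_evenAut_of_mem_U {g : TreeAut Ω} (hg : g ∈ U F) (ht : g ∈ typePreserving Ω) :
    g ∈ evenAut A := by
  refine ⟨h.U_le hg, ?_, ht, fun i => parity_eq_one_of_oddSet (h.sgn_eq_one hg)⟩
  simp [oddSet, h.sgn_eq_one hg]

/-- On type-preserving elements of G(F, A) the parities are homomorphisms to an abelian group, so
they kill commutators. -/
theorem commutator_mem_evenAut {x y : TreeAut Ω} (hx : x ∈ G F A) (hy : y ∈ G F A)
    (hxt : x ∈ typePreserving Ω) (hyt : y ∈ typePreserving Ω) : x * y * x⁻¹ * y⁻¹ ∈ evenAut A := by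
  rw [h.mem_G_iff] at hx hy
  have hxi := oddSet_inv_finite hx.1
  have hyi := oddSet_inv_finite hy.1
  refine ⟨(U A).mul_mem ((U A).mul_mem ((U A).mul_mem hx.2 hy.2) ((U A).inv_mem hx.2))
    ((U A).inv_mem hy.2), ?_, ?_, fun i => ?_⟩
  · exact oddSet_mul_finite (oddSet_mul_finite (oddSet_mul_finite hx.1 hy.1) hxi) hyi
  · exact mul_mem (mul_mem (mul_mem hxt hyt) (inv_mem hxt)) (inv_mem hyt)
  · have h1 := parity_mul (i := i) hx.1 hxi (inv_mem hxt)
    have h2 := parity_mul (i := i) hy.1 hyi (inv_mem hyt)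
    rw [mul_inv_cancel, parity_eq_one_of_oddSet sgn_one] at h1 h2
    rw [parity_mul (oddSet_mul_finite (oddSet_mul_finite hx.1 hy.1) hxi) hyi (inv_mem hyt),
      parity_mul (oddSet_mul_finite hx.1 hy.1) hxi (inv_mem hxt),
      parity_mul hx.1 hy.1 hyt, mul_right_comm (parity i x), ← h1, one_mul, ← h2]

theorem N_le_evenAut : N F A ≤ evenAut A := by
  refine iSup_le fun v => iSup_le fun w => iSup_le fun _ => ?_
  rw [Subgroup.commutator_le]
  rintro x ⟨hx, hxf⟩ y ⟨hy, hyf⟩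
  exact h.commutator_mem_evenAut hx hy
    (mem_typePreserving_of_fixed (hxf v (Set.mem_insert _ _)))
    (mem_typePreserving_of_fixed (hyf v (Set.mem_insert _ _)))

/-- There are automorphisms fixing the root with all local permutations in `A` and with prescribed
signs of the local permutations. -/
theorem exists_aut_oddSet (S : Set (Vert Ω)) (a b : Ω) :
    ∃ g : TreeAut Ω, g root = root ∧ localPerm g root a = b ∧ g ∈ U A ∧ oddSet g = S := by
  classical
  -- Transitivity of F gives an even s with s a = b; an odd element of A fixing a changes its sign
  -- without changing that value.
  have key : ∀ (v : Vert Ω) (a b : Ω), ∃ s ∈ A, s a = b ∧ (Equiv.Perm.sign s ≠ 1 ↔ v ∈ S) := by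
    intro v a b
    obtain ⟨s, hs, hab⟩ := h.exists_apply_eq a b
    obtain ⟨t, ht, hta, hts⟩ := h.exists_odd a
    rw [h.mem_iff] at hs
    by_cases hv : v ∈ S
    · refine ⟨s * t, mul_mem hs.1 ht, by rw [Equiv.Perm.mul_apply, hta, hab], ?_⟩
      rw [map_mul, hs.2, hts]
      simp [hv]
    · exact ⟨s, hs.1, hab, by simp [hs.2, hv]⟩
  choose ρ hρA hρ hρs using key
  obtain ⟨g, hg, hg1, hg2⟩ := exists_aut_of_rule (ρ root a b) ρ hρ
  refine ⟨g, hg, by rw [hg1, hρ], ?_, ?_⟩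
  · intro v
    by_cases hr : v = root
    · rw [hr, hg1]
      exact hρA _ _ _
    · obtain ⟨a, u, hu, rfl⟩ := exists_step_eq hr
      rw [hg2 a u hu]
      exact hρA _ _ _
  · ext v
    rw [mem_oddSet, sgn]
    by_cases hr : v = root
    · rw [hr, hg1]
      exact hρs _ _ _
    · obtain ⟨a, u, hu, rfl⟩ := exists_step_eq hr
      rw [hg2 a u hu]
      exact hρs _ _ _

end IsEvenPart

end Signs

end LocalAction

namespace LocalAction

/-! ### Infinite products of automorphisms -/

section Limits

variable {Ω : Type*}

/-- A pointwise limit of automorphisms and of their inverses is an automorphism. -/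
theorem exists_limit {ι : Type*} (l : Filter ι) [l.NeBot] (P : ι → TreeAut Ω)
    (h₁ : ∀ v, ∃ w, ∀ᶠ n in l, P n v = w) (h₂ : ∀ v, ∃ w, ∀ᶠ n in l, (P n)⁻¹ v = w) :
    ∃ h : TreeAut Ω, ∀ v, ∀ᶠ n in l, P n v = h v := by
  choose f hf using h₁
  choose f' hf' using h₂
  have hl : Function.LeftInverse f' f := fun v => by
    obtain ⟨n, hn, hn'⟩ := ((hf v).and (hf' (f v))).exists
    rw [← hn', ← hn, RelIso.inv_apply_self]
  have hr : Function.RightInverse f' f := fun v => by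
    obtain ⟨n, hn, hn'⟩ := ((hf' v).and (hf (f' v))).exists
    rw [← hn', ← hn, RelIso.apply_inv_self]
  refine ⟨⟨⟨f, f', hl, hr⟩, ?_⟩, hf⟩
  intro v w
  obtain ⟨n, hn, hn'⟩ := ((hf v).and (hf w)).exists
  change (tree Ω).Adj (f v) (f w) ↔ _
  rw [← hn, ← hn']
  exact (P n).map_rel_iff'

theorem eventually_localPerm_eq [Finite Ω] {ι : Type*} {l : Filter ι} {P : ι → TreeAut Ω}
    {h : TreeAut Ω} (hP : ∀ v, ∀ᶠ n in l, P n v = h v) (v : Vert Ω) :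
    ∀ᶠ n in l, localPerm (P n) v = localPerm h v := by
  filter_upwards [hP v, Filter.eventually_all.2 fun a => hP (step a v)] with n h1 h2
  exact localPerm_congr h1 h2

/-- If the translates of the support of `g` under the powers of `t` are disjoint, then `g` is a
commutator of `t` with an infinite product of conjugates of `g`. -/
theorem exists_commutator_eq [Finite Ω] {F : Subgroup (Equiv.Perm Ω)} {t g : TreeAut Ω}
    (ht : t ∈ U F) (hg : g ∈ U F) (B : Set (Vert Ω)) (hgB : ∀ v, v ∉ B → g v = v)
    (hd : ∀ (i j : ℕ) (v : Vert Ω), (t ^ i)⁻¹ v ∈ B → (t ^ j)⁻¹ v ∈ B → i = j) :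
    ∃ h ∈ U F, g = h * t * h⁻¹ * t⁻¹ := by
  -- The factors c i have disjoint supports, so at each vertex the partial products P n are
  -- eventually constant.
  set c : ℕ → TreeAut Ω := fun i => t ^ i * g * (t ^ i)⁻¹ with hc
  let P : ℕ → TreeAut Ω := fun n => Nat.rec 1 (fun i p => p * c i) n
  have hP0 : P 0 = 1 := rfl
  have hPs : ∀ n, P (n + 1) = P n * c n := fun n => rfl
  have hcfix : ∀ i v, (t ^ i)⁻¹ v ∉ B → c i v = v := by
    intro i v hv
    rw [hc]
    simp only [RelIso.mul_apply]
    rw [hgB _ hv, RelIso.apply_inv_self]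
  have hgmem : ∀ v, v ∈ B → g v ∈ B := by
    intro v hv
    by_contra h
    have := g.injective (hgB _ h)
    rw [this] at h
    exact h hv
  have hcmem : ∀ i v, (t ^ i)⁻¹ v ∈ B → (t ^ i)⁻¹ (c i v) ∈ B := by
    intro i v hv
    rw [hc]
    simp only [RelIso.mul_apply]
    rw [RelIso.inv_apply_self]
    exact hgmem _ hv
  have hA : ∀ n v, (∀ i < n, (t ^ i)⁻¹ v ∉ B) → P n v = v := by
    intro n
    induction n with
    | zero => exact fun v _ => rfl
    | succ n ih =>
      intro v hv
      rw [hPs, RelIso.mul_apply, hcfix n v (hv n (by omega))]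
      exact ih v fun i hi => hv i (by omega)
  have hB : ∀ n i v, i < n → (t ^ i)⁻¹ v ∈ B → P n v = c i v := by
    intro n
    induction n with
    | zero => intro i v hi; omega
    | succ n ih =>
      intro i v hi hv
      rw [hPs, RelIso.mul_apply]
      by_cases hin : i = n
      · subst hin
        exact hA _ _ fun j hj hj' => by
          have := hd _ _ _ hj' (hcmem i v hv)
          omega
      · rw [hcfix n v fun h => hin (hd _ _ _ hv h)]
        exact ih i v (by omega) hv
  have hlim : ∀ v, ∃ w, ∀ᶠ n in Filter.atTop, P n v = w := by
    intro v
    by_cases h : ∃ i, (t ^ i)⁻¹ v ∈ B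
    · obtain ⟨i, hi⟩ := h
      exact ⟨c i v, (Filter.eventually_gt_atTop i).mono fun n hn => hB n i v hn hi⟩
    · exact ⟨v, Filter.Eventually.of_forall fun n => hA n v fun i _ hi => h ⟨i, hi⟩⟩
  have hlim' : ∀ v, ∃ w, ∀ᶠ n in Filter.atTop, (P n)⁻¹ v = w := by
    intro v
    by_cases h : ∃ i, (t ^ i)⁻¹ v ∈ B
    · obtain ⟨i, hi⟩ := h
      have hw : (t ^ i)⁻¹ ((c i)⁻¹ v) ∈ B := by
        by_contra hcon
        have h1 := hcfix i _ hcon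
        rw [RelIso.apply_inv_self] at h1
        rw [← h1] at hcon
        exact hcon hi
      refine ⟨(c i)⁻¹ v, (Filter.eventually_gt_atTop i).mono fun n hn => ?_⟩
      have h1 := hB n i _ hn hw
      rw [RelIso.apply_inv_self] at h1
      rw [← h1, RelIso.inv_apply_self, h1]
    · refine ⟨v, Filter.Eventually.of_forall fun n => ?_⟩
      have h1 := hA n v fun i _ hi => h ⟨i, hi⟩
      conv_lhs => rw [← h1]
      exact RelIso.inv_apply_self _ _
  obtain ⟨h, hh⟩ := exists_limit Filter.atTop P hlim hlim'
  have hcU : ∀ i, c i ∈ U F := fun i =>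
    mul_mem (mul_mem (pow_mem ht i) hg) (inv_mem (pow_mem ht i))
  have hPU : ∀ n, P n ∈ U F := by
    intro n
    induction n with
    | zero => exact one_mem _
    | succ n ih => exact mul_mem ih (hcU n)
  -- Conjugation by t shifts the factors by one. In the limit h = g (t h t⁻¹), which is the
  -- commutator identity sought.
  have hrec : ∀ n, P (n + 1) = g * (t * P n * t⁻¹) := by
    intro n
    induction n with
    | zero => rw [hPs, hP0]; simp [hc]
    | succ n ih =>
      have hcs : c (n + 1) = t * c n * t⁻¹ := by
        simp only [hc, pow_succ']
        group
      calc P (n + 1 + 1) = g * (t * P n * t⁻¹) * (t * c n * t⁻¹) := by rw [hPs (n + 1), ih, hcs]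
        _ = g * (t * (P n * c n) * t⁻¹) := by group
  refine ⟨h, fun v => ?_, ?_⟩
  · obtain ⟨n, hn⟩ := (eventually_localPerm_eq hh v).exists
    rw [← hn]
    exact hPU n v
  · have : h = g * (t * h * t⁻¹) := by
      apply RelIso.ext
      intro v
      obtain ⟨n, hn, hn'⟩ := (((Filter.tendsto_add_atTop_iff_nat 1).2 Filter.tendsto_id
        |>.eventually (hh v)).and (hh (t⁻¹ v))).exists
      have hn : P (n + 1) v = h v := hn
      rw [← hn, hrec]
      simp only [RelIso.mul_apply]
      rw [hn']
    rw [eq_mul_inv_iff_mul_eq, eq_mul_inv_iff_mul_eq]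
    conv_rhs => rw [this]
    group

end Limits

/-! ### Elements supported in half-trees -/

section Restriction

variable {Ω : Type*}

/-- The elements of `U(F)` supported in the half-tree `branch a`. -/
def rist (F : Subgroup (Equiv.Perm Ω)) (a : Ω) : Subgroup (TreeAut Ω) :=
  U F ⊓ fixing (branch a)ᶜ

/-- The restriction of an automorphism that is trivial near the root to a half-tree. -/
theorem exists_rist_agree {F : Subgroup (Equiv.Perm Ω)} {g : TreeAut Ω} (hg : g ∈ U F)
    (hr : g root = root) (h1 : localPerm g root = 1) (a : Ω) :
    ∃ k ∈ rist F a, ∀ v ∈ branch a, k v = g v := by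
  classical
  -- Cutting off the portrait outside the half-tree stays compatible: across the separating edge the
  -- condition only needs the local permutation at the root, which is trivial.
  obtain ⟨k, hk, hks⟩ := exists_aut_of_portrait
    (fun v => if v ∈ branch a then localPerm g v else 1) (by
      intro b v
      by_cases hv : v = root
      · subst hv
        simp only [if_neg (root_notMem_branch a)]
        split_ifs
        · rw [localPerm_step, h1]
        · rfl
      · by_cases hv' : step b v = root
        · have := step_eq_root_iff.1 hv'
          subst this
          simp only [step_step, if_neg (root_notMem_branch a)]
          split_ifs
          · rw [localPerm_step, h1]
          · rfl
        · simp only [step_mem_branch_iff hv hv']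
          split_ifs
          · exact localPerm_step g b v
          · rfl)
  have hkout : ∀ v, v ∉ branch a → localPerm k v = 1 := fun v hv => by rw [hks, if_neg hv]
  have hkfix := mem_fixing_compl_branch hk hkout
  refine ⟨k, ⟨fun v => ?_, hkfix⟩, fun v hv => ?_⟩
  · rw [hks]
    split_ifs
    · exact hg v
    · exact one_mem _
  · induction v using Vert.induction with
    | h0 => exact absurd hv (root_notMem_branch a)
    | hs b v hb ih =>
      have hne : step b v ≠ root := fun h => by
        have := congrArg Subtype.val h
        rw [step_val_of_ne hb, root_val] at this
        simp at this
      by_cases hv' : v = root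
      · subst hv'
        rw [apply_step, apply_step, hk, hr, h1, hkout root (root_notMem_branch a)]
      · have hvb := (step_mem_branch_iff hv' hne).1 hv
        rw [apply_step, apply_step, ih hvb, hks, if_pos hvb]

/-- Elements supported in a half-tree with a prescribed local permutation at a vertex. -/
theorem exists_mem_rist {F : Subgroup (Equiv.Perm Ω)} (hF : ∀ a b, ∃ s ∈ F, s a = b)
    {a c : Ω} {u : Vert Ω} (hu : u.1.head? ≠ some a) (hc : step a u ∈ branch c)
    {x : Equiv.Perm Ω} (hx : x ∈ F) (hxa : x a = a) :
    ∃ g ∈ rist F c, (∀ v, v.1.length ≤ u.1.length + 1 → g v = v) ∧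
      localPerm g (step a u) = x ∧
      ∀ v, v.1.length = u.1.length + 1 → v ≠ step a u → localPerm g v = 1 := by
  classical
  obtain ⟨g, h1, h2, h3, h4, h5⟩ := exists_aut_of_level hF (n := u.1.length + 1) (by omega)
    (fun v => if v = step a u then x else 1) (by
      intro b v hv _
      split_ifs with h
      · have h' := congrArg Subtype.val h
        rw [step_val_of_ne hv, step_val_of_ne hu, List.cons.injEq] at h'
        rw [h'.1, hxa]
      · rfl)
  refine ⟨g, ⟨fun v => ?_, ?_⟩, h1, ?_, ?_⟩
  · rcases lt_trichotomy v.1.length (u.1.length + 1) with h | h | h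
    · rw [h2 v h]; exact one_mem _
    · rw [h3 v h]
      split_ifs
      · exact hx
      · exact one_mem _
    · exact h4 v h
  · refine mem_fixing_compl_branch (h1 _ (by simp [root_val])) fun v => ?_
    induction v using Vert.induction with
    | h0 => exact fun _ => h2 _ (by simp [root_val])
    | hs b v hb ih =>
      intro hv
      rcases lt_trichotomy (step b v).1.length (u.1.length + 1) with h | h | h
      · exact h2 _ h
      · rw [h3 _ h, if_neg]
        intro heq
        rw [heq] at hv
        exact hv hc
      · have hl := length_step_of_ne hb
        have hvr : v ≠ root := by
          rintro rfl
          rw [root_val, List.length_nil] at hl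
          omega
        have hne : step b v ≠ root := fun h' => by
          rw [h', root_val, List.length_nil] at h
          omega
        have hvb : v ∉ branch c := fun h' => hv ((step_mem_branch_iff hvr hne).2 h')
        exact h5 b v hb (by omega) (by rw [ih hvb]; rfl)
  · rw [h3 _ (length_step_of_ne hu), if_pos rfl]
  · intro v hv hne
    rw [h3 v hv, if_neg hne]

end Restriction

/-! ### Generation of the type-preserving part of U(F) -/

section Generation

variable {Ω : Type*} [Fintype Ω] [DecidableEq Ω]

/-- The conditions on the local actions that make the groups simple. -/
structure IsAmple (F A : Subgroup (Equiv.Perm Ω)) : Prop extends IsEvenPart F A where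
  three_le_card : 3 ≤ Fintype.card Ω
  exists_move : ∀ a b, a ≠ b → ∃ s ∈ F, s a = a ∧ s b ≠ b
  le_of_stabilizer_le : ∀ X : Subgroup (Equiv.Perm Ω), (∀ a, ∀ s ∈ F, s a = a → s ∈ X) → F ≤ X

namespace IsAmple

variable {F A : Subgroup (Equiv.Perm Ω)} (h : IsAmple F A)
include h

theorem exists_ne_ne (a b : Ω) : ∃ c, c ≠ a ∧ c ≠ b := by
  have hc : ({a, b} : Finset Ω).card < Fintype.card Ω :=
    (Finset.card_le_two).trans_lt h.three_le_card
  obtain ⟨c, hc⟩ := Finset.exists_mem_notMem_of_card_lt_card (s := ({a, b} : Finset Ω)) (t := Finset.univ)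
    (by rwa [Finset.card_univ])
  simp only [Finset.mem_univ, Finset.mem_insert, Finset.mem_singleton, not_or, true_and] at hc
  exact ⟨c, hc⟩

variable {W : Subgroup (TreeAut Ω)} (hW : ∀ u ∈ U F, ∀ w ∈ W, u * w * u⁻¹ ∈ W)
  (hb : ∀ a, ∀ x ∈ rist F a, ∀ y ∈ rist F a, x * y * x⁻¹ * y⁻¹ ∈ W)
include hW hb

/-- In `branch c`, let f act by x at the vertex y at distance two from the root, trivially at the
other vertices of that sphere, and let s move another such vertex to y. In f s f⁻¹ s⁻¹ the factor
f⁻¹ acts where its local permutation is trivial, so the commutator fixes y and acts there by x. A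
colour-preserving conjugation carries y to v. -/
theorem exists_mem_localPerm_eq_of_fixed (v : Vert Ω) {a : Ω} {x : Equiv.Perm Ω} (hx : x ∈ F)
    (hxa : x a = a) : ∃ g ∈ W, g ∈ U F ∧ g v = v ∧ localPerm g v = x := by
  obtain ⟨c, hca, -⟩ := h.exists_ne_ne a a
  obtain ⟨s₀, hs₀, hs₀c, hs₀a⟩ := h.exists_move c a hca
  set b := s₀.symm a with hbdef
  have hsb : s₀ b = a := s₀.apply_symm_apply a
  have hba : b ≠ a := fun h' => hs₀a (by rw [← h']; rw [hsb, h'])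
  have hbc : b ≠ c := fun h' => hca (by rw [← hsb, h', hs₀c])
  have hr : ∀ e, (root : Vert Ω).1.head? ≠ some e := fun e => by simp [root_val]
  have hlc : (step c (root : Vert Ω)).1.length = 1 := by
    rw [length_step_of_ne (hr c)]; rfl
  have hne : ∀ e, e ≠ c → (step c (root : Vert Ω)).1.head? ≠ some e := fun e he => by
    rw [head?_step_of_ne (hr c)]
    exact fun h' => he (Option.some.inj h').symm
  have hbr : step a (step c root) ∈ branch c := by
    rw [mem_branch, getLast?_step_of_ne (hne a hca.symm), getLast?_step_root]
    rfl
  obtain ⟨f, hf, hffix, hfx, hf1⟩ := exists_mem_rist h.exists_apply_eq (hne a hca.symm) hbr hx hxa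
  obtain ⟨s, hs, hsfix, hsx, -⟩ := exists_mem_rist h.exists_apply_eq (hr c)
    (step_root_mem_branch c) hs₀ hs₀c
  have hs2 : s (step b (step c root)) = step a (step c root) := by
    rw [apply_step, hsx, hsb, hsfix _ (by rw [hlc, root_val]; rfl)]
  have hl2 : ∀ e, e ≠ c → (step e (step c (root : Vert Ω))).1.length = 2 := fun e he => by
    rw [length_step_of_ne (hne e he), hlc]
  have hs3 : s⁻¹ (step a (step c root)) = step b (step c root) := by
    rw [← hs2, RelIso.inv_apply_self]
  have hfb : f (step b (step c root)) = step b (step c root) :=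
    hffix _ (by rw [hl2 b hbc, hlc])
  have hfb' : f⁻¹ (step b (step c root)) = step b (step c root) := by
    conv_lhs => rw [← hfb]
    exact RelIso.inv_apply_self _ _
  have hfa : f (step a (step c root)) = step a (step c root) :=
    hffix _ (by rw [hl2 a hca.symm, hlc])
  set g := f * s * f⁻¹ * s⁻¹ with hg
  have hgv : g (step a (step c root)) = step a (step c root) := by
    rw [hg, RelIso.mul_apply, RelIso.mul_apply, RelIso.mul_apply, hs3, hfb', hs2, hfa]
  have hgs : localPerm g (step a (step c root)) = x := by
    rw [hg, localPerm_mul, localPerm_mul, localPerm_mul, hs3, hfb', hs2, hfx, localPerm_inv,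
      localPerm_inv, hs3, hfb', hf1 _ (by rw [hl2 b hbc, hlc]) (fun h' => hba
        (step_left_injective _ h'))]
    group
  have hgW : g ∈ W := hb c f hf s hs
  have hgU : g ∈ U F := mul_mem (mul_mem (mul_mem hf.1 hs.1) (inv_mem hf.1)) (inv_mem hs.1)
  set u := transl v * (transl (step a (step c root)))⁻¹ with hu
  have huU : u ∈ U F := mul_mem (transl_mem_U F _) (inv_mem (transl_mem_U F _))
  have huv : u (step a (step c root)) = v := by
    rw [hu, RelIso.mul_apply, transl_inv_apply, transl_root]
  have huv' : u⁻¹ v = step a (step c root) := by rw [← huv, RelIso.inv_apply_self]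
  have hu1 : ∀ w, localPerm u w = 1 := fun w => by
    rw [hu, localPerm_mul, localPerm_transl, localPerm_transl_inv, one_mul]
  refine ⟨u * g * u⁻¹, hW u huU g hgW, mul_mem (mul_mem huU hgU) (inv_mem huU), ?_, ?_⟩
  · rw [RelIso.mul_apply, RelIso.mul_apply, huv', hgv, huv]
  · rw [localPerm_mul, localPerm_mul, localPerm_inv, hu1, hu1, huv', hgs]
    group

/-- The local actions obtained at v form a group containing the point stabilizers of F, and these
generate F by `le_of_stabilizer_le`. -/
theorem exists_mem_localPerm_eq (v : Vert Ω) {x : Equiv.Perm Ω} (hx : x ∈ F) :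
    ∃ g ∈ W, g ∈ U F ∧ g v = v ∧ localPerm g v = x := by
  let X : Subgroup (Equiv.Perm Ω) :=
    { carrier := {x | ∃ g ∈ W, g ∈ U F ∧ g v = v ∧ localPerm g v = x}
      one_mem' := ⟨1, one_mem _, one_mem _, rfl, localPerm_one v⟩
      mul_mem' := by
        rintro _ _ ⟨g, hg, hgU, hgv, rfl⟩ ⟨k, hk, hkU, hkv, rfl⟩
        exact ⟨g * k, mul_mem hg hk, mul_mem hgU hkU, by rw [RelIso.mul_apply, hkv, hgv],
          by rw [localPerm_mul, hkv]⟩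
      inv_mem' := by
        rintro _ ⟨g, hg, hgU, hgv, rfl⟩
        have hgv' : g⁻¹ v = v := by
          conv_lhs => rw [← hgv]
          exact RelIso.inv_apply_self _ _
        exact ⟨g⁻¹, inv_mem hg, inv_mem hgU, hgv', by rw [localPerm_inv, hgv']⟩ }
  exact h.le_of_stabilizer_le X
    (fun a s hs hsa => h.exists_mem_localPerm_eq_of_fixed hW hb v hs hsa) hx

/-- Induction along a path. Once the previous vertex is at a neighbour of the root, an element of W
rotating about that neighbour turns the next edge onto the edge towards the root. -/
theorem exists_mem_apply_eq_root (w : Vert Ω) :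
    ∃ k ∈ W, k ∈ U F ∧ k ∈ typePreserving Ω ∧ (k w = root ∨ ∃ c, k w = step c root) := by
  induction w using Vert.step_induction with
  | h0 => exact ⟨1, one_mem _, one_mem _, one_mem _, Or.inl rfl⟩
  | hs a w ih =>
    obtain ⟨k, hk, hkU, hkt, hkw | ⟨c, hkw⟩⟩ := ih
    · exact ⟨k, hk, hkU, hkt, Or.inr ⟨_, by rw [apply_step, hkw]⟩⟩
    · obtain ⟨x, hx, hxc⟩ := h.exists_apply_eq (localPerm k w a) c
      obtain ⟨l, hl, hlU, hlv, hlx⟩ := h.exists_mem_localPerm_eq hW hb (step c root) hx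
      refine ⟨l * k, mul_mem hl hk, mul_mem hlU hkU,
        mul_mem (mem_typePreserving_of_fixed hlv) hkt, Or.inl ?_⟩
      rw [RelIso.mul_apply, apply_step, hkw, apply_step, hlx, hxc, hlv, step_step]

/-- Composing a rotation k₂ about the root, fixing the colour a and moving b, with a rotation k₁
about the neighbour of colour b gives t ∈ W mapping `branch a` and `branch b` into `branch b`. Hence
the translates of `branch a` by powers of t are disjoint, and `exists_commutator_eq` writes every
element supported in `branch a` as h t h⁻¹ t⁻¹ with h ∈ U(F). This lies in W because U(F) normalizes
W. -/
theorem rist_le (a : Ω) : rist F a ≤ W := by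
  obtain ⟨b, hba, -⟩ := h.exists_ne_ne a a
  obtain ⟨x, hx, hxa, hxb⟩ := h.exists_move a b hba.symm
  obtain ⟨k₁, hk₁, hk₁U, hk₁v, hk₁x⟩ := h.exists_mem_localPerm_eq hW hb (step b root) hx
  obtain ⟨k₂, hk₂, hk₂U, hk₂v, hk₂x⟩ := h.exists_mem_localPerm_eq hW hb root hx
  have hr : ∀ e, (root : Vert Ω).1.head? ≠ some e := fun e => by simp [root_val]
  have hk₁r : k₁ root = step (x b) (step b root) := by
    have := apply_step k₁ b (step b root)
    rwa [step_step, hk₁v, hk₁x] at this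
  have hk₁b : localPerm k₁ root b = x b := by rw [← localPerm_step, hk₁x]
  have hhead : (step b (root : Vert Ω)).1.head? ≠ some (x b) := by
    rw [head?_step_of_ne (hr b)]
    exact fun h' => hxb (Option.some.inj h').symm
  have hmap : ∀ e, e ≠ b → ∀ v ∈ branch e, k₁ v ∈ branch b := by
    intro e he v hv
    have hne : (k₁ root).1.head? ≠ some (localPerm k₁ root e) := by
      rw [hk₁r, head?_step_of_ne hhead, ← hk₁b]
      exact fun h' => he ((localPerm k₁ root).injective (Option.some.inj h')).symm
    have h1 := (apply_mem_branch k₁ hne hv).1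
    rw [getLast?_step_of_ne hne, hk₁r, getLast?_step_of_ne hhead, getLast?_step_root] at h1
    exact h1
  set t := k₁ * k₂ with ht
  have hta : ∀ v ∈ branch a, t v ∈ branch b := fun v hv => by
    have := apply_mem_branch_of_root hk₂v hv
    rw [hk₂x, hxa] at this
    exact hmap a hba.symm _ this
  have htb : ∀ v ∈ branch b, t v ∈ branch b := fun v hv => by
    have := apply_mem_branch_of_root hk₂v hv
    rw [hk₂x] at this
    exact hmap _ hxb _ this
  have htn : ∀ n : ℕ, ∀ v ∈ branch a, (t ^ (n + 1)) v ∈ branch b := by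
    intro n
    induction n with
    | zero => intro v hv; rw [zero_add, pow_one]; exact hta v hv
    | succ n ih => intro v hv; rw [pow_succ', RelIso.mul_apply]; exact htb _ (ih v hv)
  have key : ∀ (i n : ℕ) (v : Vert Ω), (t ^ i)⁻¹ v ∈ branch a →
      (t ^ (i + (n + 1)))⁻¹ v ∈ branch a → False := by
    intro i n v h1 h2
    have h3 := htn n _ h2
    rw [← RelIso.mul_apply, pow_add t i, mul_inv_rev, mul_inv_cancel_left] at h3
    rw [mem_branch] at h1 h3
    rw [h1] at h3
    exact hba (Option.some.inj h3).symm
  have htW : t ∈ W := mul_mem hk₁ hk₂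
  intro g hg
  obtain ⟨k, hk, hgk⟩ := exists_commutator_eq (mul_mem hk₁U hk₂U) hg.1 (branch a)
    (fun v hv => hg.2 v hv) (by
      intro i j v hi hj
      rcases lt_trichotomy i j with hij | hij | hij
      · obtain ⟨n, rfl⟩ := Nat.exists_eq_add_of_lt hij
        exact (key i n v hi hj).elim
      · exact hij
      · obtain ⟨n, rfl⟩ := Nat.exists_eq_add_of_lt hij
        exact (key j n v hj hi).elim)
  rw [hgk]
  exact mul_mem (hW k hk t htW) (inv_mem htW)

/-- A subgroup that is normalized by `U(F)` and contains the derived subgroups of the groups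
`rist F a` contains all type-preserving elements of `U(F)`. -/
theorem mem_of_mem_U {u : TreeAut Ω} (hu : u ∈ U F) (hut : u ∈ typePreserving Ω) : u ∈ W := by
  -- An element acting trivially on the star of the root is a product of its restrictions to the
  -- half-trees at the root; they are split off one at a time.
  have key : ∀ (S : Finset Ω) (u : TreeAut Ω), u ∈ U F → u root = root → localPerm u root = 1 →
      (∀ a, a ∉ S → ∀ v ∈ branch a, u v = v) → u ∈ W := by
    intro S
    induction S using Finset.induction_on with
    | empty =>
      intro u _ hr _ hfix
      have : u = 1 := RelIso.ext fun v => by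
        by_cases hv : v = root
        · rw [hv, hr]; rfl
        · obtain ⟨a, ha⟩ := exists_mem_branch hv
          exact hfix a (Finset.notMem_empty a) v ha
      rw [this]
      exact one_mem _
    | insert a S _ ih =>
      intro u hu hr h1 hfix
      obtain ⟨k, hk, hku⟩ := exists_rist_agree hu hr h1 a
      have hkW := h.rist_le hW hb a hk
      have hmaps : ∀ b, ∀ v ∈ branch b, u v ∈ branch b := fun b v hv => by
        have := apply_mem_branch_of_root hr hv
        rwa [h1] at this
      have hkr : k root = root := hk.2 root (root_notMem_branch a)
      have hk1 : localPerm k root = 1 := localPerm_eq_of fun b => by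
        rw [hkr]
        by_cases hb : b = a
        · subst hb
          rw [hku _ (step_root_mem_branch b), apply_step, h1, hr]
        · refine (hk.2 _ fun hmem => hb ?_).symm
          rw [mem_branch, getLast?_step_root] at hmem
          exact Option.some.inj hmem
      have hinv : ∀ v, k (k⁻¹ v) = v := RelIso.apply_inv_self k
      have hout : ∀ b, b ≠ a → ∀ v ∈ branch b, v ∉ branch a := fun b hb v hv hv' => by
        rw [mem_branch] at hv hv'
        rw [hv] at hv'
        exact hb (Option.some.inj hv')
      have hmain : k⁻¹ * u ∈ W := by
        have hkr' : k⁻¹ root = root := by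
          conv_lhs => rw [← hkr]
          exact RelIso.inv_apply_self _ _
        refine ih _ (mul_mem (inv_mem hk.1) hu) ?_ ?_ ?_
        · rw [RelIso.mul_apply, hr, hkr']
        · rw [localPerm_mul, localPerm_inv, hr, hkr', hk1, h1]
          group
        · intro b hbS v hv
          rw [RelIso.mul_apply]
          apply k.injective
          rw [hinv]
          by_cases hba : b = a
          · subst hba
            exact (hku v hv).symm
          · rw [hfix b (by simp [hba, hbS]) v hv, hk.2 v (hout b hba v hv)]
      have := mul_mem hkW hmain
      rwa [mul_inv_cancel_left] at this
  -- Elements of W first bring the image of the root back, parity excluding a neighbour of the root,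
  -- and then cancel the local permutation there.
  obtain ⟨k, hk, hkU, hkt, hkr⟩ := h.exists_mem_apply_eq_root hW hb (u root)
  have hkr' : k (u root) = root := by
    rcases hkr with hkr | ⟨c, hkr⟩
    · exact hkr
    · have h1 := mul_mem hkt hut root
      rw [RelIso.mul_apply, hkr, length_step_mod_two] at h1
      simp [root_val] at h1
  obtain ⟨l, hl, hlU, hlr, hlx⟩ := h.exists_mem_localPerm_eq hW hb root
    (inv_mem (mul_mem hkU hu root))
  have hlk : l * (k * u) ∈ W := by
    refine key Finset.univ _ (mul_mem hlU (mul_mem hkU hu)) ?_ ?_ ?_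
    · rw [RelIso.mul_apply, RelIso.mul_apply, hkr', hlr]
    · rw [localPerm_mul, RelIso.mul_apply, hkr', hlx, inv_mul_cancel]
    · exact fun a ha => absurd (Finset.mem_univ a) ha
  have := mul_mem (inv_mem hk) (mul_mem (inv_mem hl) hlk)
  rwa [inv_mul_cancel_left, inv_mul_cancel_left] at this

end IsAmple

end Generation

end LocalAction

namespace LocalAction

/-! ### The parity description of N(F, A), and simplicity -/

section Simplicity

variable {Ω : Type*}

theorem conj_mem_fixing {g x : TreeAut Ω} {S T : Set (Vert Ω)} (hx : x ∈ fixing S)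
    (h : ∀ v ∈ T, g⁻¹ v ∈ S) : g * x * g⁻¹ ∈ fixing T := fun v hv => by
  rw [RelIso.mul_apply, RelIso.mul_apply, hx _ (h v hv), RelIso.apply_inv_self]

theorem apply_mem_of_mem_fixing_compl {q : TreeAut Ω} {S : Set (Vert Ω)} (hq : q ∈ fixing Sᶜ)
    {v : Vert Ω} (hv : v ∈ S) : q v ∈ S := by
  by_contra h
  have := q.injective (hq (q v) h)
  rw [this] at h
  exact h hv

theorem mul_comm_of_mem_fixing {p q : TreeAut Ω} {S : Set (Vert Ω)} (hp : p ∈ fixing S)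
    (hq : q ∈ fixing Sᶜ) : p * q = q * p := by
  apply RelIso.ext
  intro v
  rw [RelIso.mul_apply, RelIso.mul_apply]
  by_cases hv : v ∈ S
  · rw [hp v hv, hp _ (apply_mem_of_mem_fixing_compl hq hv)]
  · have hv' : v ∈ Sᶜ := hv
    rw [hq v hv', hq _ (apply_mem_of_mem_fixing_compl (S := Sᶜ) (by rwa [compl_compl]) hv')]

/-- The root and all its other neighbours are fixed, so the one neighbour inside the half-tree is
fixed too. -/
theorem fixing_compl_branch_le (a : Ω) :
    fixing (branch a)ᶜ ≤ fixing ({root, step a root} : Set (Vert Ω)) := by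
  intro g hg v hv
  have hr : g root = root := hg root (root_notMem_branch a)
  rcases hv with rfl | rfl
  · exact hr
  · by_contra hne
    have h1 := apply_step g a root
    rw [hr] at h1
    by_cases hc : localPerm g root a = a
    · rw [hc] at h1
      exact hne h1
    · have h2 := hg (step (localPerm g root a) root) fun hmem => hc (by
        rw [mem_branch, getLast?_step_root] at hmem
        exact Option.some.inj hmem)
      rw [← h1] at h2
      exact hne (g.injective h2)

theorem N_conj_mem {F A : Subgroup (Equiv.Perm Ω)} {g x : TreeAut Ω} (hg : g ∈ G F A)
    (hx : x ∈ N F A) : g * x * g⁻¹ ∈ N F A := by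
  have key : (N F A).map (MulAut.conj g).toMonoidHom ≤ N F A := by
    conv_lhs => rw [N]
    simp_rw [Subgroup.map_iSup, Subgroup.map_commutator]
    refine iSup_le fun v => iSup_le fun w => iSup_le fun hvw => ?_
    refine le_iSup_of_le (g v) (le_iSup_of_le (g w) (le_iSup_of_le (g.map_rel_iff'.2 hvw) ?_))
    have : (G F A ⊓ fixing {v, w}).map (MulAut.conj g).toMonoidHom ≤
        G F A ⊓ fixing {g v, g w} := by
      rintro _ ⟨y, ⟨hy, hyf⟩, rfl⟩
      refine ⟨(G F A).mul_mem ((G F A).mul_mem hg hy) ((G F A).inv_mem hg), conj_mem_fixing hyf ?_⟩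
      rintro u (rfl | rfl)
      · rw [RelIso.inv_apply_self]; exact Or.inl rfl
      · rw [RelIso.inv_apply_self]; exact Or.inr rfl
    exact Subgroup.commutator_mono this this
  exact key ⟨x, hx, rfl⟩

open scoped commutatorElement in
theorem commutator_mem_N {F A : Subgroup (Equiv.Perm Ω)} {a : Ω} {x y : TreeAut Ω}
    (hx : x ∈ G F A) (hxa : x ∈ fixing (branch a)ᶜ) (hy : y ∈ G F A)
    (hya : y ∈ fixing (branch a)ᶜ) : x * y * x⁻¹ * y⁻¹ ∈ N F A := by
  have h1 : ⁅G F A ⊓ fixing {root, step a root}, G F A ⊓ fixing {root, step a root}⁆ ≤ N F A :=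
    le_iSup_of_le root (le_iSup_of_le (step a root) (le_iSup_of_le ⟨a, rfl⟩ le_rfl))
  exact h1 (Subgroup.commutator_mem_commutator ⟨hx, fixing_compl_branch_le a hxa⟩
    ⟨hy, fixing_compl_branch_le a hya⟩)

theorem transl_mul_inv_mem_typePreserving {v w : Vert Ω}
    (h : v.1.length % 2 = w.1.length % 2) :
    transl w * (transl v)⁻¹ ∈ typePreserving Ω :=
  mem_typePreserving_of_apply (v := v)
    (by rw [RelIso.mul_apply, transl_inv_apply, transl_root, h])

theorem units_mul_eq_one {a b : ℤˣ} (ha : a ≠ 1) (hb : b ≠ 1) : a * b = 1 := by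
  rw [(Int.units_eq_one_or a).resolve_left ha, (Int.units_eq_one_or b).resolve_left hb]
  rfl

variable [Fintype Ω] [DecidableEq Ω] {F A : Subgroup (Equiv.Perm Ω)}

theorem exists_pair_of_parity {g : TreeAut Ω} (hg : g ∈ evenAut A) {v : Vert Ω}
    (hv : v ∈ oddSet g) :
    ∃ w ∈ oddSet g, w ≠ v ∧ w.1.length % 2 = v.1.length % 2 := by
  by_contra! hcon
  refine parity_eq_neg_one hv (fun w hw hwv => ?_) (hg.2.2.2 _)
  by_contra h
  exact hcon w h hwv hw

theorem oddSet_mul_inv_subset {g x : TreeAut Ω} (h : oddSet x ⊆ oddSet g) :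
    oddSet (g * x⁻¹) ⊆ x '' (oddSet g \ oddSet x) := by
  intro u hu
  rw [mem_oddSet, sgn_mul, sgn_inv] at hu
  refine ⟨x⁻¹ u, ?_, RelIso.apply_inv_self x u⟩
  by_cases hx : x⁻¹ u ∈ oddSet x
  · exact absurd (units_mul_eq_one (h hx) hx) hu
  · refine ⟨fun hg => hu ?_, hx⟩
    rw [mem_oddSet, not_not] at hx
    rw [hg, hx, one_mul]

/-- The group `evenAut A` is generated by the type-preserving elements of `U(F)` together with
elements that are odd at precisely two vertices. -/
theorem IsEvenPart.evenAut_le (h : IsEvenPart F A) {M : Subgroup (TreeAut Ω)}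
    (hU : ∀ u ∈ U F, u ∈ typePreserving Ω → u ∈ M)
    (hp : ∀ v w : Vert Ω, v ≠ w → v.1.length % 2 = w.1.length % 2 →
      ∃ x ∈ M, x ∈ evenAut A ∧ oddSet x = {v, w}) : evenAut A ≤ M := by
  -- Induction on the number of odd vertices: they come in pairs of the same type, and dividing by
  -- an element odd at one such pair removes it.
  have key : ∀ n (g : TreeAut Ω), g ∈ evenAut A → (oddSet g).ncard < n → g ∈ M := by
    intro n
    induction n with
    | zero => intro g _ hn; omega
    | succ n ih =>
      intro g hg hn
      by_cases hne : (oddSet g).Nonempty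
      · obtain ⟨v, hv⟩ := hne
        obtain ⟨w, hw, hwv, hpar⟩ := exists_pair_of_parity hg hv
        obtain ⟨x, hx, hxe, hxo⟩ := hp v w hwv.symm hpar.symm
        have hsub : oddSet x ⊆ oddSet g := by
          rw [hxo]
          rintro u (rfl | rfl)
          · exact hv
          · exact hw
        have hfin : (oddSet g \ oddSet x).Finite := hg.2.1.subset Set.sdiff_subset
        have h1 : (oddSet (g * x⁻¹)).ncard < n := by
          have h2 := Set.ncard_le_ncard (oddSet_mul_inv_subset hsub) (hfin.image x)
          have h3 := Set.ncard_image_le (f := x) hfin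
          have h4 : (oddSet g \ oddSet x).ncard < (oddSet g).ncard :=
            Set.ncard_lt_ncard ⟨Set.sdiff_subset, fun h' => (h' hv).2 (by
              rw [hxo]; exact Or.inl rfl)⟩ hg.2.1
          omega
        have := mul_mem (ih (g * x⁻¹) (mul_mem hg (inv_mem hxe)) h1) hx
        rwa [inv_mul_cancel_right] at this
      · refine hU g (h.mem_U_iff.2 ⟨hg.1, fun v => ?_⟩) hg.2.2.1
        by_contra hv
        exact hne ⟨v, hv⟩
  exact fun g hg => key _ g hg (Nat.lt_succ_self _)

/-- Let y ∈ G(F, A) be odd at v only, and let m ∈ M have trivial signs and move y v to y w. Then m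
y⁻¹ m⁻¹ y is odd exactly at v and w; it lies in M because y normalizes M. -/
theorem IsEvenPart.exists_pair (h : IsEvenPart F A) {M : Subgroup (TreeAut Ω)}
    (hU : ∀ u ∈ U F, u ∈ typePreserving Ω → u ∈ M)
    (hM : ∀ g ∈ G F A, ∀ m ∈ M, g * m * g⁻¹ ∈ M) {v w : Vert Ω} (hvw : v ≠ w)
    (hpar : v.1.length % 2 = w.1.length % 2) :
    ∃ x ∈ M, x ∈ evenAut A ∧ oddSet x = {v, w} := by
  obtain ⟨a, -⟩ : ∃ a : Ω, True := by
    by_cases hv : v = root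
    · have hw : w ≠ root := fun hw => hvw (hv.trans hw.symm)
      obtain ⟨a, -⟩ := exists_step_eq hw
      exact ⟨a, trivial⟩
    · obtain ⟨a, -⟩ := exists_step_eq hv
      exact ⟨a, trivial⟩
  obtain ⟨y, hyr, -, hyA, hyo⟩ := h.exists_aut_oddSet {v} a a
  have hyt : y ∈ typePreserving Ω := mem_typePreserving_of_fixed hyr
  have hyG : y ∈ G F A := h.mem_G_iff.2 ⟨by rw [hyo]; exact Set.finite_singleton v, hyA⟩
  set m := transl (y w) * (transl (y v))⁻¹ with hm
  have hmU : m ∈ U F := mul_mem (transl_mem_U F _) (inv_mem (transl_mem_U F _))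
  have hmt : m ∈ typePreserving Ω :=
    transl_mul_inv_mem_typePreserving (by rw [hyt, hyt, hpar])
  have hmv : m (y v) = y w := by
    rw [hm, RelIso.mul_apply, transl_inv_apply, transl_root]
  have hmM : m ∈ M := hU m hmU hmt
  refine ⟨m * y⁻¹ * m⁻¹ * y, ?_, ?_, ?_⟩
  · have h1 := hM y⁻¹ (inv_mem hyG) _ (inv_mem hmM)
    rw [inv_inv] at h1
    have h2 := mul_mem hmM h1
    rwa [← mul_assoc, ← mul_assoc] at h2
  · have := h.commutator_mem_evenAut (h.U_le_G hmU) (inv_mem hyG) hmt (inv_mem hyt)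
    rwa [inv_inv] at this
  · have hsy : ∀ u, sgn y u ≠ 1 ↔ u = v := fun u => by
      rw [← mem_oddSet, hyo]; rfl
    ext u
    have h1 : y⁻¹ (m⁻¹ (y u)) = v ↔ u = w := by
      constructor
      · intro h'
        apply y.injective
        rw [← hmv, ← h', RelIso.apply_inv_self, RelIso.apply_inv_self]
      · rintro rfl
        rw [← hmv, RelIso.inv_apply_self, RelIso.inv_apply_self]
    rw [mem_oddSet, sgn_mul, sgn_mul, sgn_mul, h.sgn_eq_one hmU, h.sgn_eq_one (inv_mem hmU),
      sgn_inv, one_mul, mul_one]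
    simp only [Set.mem_insert_iff, Set.mem_singleton_iff]
    by_cases hu : u = v
    · subst hu
      have h2 : sgn y (y⁻¹ (m⁻¹ (y u))) = 1 := by
        by_contra h'
        exact hvw (h1.1 ((hsy _).1 h'))
      rw [h2, one_mul]
      simp [(hsy u).2 rfl]
    · have h2 : sgn y u = 1 := by
        by_contra h'
        exact hu ((hsy _).1 h')
      rw [h2, mul_one, hsy, h1]
      simp [hu]

namespace IsAmple

variable (h : IsAmple F A)
include h

theorem mem_N_of_mem_U {u : TreeAut Ω} (hu : u ∈ U F) (hut : u ∈ typePreserving Ω) :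
    u ∈ N F A :=
  h.mem_of_mem_U (fun _ hg _ hw => N_conj_mem (h.U_le_G hg) hw)
    (fun _ _ hx _ hy => commutator_mem_N (h.U_le_G hx.1) hx.2 (h.U_le_G hy.1) hy.2) hu hut

/-- The generation criterion, used both for N(F, A) itself and, in `evenAut_le_of_normal`, for a
core of a normal subgroup. -/
theorem evenAut_le_of_conj_mem {M : Subgroup (TreeAut Ω)}
    (hM : ∀ g ∈ G F A, ∀ m ∈ M, g * m * g⁻¹ ∈ M)
    (hb : ∀ a, ∀ x ∈ rist F a, ∀ y ∈ rist F a, x * y * x⁻¹ * y⁻¹ ∈ M) : evenAut A ≤ M := by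
  have hU : ∀ u ∈ U F, u ∈ typePreserving Ω → u ∈ M := fun u hu hut =>
    h.mem_of_mem_U (fun g hg w hw => hM g (h.U_le_G hg) w hw) hb hu hut
  exact h.evenAut_le hU fun v w hvw hpar => h.exists_pair hU hM hvw hpar

/-- The group `N(F, F')` is defined by parity conditions. -/
theorem N_eq : N F A = evenAut A :=
  le_antisymm h.N_le_evenAut (h.evenAut_le_of_conj_mem (fun _ hg _ hm => N_conj_mem hg hm)
    fun _ _ hx _ hy => commutator_mem_N (h.U_le_G hx.1) hx.2 (h.U_le_G hy.1) hy.2)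

theorem evenAut_conj_mem {g x : TreeAut Ω} (hg : g ∈ G F A) (hx : x ∈ evenAut A) :
    g * x * g⁻¹ ∈ evenAut A := by
  rw [← h.N_eq] at hx ⊢
  exact N_conj_mem hg hx

/-- A nontrivial normal subgroup contains an element that moves a given half-tree off itself. -/
theorem exists_mem_branch_notMem {M : Subgroup (TreeAut Ω)}
    (hM : ∀ g ∈ evenAut A, ∀ m ∈ M, g * m * g⁻¹ ∈ M) {m : TreeAut Ω} (hm : m ∈ M) (hm1 : m ≠ 1)
    (a : Ω) : ∃ k ∈ M, ∀ u ∈ branch a, k u ∉ branch a := by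
  obtain ⟨v, hv⟩ : ∃ v, m v ≠ v := by
    by_contra! hcon
    exact hm1 (RelIso.ext hcon)
  set m' := (transl v)⁻¹ * m * transl v with hm'
  have hr : m' root ≠ root := by
    rw [hm', RelIso.mul_apply, RelIso.mul_apply, transl_root]
    intro h'
    apply hv
    rw [← RelIso.apply_inv_self (transl v) (m v), h', transl_root]
  obtain ⟨l, hl⟩ := exists_mem_branch hr
  rw [mem_branch] at hl
  obtain ⟨d, u, hu, hud⟩ := exists_step_eq hr
  have hd : (m' root).1.head? = some d := by rw [← hud]; exact head?_step_of_ne hu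
  -- Let l be the direction from the root to m' root, and d the colour at m' root back towards the
  -- root. As the edge of colour c is not sent to the one of colour d, `branch c` goes beyond m'
  -- root, thus into `branch l`; and c ≠ l.
  obtain ⟨c, hcl, hcd⟩ := h.exists_ne_ne l ((localPerm m' root).symm d)
  have hc : ∀ u ∈ branch c, m' u ∉ branch c := by
    intro u hu hmem
    have hne : (m' root).1.head? ≠ some (localPerm m' root c) := by
      rw [hd]
      intro h'
      exact hcd ((Equiv.eq_symm_apply _).2 (Option.some.inj h').symm)
    rw [mem_branch, (apply_mem_branch m' hne hu).1, getLast?_step_of_ne hne, hl] at hmem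
    exact hcl (Option.some.inj hmem).symm
  -- A translation to x ∈ `branch c` whose word does not start with a carries `branch a` into
  -- `branch c`. The parity of x makes the total conjugating element type-preserving.
  obtain ⟨x, hxpar, hxa, hxc⟩ : ∃ x : Vert Ω, (v.1.length + x.1.length) % 2 = 0 ∧
      x.1.head? ≠ some a ∧ x ∈ branch c := by
    have hroot : ∀ e, (root : Vert Ω).1.head? ≠ some e := fun e => by simp [root_val]
    obtain ⟨b, hba, hbc⟩ := h.exists_ne_ne a c
    have h1 : (step c (root : Vert Ω)).1.head? ≠ some b := by
      rw [head?_step_of_ne (hroot c)]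
      exact fun h' => hbc (Option.some.inj h').symm
    have hl1 : (step c (root : Vert Ω)).1.length = 1 := by
      rw [length_step_of_ne (hroot c)]; rfl
    obtain ⟨b', hba', hbb'⟩ := h.exists_ne_ne a b
    have h2 : (step b (step c (root : Vert Ω))).1.head? ≠ some b' := by
      rw [head?_step_of_ne h1]
      exact fun h' => hbb' (Option.some.inj h').symm
    have hlast : (step b (step c (root : Vert Ω))).1.getLast? = some c := by
      rw [getLast?_step_of_ne h1, getLast?_step_root]; rfl
    rcases Nat.mod_two_eq_zero_or_one v.1.length with hv2 | hv2
    · refine ⟨step b (step c root), ?_, ?_, hlast⟩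
      · rw [length_step_of_ne h1, hl1]; omega
      · rw [head?_step_of_ne h1]
        exact fun h' => hba (Option.some.inj h')
    · refine ⟨step b' (step b (step c root)), ?_, ?_, ?_⟩
      · rw [length_step_of_ne h2, length_step_of_ne h1, hl1]; omega
      · rw [head?_step_of_ne h2]
        exact fun h' => hba' (Option.some.inj h')
      · rw [mem_branch, getLast?_step_of_ne h2, hlast]; rfl
  have hmaps : ∀ u ∈ branch a, transl x u ∈ branch c := by
    intro u hu
    have hne : (transl x root).1.head? ≠ some (localPerm (transl x) root a) := by
      rw [transl_root, localPerm_transl]; exact hxa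
    have := (apply_mem_branch (transl x) hne hu).1
    rw [transl_root, localPerm_transl, Equiv.Perm.one_apply, getLast?_step_of_ne hxa] at this
    rw [mem_branch, this, mem_branch.1 hxc]
    rfl
  set n := transl v * transl x with hn
  have hnU : n ∈ U F := mul_mem (transl_mem_U F _) (transl_mem_U F _)
  have hnt : n ∈ typePreserving Ω := by
    refine mem_typePreserving_of_apply (v := root) ?_
    have h1 := length_apply_add_mod_two (transl v) x
    rw [transl_root] at h1
    rw [hn, RelIso.mul_apply, transl_root, root_val, List.length_nil]
    omega
  have hnE : n ∈ evenAut A := h.mem_evenAut_of_mem_U hnU hnt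
  refine ⟨n⁻¹ * m * n⁻¹⁻¹, hM n⁻¹ (inv_mem hnE) m hm, fun u hu hmem => ?_⟩
  have h1 : n⁻¹ * m * n⁻¹⁻¹ = (transl x)⁻¹ * m' * transl x := by
    rw [hn, hm']; group
  rw [h1] at hmem
  have h2 := hmaps _ hmem
  rw [RelIso.mul_apply, RelIso.mul_apply, RelIso.apply_inv_self] at h2
  exact hc _ (hmaps u hu) h2

/-- The double commutator trick: if k ∈ M moves `branch a` off itself, then p = k x⁻¹ k⁻¹ is trivial
on `branch a` and commutes with x y x⁻¹, so [x, y] = [p x, y]. Here p x = k (x⁻¹ k⁻¹ x) lies in M.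
-/
theorem commutator_mem_of_normal {M : Subgroup (TreeAut Ω)}
    (hM : ∀ g ∈ evenAut A, ∀ m ∈ M, g * m * g⁻¹ ∈ M) {m : TreeAut Ω} (hm : m ∈ M) (hm1 : m ≠ 1)
    {a : Ω} {x y : TreeAut Ω} (hx : x ∈ evenAut A) (hxa : x ∈ fixing (branch a)ᶜ)
    (hy : y ∈ evenAut A) (hya : y ∈ fixing (branch a)ᶜ) : x * y * x⁻¹ * y⁻¹ ∈ M := by
  obtain ⟨k, hk, hka⟩ := h.exists_mem_branch_notMem hM hm hm1 a
  set p := k * x⁻¹ * k⁻¹ with hp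
  have hpf : p ∈ fixing (branch a) := conj_mem_fixing (inv_mem hxa) fun v hv hmem =>
    hka _ hmem (by rwa [RelIso.apply_inv_self])
  have hcomm := mul_comm_of_mem_fixing hpf (mul_mem (mul_mem hxa hya) (inv_mem hxa))
  have hz : p * x ∈ M := by
    have h1 := mul_mem hk (hM x⁻¹ (inv_mem hx) k⁻¹ (inv_mem hk))
    rw [inv_inv] at h1
    have h2 : k * (x⁻¹ * k⁻¹ * x) = p * x := by rw [hp]; group
    rwa [h2] at h1
  have h3 := mul_mem hz (hM y hy _ (inv_mem hz))
  have h4 : p * x * (y * (p * x)⁻¹ * y⁻¹) = (p * (x * y * x⁻¹)) * p⁻¹ * y⁻¹ := by group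
  rw [h4, hcomm, mul_inv_cancel_right] at h3
  exact h3

/-- The generation criterion asks for a subgroup normalized by all of G(F, A), but M is only
normalized by `evenAut A`. It is therefore applied to the intersection C of the G(F, A)-conjugates
of M, each of which is again nontrivial and normalized by `evenAut A`. -/
theorem evenAut_le_of_normal {M : Subgroup (TreeAut Ω)}
    (hM : ∀ g ∈ evenAut A, ∀ m ∈ M, g * m * g⁻¹ ∈ M) {m : TreeAut Ω} (hm : m ∈ M) (hm1 : m ≠ 1) :
    evenAut A ≤ M := by
  let C : Subgroup (TreeAut Ω) :=
    { carrier := {x | ∀ g ∈ G F A, g * x * g⁻¹ ∈ M}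
      one_mem' := fun g _ => by rw [mul_one, mul_inv_cancel]; exact one_mem M
      mul_mem' := fun {x y} hx hy g hg => by
        have := mul_mem (hx g hg) (hy g hg)
        rwa [show g * x * g⁻¹ * (g * y * g⁻¹) = g * (x * y) * g⁻¹ by group] at this
      inv_mem' := fun {x} hx g hg => by
        have := inv_mem (hx g hg)
        rwa [show (g * x * g⁻¹)⁻¹ = g * x⁻¹ * g⁻¹ by group] at this }
  have hC : evenAut A ≤ C := by
    refine h.evenAut_le_of_conj_mem (fun g hg x hx k hk => ?_) fun a x hx y hy g hg => ?_
    · have := hx (k * g) (mul_mem hk hg)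
      rwa [show k * g * x * (k * g)⁻¹ = k * (g * x * g⁻¹) * k⁻¹ by group] at this
    · have hE : ∀ z ∈ rist F a, z ∈ evenAut A := fun z hz => h.mem_evenAut_of_mem_U hz.1
        (mem_typePreserving_of_fixed (hz.2 root (root_notMem_branch a)))
      refine h.commutator_mem_of_normal (M := M.comap (MulAut.conj g).toMonoidHom)
        (m := g⁻¹ * m * g) ?_ ?_ ?_ (hE x hx) hx.2 (hE y hy) hy.2
      · intro k hk n hn
        have hn' : g * n * g⁻¹ ∈ M := hn
        have := hM _ (h.evenAut_conj_mem hg hk) _ hn'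
        rw [show g * k * g⁻¹ * (g * n * g⁻¹) * (g * k * g⁻¹)⁻¹ = g * (k * n * k⁻¹) * g⁻¹
          by group] at this
        exact this
      · change g * (g⁻¹ * m * g) * g⁻¹ ∈ M
        rwa [show g * (g⁻¹ * m * g) * g⁻¹ = m by group]
      · intro h'
        apply hm1
        rw [show m = g * (g⁻¹ * m * g) * g⁻¹ by group, h']
        group
  intro x hx
  have := hC hx 1 (one_mem _)
  simpa using this

/-- Two translations of length two leaving the root in different directions: the last letter of the
image of the root tells the order of the factors. -/
theorem exists_not_commute : ∃ x ∈ N F A, ∃ y ∈ N F A, x * y ≠ y * x := by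
  have hc := h.three_le_card
  obtain ⟨a, -⟩ : ∃ a : Ω, True := by
    have : Nonempty Ω := Fintype.card_pos_iff.1 (by omega)
    exact ⟨Classical.arbitrary Ω, trivial⟩
  obtain ⟨b, hba, -⟩ := h.exists_ne_ne a a
  obtain ⟨c, hca, hcb⟩ := h.exists_ne_ne a b
  have hroot : ∀ e, (root : Vert Ω).1.head? ≠ some e := fun e => by simp [root_val]
  have h1 : ∀ e, e ≠ a → (step e (root : Vert Ω)).1.head? ≠ some a := fun e he => by
    rw [head?_step_of_ne (hroot e)]
    exact fun h' => he (Option.some.inj h')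
  have hmem : ∀ e, e ≠ a → transl (step a (step e (root : Vert Ω))) ∈ N F A := fun e he =>
    h.mem_N_of_mem_U (transl_mem_U F _) (transl_mem_typePreserving (by
      rw [length_step_of_ne (h1 e he), length_step_of_ne (hroot e), root_val, List.length_nil]))
  refine ⟨_, hmem b hba, _, hmem c hca, fun heq => ?_⟩
  have h2 := congrArg (fun g : TreeAut Ω => (g root).1.getLast?) heq
  have h3 : ∀ e f, e ≠ a → f ≠ a → ((transl (step a (step e (root : Vert Ω))) *
      transl (step a (step f (root : Vert Ω)))) root).1.getLast? = some e := by
    intro e f he hf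
    have h4 : (step a (step e (root : Vert Ω))).1.head? ≠ some f := by
      rw [head?_step_of_ne (h1 e he)]
      exact fun h' => hf (Option.some.inj h').symm
    have h5 : (step f (step a (step e (root : Vert Ω)))).1.head? ≠ some a := by
      rw [head?_step_of_ne h4]
      exact fun h' => hf (Option.some.inj h')
    rw [RelIso.mul_apply, transl_root, transl_step, transl_step, transl_root,
      getLast?_step_of_ne h5, getLast?_step_of_ne h4, getLast?_step_of_ne (h1 e he),
      getLast?_step_root]
    rfl
  simp only [h3 b c hba hca, h3 c b hca hba] at h2
  exact hcb (Option.some.inj h2).symm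

theorem isSimpleGroup_N : IsSimpleGroup (N F A) := by
  obtain ⟨x, hx, y, hy, hxy⟩ := h.exists_not_commute
  have : Nontrivial (N F A) := by
    refine ⟨⟨⟨x, hx⟩, 1, fun h' => hxy ?_⟩⟩
    have h1 : x = 1 := congrArg Subtype.val h'
    rw [h1, one_mul, mul_one]
  refine ⟨fun H hH => ?_⟩
  rw [or_iff_not_imp_left]
  intro hne
  obtain ⟨⟨m, hm⟩, hm1⟩ := Subgroup.ne_bot_iff_exists_ne_one.1 hne
  have hle := h.evenAut_le_of_normal (M := H.map (N F A).subtype) (m := ((m : N F A) : TreeAut Ω))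
    (by
      rintro g hg _ ⟨k, hk, rfl⟩
      rw [← h.N_eq] at hg
      exact ⟨⟨g, hg⟩ * k * ⟨g, hg⟩⁻¹, hH.conj_mem k hk ⟨g, hg⟩, rfl⟩)
    ⟨m, hm, rfl⟩ (fun h' => hm1 (Subtype.ext (Subtype.ext h')))
  rw [eq_top_iff]
  intro g _
  obtain ⟨k, hk, hkg⟩ := hle (h.N_eq.le g.2)
  rwa [← Subtype.ext (show ((k : N F A) : TreeAut Ω) = g from hkg)]

end IsAmple

end Simplicity

end LocalAction

namespace LocalAction

/-! ### The topology of N(F, A) -/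

section Topology

variable {Ω : Type*}

theorem length_apply_of_root {g : TreeAut Ω} (hg : g root = root) (v : Vert Ω) :
    (g v).1.length = v.1.length := by
  induction v using Vert.induction with
  | h0 => rw [hg]
  | hs a v hv ih =>
    rw [apply_step, length_step_of_ne hv, length_step_of_ne, ih]
    by_cases hr : v = root
    · rw [hr, hg]; simp [root_val]
    · obtain ⟨b, hb⟩ := exists_mem_branch hr
      rw [(apply_mem_branch g (by rw [hg]; simp [root_val]) hb).2]
      intro h
      obtain ⟨c, hc, hca⟩ := Option.map_eq_some_iff.1 h
      rw [(localPerm g v).injective hca] at hc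
      exact hv hc

theorem length_step_root (a : Ω) : (step a (root : Vert Ω)).1.length = 1 := by
  rw [length_step_of_ne (by simp [root_val])]
  rfl

theorem finite_sphere [Finite Ω] (n : ℕ) : {v : Vert Ω | v.1.length = n}.Finite :=
  (List.finite_length_eq Ω n).preimage (f := fun v : Vert Ω => v.1) Subtype.val_injective.injOn

theorem finite_ball [Finite Ω] (n : ℕ) : {v : Vert Ω | v.1.length ≤ n}.Finite :=
  (List.finite_length_le Ω n).preimage (f := fun v : Vert Ω => v.1) Subtype.val_injective.injOn

/-- The stabilizer of the root in `N(F, F') ∩ U(F)`. -/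
def rootStab (F A : Subgroup (Equiv.Perm Ω)) : Subgroup (N F A) :=
  (U F ⊓ fixing {root}).subgroupOf (N F A)

theorem mem_rootStab {F A : Subgroup (Equiv.Perm Ω)} {g : N F A} :
    g ∈ rootStab F A ↔ (g : TreeAut Ω) ∈ U F ∧ (g : TreeAut Ω) root = root :=
  ⟨fun h => ⟨h.1, h.2 root rfl⟩, fun h => ⟨h.1, by rintro v rfl; exact h.2⟩⟩

variable [Finite Ω] {F A : Subgroup (Equiv.Perm Ω)}

open scoped Topology in
theorem nhds_one_hasBasis_N : (𝓝 (1 : N F A)).HasBasis (fun S : Set (Vert Ω) => S.Finite)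
    fun S => {g | (g : TreeAut Ω) ∈ U F ⊓ fixing S} := by
  have h1 := (basisG F A).nhds_one_hasBasis
  have h2 : 𝓝 (1 : N F A) = Filter.comap (Subgroup.inclusion (N_le_G F A)) (𝓝 1) := by
    rw [nhds_induced, map_one]
  rw [h2]
  refine ⟨fun t => ?_⟩
  rw [(h1.comap _).mem_iff]
  constructor
  · rintro ⟨_, ⟨S, hS, rfl⟩, h⟩
    exact ⟨S, hS, h⟩
  · rintro ⟨S, hS, h⟩
    exact ⟨_, ⟨S, hS, rfl⟩, h⟩

open scoped Topology in
theorem isOpen_of_mul_mem {T : Set (N F A)} (S : N F A → Set (Vert Ω))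
    (hS : ∀ x, (S x).Finite)
    (h : ∀ x ∈ T, ∀ u : N F A, (u : TreeAut Ω) ∈ U F ⊓ fixing (S x) → x * u ∈ T) : IsOpen T := by
  rw [isOpen_iff_mem_nhds]
  intro x hx
  rw [← map_mul_left_nhds_one x, Filter.mem_map, nhds_one_hasBasis_N.mem_iff]
  exact ⟨S x, hS x, fun u hu => h x hx u hu⟩

theorem isClopen_of_mul_mem {T : Set (N F A)} (S : Set (Vert Ω)) (hS : S.Finite)
    (h : ∀ x, ∀ u : N F A, (u : TreeAut Ω) ∈ U F ⊓ fixing S → (x * u ∈ T ↔ x ∈ T)) :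
    IsClopen T :=
  ⟨⟨isOpen_of_mul_mem (fun _ => S) (fun _ => hS) fun x hx u hu hc => hx ((h x u hu).1 hc)⟩,
    isOpen_of_mul_mem (fun _ => S) (fun _ => hS) fun x hx u hu => (h x u hu).2 hx⟩

theorem isClopen_apply_eq (v w : Vert Ω) : IsClopen {g : N F A | (g : TreeAut Ω) v = w} := by
  refine isClopen_of_mul_mem {v} (Set.finite_singleton v) fun x u hu => ?_
  simp only [Set.mem_ofPred_eq, Subgroup.coe_mul, RelIso.mul_apply, hu.2 v rfl]

theorem isClopen_localPerm_mem (v : Vert Ω) (T : Set (Equiv.Perm Ω)) :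
    IsClopen {g : N F A | localPerm (g : TreeAut Ω) v ∈ T} := by
  refine isClopen_of_mul_mem (insert v (Set.range fun a => step a v))
    ((Set.finite_range _).insert _) fun x u hu => ?_
  have h1 : (u : TreeAut Ω) v = v := hu.2 v (Set.mem_insert _ _)
  have h2 : localPerm (u : TreeAut Ω) v = 1 := by
    rw [← localPerm_one v]
    exact localPerm_congr h1 fun a => hu.2 _ (Set.mem_insert_of_mem _ ⟨a, rfl⟩)
  simp only [Set.mem_ofPred_eq, Subgroup.coe_mul, localPerm_mul, h1, h2, mul_one]

theorem t2Space_N : T2Space (N F A) := by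
  refine IsTopologicalGroup.t2Space_of_one_sep fun x hx => ?_
  obtain ⟨v, hv⟩ : ∃ v, (x : TreeAut Ω) v ≠ v := by
    by_contra! hcon
    exact hx (Subtype.ext (RelIso.ext hcon))
  exact ⟨_, nhds_one_hasBasis_N.mem_of_mem (Set.finite_singleton v), fun h => hv (h.2 v rfl)⟩

theorem totallyDisconnectedSpace_N : TotallyDisconnectedSpace (N F A) := by
  refine ⟨isTotallyDisconnected_of_isTotallySeparated fun x _ y _ hxy => ?_⟩
  obtain ⟨v, hv⟩ : ∃ v, (x : TreeAut Ω) v ≠ (y : TreeAut Ω) v := by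
    by_contra! hcon
    exact hxy (Subtype.ext (RelIso.ext hcon))
  have h := isClopen_apply_eq (F := F) (A := A) v ((x : TreeAut Ω) v)
  exact ⟨_, _, h.isOpen, h.compl.isOpen, rfl, fun h => hv h.symm, by
    rw [Set.union_compl_self], disjoint_compl_right⟩

theorem isOpen_rootStab : IsOpen (rootStab F A : Set (N F A)) :=
  Subgroup.isOpen_of_mem_nhds _ (g := 1)
    (nhds_one_hasBasis_N.mem_of_mem (Set.finite_singleton root))

end Topology

/-! ### Compact vertex stabilizers, and pairs of odd vertices at distance two -/

section CompactGeneration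

variable {Ω : Type*} [Fintype Ω] [DecidableEq Ω] {F A F' A' : Subgroup (Equiv.Perm Ω)}

-- Each vertex has finitely many possible images under the root stabilizer, so an ultrafilter on it
-- converges pointwise to an automorphism. Membership in U(F) passes to the limit since local
-- permutations depend on finitely many vertices, and `mem_N_of_mem_U` keeps the limit in N(F, A).
open scoped Topology in
theorem IsAmple.isCompact_rootStab (h : IsAmple F A) :
    IsCompact (rootStab F A : Set (N F A)) := by
  rw [isCompact_iff_ultrafilter_le_nhds]
  intro f hf
  have hC : ∀ᶠ g in (f : Filter (N F A)), g ∈ rootStab F A := Filter.le_principal_iff.1 hf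
  have hfin : ∀ (e : N F A → N F A), (∀ g ∈ rootStab F A, e g ∈ rootStab F A) →
      ∀ v, ∃ w, ∀ᶠ g in (f : Filter (N F A)), ((e g : N F A) : TreeAut Ω) v = w := by
    intro e he v
    have h1 : ⋃ w ∈ {w : Vert Ω | w.1.length = v.1.length},
        {g : N F A | ((e g : N F A) : TreeAut Ω) v = w} ∈ f := by
      filter_upwards [hC] with g hg
      simp only [Set.mem_iUnion]
      exact ⟨_, length_apply_of_root (mem_rootStab.1 (he g hg)).2 v, rfl⟩
    obtain ⟨w, -, hw⟩ := (Ultrafilter.finite_biUnion_mem_iff (finite_sphere _)).1 h1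
    exact ⟨w, hw⟩
  obtain ⟨k, hk⟩ := exists_limit (f : Filter (N F A)) (fun g => (g : TreeAut Ω))
    (hfin (fun g => g) fun _ hg => hg) (hfin (fun g => g⁻¹) fun _ hg => inv_mem hg)
  have hkr : k root = root := by
    obtain ⟨g, hg, hg'⟩ := ((hk root).and hC).exists
    rw [← hg, (mem_rootStab.1 hg').2]
  have hkU : k ∈ U F := by
    intro v
    obtain ⟨g, hg, hg'⟩ := ((eventually_localPerm_eq hk v).and hC).exists
    rw [← hg]
    exact (mem_rootStab.1 hg').1 v
  have hkN : k ∈ N F A := h.mem_N_of_mem_U hkU (mem_typePreserving_of_fixed hkr)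
  refine ⟨⟨k, hkN⟩, mem_rootStab.2 ⟨hkU, hkr⟩, ?_⟩
  rw [← map_mul_left_nhds_one, (nhds_one_hasBasis_N.map _).ge_iff]
  intro S hS
  have h2 : ∀ᶠ g : N F A in (f : Filter (N F A)), ∀ v ∈ S, (g : TreeAut Ω) v = k v :=
    (Filter.eventually_all_finite hS).2 fun v _ => hk v
  refine Filter.mem_of_superset (Filter.inter_mem h2 hC) ?_
  rintro g ⟨hg, hgC⟩
  refine ⟨(⟨k, hkN⟩ : N F A)⁻¹ * g, ⟨?_, fun v hv => ?_⟩, mul_inv_cancel_left _ _⟩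
  · exact (U F).mul_mem ((U F).inv_mem hkU) (mem_rootStab.1 hgC).1
  · have h3 : k⁻¹ ((g : TreeAut Ω) v) = v := by rw [hg v hv, RelIso.inv_apply_self]
    exact h3

theorem IsAmple.locallyCompactSpace_N (h : IsAmple F A) : LocallyCompactSpace (N F A) :=
  h.isCompact_rootStab.locallyCompactSpace_of_mem_nhds_of_group (x := 1)
    (isOpen_rootStab.mem_nhds (one_mem _))

theorem oddSet_conj (h : IsEvenPart F A) {u x : TreeAut Ω} (hu : u ∈ U F) :
    oddSet (u * x * u⁻¹) = u '' oddSet x := by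
  ext v
  rw [mem_oddSet, sgn_mul, sgn_mul, h.sgn_eq_one hu, h.sgn_eq_one (inv_mem hu), one_mul, mul_one]
  constructor
  · exact fun hv => ⟨_, hv, RelIso.apply_inv_self u v⟩
  · rintro ⟨w, hw, rfl⟩
    rwa [RelIso.inv_apply_self]

theorem oddSet_mul_of_adjacent {x y : TreeAut Ω} {u v w : Vert Ω} (hvw : v ≠ w) (huv : u ≠ v)
    (huw : u ≠ w) (hy : oddSet y = {v, u}) (hx : oddSet x = {y u, y w}) :
    oddSet (x * y) = {v, w} := by
  have hy' : ∀ z, sgn y z ≠ 1 ↔ z = v ∨ z = u := fun z => by rw [← mem_oddSet, hy]; rfl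
  have hx' : ∀ z, sgn x (y z) ≠ 1 ↔ z = u ∨ z = w := fun z => by
    rw [← mem_oddSet, hx]
    simp
  ext z
  rw [mem_oddSet, sgn_mul]
  simp only [Set.mem_insert_iff, Set.mem_singleton_iff]
  by_cases h1 : z = u
  · subst h1
    rw [units_mul_eq_one ((hx' z).2 (Or.inl rfl)) ((hy' z).2 (Or.inr rfl))]
    simp [huv, huw]
  · by_cases h2 : z = v
    · subst h2
      have : sgn x (y z) = 1 := by
        by_contra h'
        rcases (hx' z).1 h' with h' | h'
        · exact h1 h'
        · exact hvw h'
      rw [this, one_mul, hy']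
      simp
    · have : sgn y z = 1 := by
        by_contra h'
        rcases (hy' z).1 h' with h' | h'
        · exact h2 h'
        · exact h1 h'
      rw [this, mul_one, hx']
      simp [h1, h2]

/-- It suffices to have elements that are odd at precisely two vertices for pairs of vertices at
distance two. -/
theorem exists_pair_of_distance_two {M : Subgroup (TreeAut Ω)}
    (hp : ∀ (m : Vert Ω) (a b : Ω), a ≠ b →
      ∃ x ∈ M, x ∈ evenAut A ∧ oddSet x = {step a m, step b m})
    {v w : Vert Ω} (hvw : v ≠ w) (hpar : v.1.length % 2 = w.1.length % 2) :
    ∃ x ∈ M, x ∈ evenAut A ∧ oddSet x = {v, w} := by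
  have main : ∀ l : List Ω, ∀ v w : Vert Ω, v ≠ w → l.foldl (fun u a => step a u) v = w →
      v.1.length % 2 = w.1.length % 2 → ∃ x ∈ M, x ∈ evenAut A ∧ oddSet x = {v, w} := by
    intro l
    induction hn : l.length using Nat.strong_induction_on generalizing l with
    | _ n ih =>
      intro v w hvw hl hpar
      match l, hn, hl with
      | [], _, hl => exact absurd hl hvw
      | [a], _, hl =>
        have h1 : step a v = w := hl
        have := length_step_mod_two a v
        rw [h1] at this
        omega
      | a :: b :: l, hn, hl =>
        have hl' : l.foldl (fun u a => step a u) (step b (step a v)) = w := hl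
        have hlen : l.length < n := by rw [← hn]; simp
        by_cases hab : a = b
        · subst hab
          rw [step_step] at hl'
          exact ih _ hlen l rfl v w hvw hl' hpar
        · set u := step b (step a v) with hu
          obtain ⟨y, hy, hye, hyo⟩ := hp (step a v) a b hab
          rw [step_step, ← hu] at hyo
          by_cases huw : u = w
          · exact ⟨y, hy, hye, by rw [hyo, huw]⟩
          · have huv : u ≠ v := fun h' => by
              have h2 : step b (step a v) = step a (step a v) := by rw [← hu, h', step_step]
              exact hab (step_left_injective _ h2).symm
            -- The second factor x acts after y, so the rest of the path has to be transported by y;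
            -- this recolours the path but keeps its length.
            have hfold : ∀ (l : List Ω) (g : TreeAut Ω) (z : Vert Ω), ∃ l' : List Ω,
                l'.length = l.length ∧
                l'.foldl (fun u a => step a u) (g z) = g (l.foldl (fun u a => step a u) z) := by
              intro l
              induction l with
              | nil => exact fun g z => ⟨[], rfl, rfl⟩
              | cons c l ihl =>
                intro g z
                obtain ⟨l', hl1, hl2⟩ := ihl g (step c z)
                refine ⟨localPerm g z c :: l', by simp [hl1], ?_⟩
                rw [List.foldl_cons, List.foldl_cons, ← hl2, apply_step]
            obtain ⟨l', hl1, hl2⟩ := hfold l y u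
            have hupar : u.1.length % 2 = v.1.length % 2 := by
              rw [hu]
              have h1 := length_step_mod_two a v
              have h2 := length_step_mod_two b (step a v)
              omega
            obtain ⟨x, hx, hxe, hxo⟩ := ih l'.length (by omega) l' rfl (y u) (y w)
              (fun h' => huw (y.injective h')) (by rw [hl2, hl'])
              (by rw [hye.2.2.1, hye.2.2.1]; omega)
            exact ⟨x * y, mul_mem hx hy, mul_mem hxe hye,
              oddSet_mul_of_adjacent hvw huv huw hyo hxo⟩
  have hpath : ∀ v w : Vert Ω, ∃ l : List Ω, l.foldl (fun u a => step a u) v = w := by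
    have h0 : ∀ v : Vert Ω, ∃ l : List Ω, l.foldl (fun u a => step a u) v = root := by
      intro v
      induction v using Vert.step_induction with
      | h0 => exact ⟨[], rfl⟩
      | hs a v ih =>
        obtain ⟨l, hl⟩ := ih
        exact ⟨a :: l, by rw [List.foldl_cons, step_step, hl]⟩
    intro v w
    induction w using Vert.step_induction with
    | h0 => exact h0 v
    | hs a w ih =>
      obtain ⟨l, hl⟩ := ih
      exact ⟨l ++ [a], by rw [List.foldl_append, hl]; rfl⟩
  obtain ⟨l, hl⟩ := hpath v w
  exact main l v w hvw hl hpar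

end CompactGeneration

end LocalAction

namespace LocalAction

/-! ### Compact generation -/

section CompactGeneration

variable {Ω : Type*} [Fintype Ω] [DecidableEq Ω] {F A F' A' : Subgroup (Equiv.Perm Ω)}

theorem IsAmple.exists_pair_evenAut (h : IsAmple F A) {v w : Vert Ω} (hvw : v ≠ w)
    (hpar : v.1.length % 2 = w.1.length % 2) : ∃ x ∈ N F A, oddSet (x : TreeAut Ω) = {v, w} := by
  obtain ⟨x, hx, -, hxo⟩ := h.exists_pair (M := N F A) (fun u hu hut => h.mem_N_of_mem_U hu hut)
    (fun g hg m hm => N_conj_mem hg hm) hvw hpar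
  exact ⟨x, hx, hxo⟩

/-- Generators: the compact root stabilizer, finitely many translations that carry the root along it
two steps at a time, elements odd at a pair of neighbours of the root, and the conjugates of the
latter by a type-reversing translation. -/
theorem IsAmple.exists_isCompact_closure_eq_top (h : IsAmple F A) :
    ∃ S : Set (N F A), IsCompact S ∧ Subgroup.closure S = ⊤ := by
  have hcard := h.three_le_card
  obtain ⟨c, -⟩ : ∃ c : Ω, True := by
    have : Nonempty Ω := Fintype.card_pos_iff.1 (by omega)
    exact ⟨Classical.arbitrary Ω, trivial⟩
  have hpair : ∀ a b : Ω, ∃ x : N F A,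
      a ≠ b → oddSet (x : TreeAut Ω) = {step a root, step b root} := by
    intro a b
    by_cases hab : a = b
    · exact ⟨1, fun h' => absurd hab h'⟩
    · obtain ⟨x, hx, hxo⟩ := h.exists_pair_evenAut (v := step a root) (w := step b root)
        (fun h' => hab (step_left_injective _ h')) (by rw [length_step_root, length_step_root])
      exact ⟨⟨x, hx⟩, fun _ => hxo⟩
  choose x hx using hpair
  have hgc : ∀ g : N F A, transl (step c root) * (g : TreeAut Ω) * (transl (step c root))⁻¹ ∈
      N F A := fun g => N_conj_mem (h.U_le_G (transl_mem_U F _)) g.2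
  have htr : ∀ w : Vert Ω, w.1.length % 2 = 0 → transl w ∈ N F A := fun w hw =>
    h.mem_N_of_mem_U (transl_mem_U F w) (transl_mem_typePreserving hw)
  have htab : ∀ a b : Ω, transl (step a (step b (root : Vert Ω))) ∈ N F A := fun a b =>
    htr _ (by
      have := length_step_mod_two a (step b (root : Vert Ω))
      rw [length_step_root] at this
      omega)
  set S : Set (N F A) := (rootStab F A : Set (N F A)) ∪
    (Set.range (fun p : Ω × Ω => x p.1 p.2) ∪
      (Set.range (fun p : Ω × Ω => (⟨_, hgc (x p.1 p.2)⟩ : N F A)) ∪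
        Set.range (fun p : Ω × Ω => (⟨_, htab p.1 p.2⟩ : N F A)))) with hS
  refine ⟨S, h.isCompact_rootStab.union (((Set.finite_range _).union
    ((Set.finite_range _).union (Set.finite_range _))).isCompact), ?_⟩
  set M : Subgroup (TreeAut Ω) := (Subgroup.closure S).map (N F A).subtype with hM
  have hmem : ∀ g : N F A, g ∈ S → (g : TreeAut Ω) ∈ M := fun g hg =>
    ⟨g, Subgroup.subset_closure hg, rfl⟩
  have htrans : ∀ n, ∀ w : Vert Ω, w.1.length = 2 * n → ∃ k ∈ M, k ∈ U F ∧ k root = w := by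
    intro n
    induction n with
    | zero => exact fun w hw => ⟨1, one_mem _, one_mem _,
        (eq_root_iff.2 (List.eq_nil_of_length_eq_zero hw)).symm⟩
    | succ n ih =>
      intro w hw
      obtain ⟨a, u, hu, rfl⟩ := exists_step_eq (v := w) (by
        rintro rfl
        rw [root_val, List.length_nil] at hw
        omega)
      rw [length_step_of_ne hu] at hw
      obtain ⟨b, l, hl, rfl⟩ := exists_step_eq (v := u) (by
        rintro rfl
        rw [root_val, List.length_nil] at hw
        omega)
      rw [length_step_of_ne hl] at hw
      obtain ⟨k, hk, hkU, hkr⟩ := ih l (by omega)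
      refine ⟨transl l * transl (step a (step b root)), ?_,
        mul_mem (transl_mem_U F _) (transl_mem_U F _), ?_⟩
      · have h1 : transl l ∈ M := by
          have h2 : k⁻¹ * transl l ∈ M := by
            have hU := mul_mem (inv_mem hkU) (transl_mem_U F l)
            have hr : (k⁻¹ * transl l) root = root := by
              rw [RelIso.mul_apply, transl_root, ← hkr, RelIso.inv_apply_self]
            exact hmem ⟨_, h.mem_N_of_mem_U hU (mem_typePreserving_of_fixed hr)⟩
              (Or.inl (mem_rootStab.2 ⟨hU, hr⟩))
          have := mul_mem hk h2
          rwa [mul_inv_cancel_left] at this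
        exact mul_mem h1 (hmem ⟨_, htab a b⟩ (Or.inr (Or.inr (Or.inr ⟨(a, b), rfl⟩))))
      · rw [RelIso.mul_apply, transl_root, transl_step, transl_step, transl_root]
  have hU : ∀ u ∈ U F, u ∈ typePreserving Ω → u ∈ M := by
    intro u hu hut
    have hpar := hut root
    rw [root_val, List.length_nil] at hpar
    obtain ⟨k, hk, hkU, hkr⟩ := htrans ((u root).1.length / 2) (u root) (by omega)
    have h1 := mul_mem (inv_mem hkU) hu
    have hr : (k⁻¹ * u) root = root := by
      rw [RelIso.mul_apply, ← hkr, RelIso.inv_apply_self]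
    have h2 := mul_mem hk (hmem ⟨_, h.mem_N_of_mem_U h1 (mem_typePreserving_of_fixed hr)⟩
      (Or.inl (mem_rootStab.2 ⟨h1, hr⟩)))
    rwa [mul_inv_cancel_left] at h2
  have hp : ∀ (m : Vert Ω) (a b : Ω), a ≠ b →
      ∃ y ∈ M, y ∈ evenAut A ∧ oddSet y = {step a m, step b m} := by
    intro m a b hab
    have hxab := hx a b hab
    have hEN : ∀ g ∈ N F A, g ∈ evenAut A := fun g hg => h.N_eq ▸ hg
    have ho : oddSet (transl m * (x a b : TreeAut Ω) * (transl m)⁻¹) = {step a m, step b m} := by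
      rw [oddSet_conj h.toIsEvenPart (transl_mem_U F m), hxab, Set.image_pair, transl_step,
        transl_step, transl_root]
    refine ⟨_, ?_, hEN _ (N_conj_mem (h.U_le_G (transl_mem_U F m)) (x a b).2), ho⟩
    -- Pairs around m come from pairs around the root if m has even length. For odd length the
    -- translation to m is not type-preserving, and the conjugated family, centred at `step c root`,
    -- is used.
    rcases Nat.mod_two_eq_zero_or_one m.1.length with hm | hm
    · have h1 := hU _ (transl_mem_U F m) (transl_mem_typePreserving hm)
      exact mul_mem (mul_mem h1 (hmem _ (Or.inr (Or.inl ⟨(a, b), rfl⟩)))) (inv_mem h1)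
    · have h1 := hU _ (mul_mem (transl_mem_U F m) (inv_mem (transl_mem_U F (step c root))))
        (transl_mul_inv_mem_typePreserving (by rw [length_step_root, hm]))
      have h2 := mul_mem (mul_mem h1 (hmem _ (Or.inr (Or.inr (Or.inl ⟨(a, b), rfl⟩)))))
        (inv_mem h1)
      convert h2 using 1
      dsimp only
      group
  have hle : evenAut A ≤ M := h.evenAut_le hU fun v w hvw hpar =>
    exists_pair_of_distance_two hp hvw hpar
  rw [eq_top_iff]
  intro g _
  obtain ⟨k, hk, hkg⟩ := hle (h.N_eq.le g.2)
  rwa [← Subtype.ext (show ((k : N F A) : TreeAut Ω) = g from hkg)]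

theorem IsAmple.isCompactlyGeneratedTDLC_N (h : IsAmple F A) :
    IsCompactlyGeneratedTDLC (N F A) :=
  ⟨inferInstance, t2Space_N, totallyDisconnectedSpace_N, h.locallyCompactSpace_N,
    h.exists_isCompact_closure_eq_top⟩

end CompactGeneration

/-! ### The closed cocompact inclusion -/

section Inclusion

variable {Ω : Type*} [Fintype Ω] [DecidableEq Ω] {F A F' A' : Subgroup (Equiv.Perm Ω)}

theorem evenAut_mono (h : A ≤ A') : evenAut A ≤ evenAut A' :=
  fun _ hg => ⟨U_mono h hg.1, hg.2⟩

theorem mem_evenAut_iff_of_le (h : A ≤ A') {g : TreeAut Ω} :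
    g ∈ evenAut A ↔ g ∈ evenAut A' ∧ g ∈ U A :=
  ⟨fun hg => ⟨evenAut_mono h hg, hg.1⟩, fun hg => ⟨hg.2, hg.1.2⟩⟩

/-- Every element of `evenAut A'` can be moved into `U(F')` by an element of `evenAut A`. -/
theorem IsEvenPart.exists_mul_mem (h : IsEvenPart F A) (h' : IsEvenPart F' A') (hA : A ≤ A')
    {g : TreeAut Ω} (hg : g ∈ evenAut A') (a : Ω) :
    ∃ k ∈ evenAut A, k * g ∈ U F' ∧ (k * g) root = root ∧
      (k * g) (step a root) = step a root := by
  set m := (transl (g root))⁻¹ with hm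
  have hmr : (m * g) root = root := by rw [RelIso.mul_apply, hm, transl_inv_apply]
  have hmt : m ∈ typePreserving Ω := inv_mem (transl_mem_typePreserving (by
    have := hg.2.2.1 root
    rwa [root_val, List.length_nil] at this))
  have hmE : m ∈ evenAut A := h.mem_evenAut_of_mem_U (inv_mem (transl_mem_U F _)) hmt
  have hmg : m * g ∈ evenAut A' := mul_mem (evenAut_mono hA hmE) hg
  -- The odd vertices of k are chosen to cancel all the signs of m g. The parity conditions on k are
  -- then automatic, because k (m g) ∈ U(F') and m g both satisfy them.
  obtain ⟨k, hkr, hka, hkA, hko⟩ := h.exists_aut_oddSet ((m * g) '' oddSet (m * g))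
    (localPerm (m * g) root a) a
  have hs : ∀ v, sgn (k * (m * g)) v = 1 := by
    intro v
    have hiff : sgn k ((m * g) v) ≠ 1 ↔ sgn (m * g) v ≠ 1 := by
      rw [← mem_oddSet, hko, ← mem_oddSet]
      exact (m * g).injective.mem_set_image
    rw [sgn_mul]
    by_cases hv : sgn (m * g) v = 1
    · rw [hv, mul_one]
      by_contra hc
      exact hiff.1 hc hv
    · exact units_mul_eq_one (hiff.2 hv) hv
  have hr : (k * (m * g)) root = root := by rw [RelIso.mul_apply, hmr, hkr]
  have hU : k * (m * g) ∈ U F' :=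
    h'.mem_U_iff.2 ⟨mul_mem (U_mono hA hkA) hmg.1, hs⟩
  have hkE : k ∈ evenAut A := by
    rw [mem_evenAut_iff_of_le hA]
    refine ⟨?_, hkA⟩
    have := mul_mem (h'.mem_evenAut_of_mem_U hU (mem_typePreserving_of_fixed hr)) (inv_mem hmg)
    rwa [mul_inv_cancel_right] at this
  refine ⟨k * m, mul_mem hkE hmE, by rwa [mul_assoc], by rwa [mul_assoc], ?_⟩
  rw [mul_assoc, apply_step, hr, localPerm_mul, hmr, Equiv.Perm.mul_apply, hka]

theorem IsAmple.N_le_N (h : IsAmple F A) (h' : IsAmple F' A') (hA : A ≤ A') :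
    N F A ≤ N F' A' := by
  rw [h.N_eq, h'.N_eq]
  exact evenAut_mono hA

theorem mem_range_inclusion {Γ : Type*} [Group Γ] {H K : Subgroup Γ} (h : H ≤ K) {g : K} :
    g ∈ (Subgroup.inclusion h).range ↔ (g : Γ) ∈ H :=
  ⟨by rintro ⟨k, rfl⟩; exact k.2, fun hg => ⟨⟨g, hg⟩, rfl⟩⟩

theorem IsAmple.mem_range_inclusion_iff (h : IsAmple F A) (h' : IsAmple F' A') (hA : A ≤ A')
    {g : N F' A'} :
    g ∈ (Subgroup.inclusion (h.N_le_N h' hA)).range ↔ (g : TreeAut Ω) ∈ U A := by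
  have hg : (g : TreeAut Ω) ∈ evenAut A' := h'.N_eq.le g.2
  rw [mem_range_inclusion, h.N_eq, mem_evenAut_iff_of_le hA, and_iff_right hg]

-- For elements with local permutations in A, lying in U(F) and lying in U(F') both mean that all
-- signs are trivial, so the two topologies agree. The image is the intersection of clopen local
-- conditions.
open scoped Topology in
theorem IsAmple.isClosedEmbedding_inclusion (h : IsAmple F A) (h' : IsAmple F' A') (hA : A ≤ A') :
    Topology.IsClosedEmbedding (Subgroup.inclusion (h.N_le_N h' hA)) := by
  have key : ∀ S : Set (Vert Ω), Subgroup.inclusion (h.N_le_N h' hA) ⁻¹'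
      {g : N F' A' | (g : TreeAut Ω) ∈ U F' ⊓ fixing S} =
        {g : N F A | (g : TreeAut Ω) ∈ U F ⊓ fixing S} := by
    intro S
    ext ⟨g, hgN⟩
    have hg : g ∈ U A := (N_le_G F A hgN).2
    have hiff : g ∈ U F' ↔ g ∈ U F := by
      rw [h.mem_U_iff, h'.mem_U_iff]
      exact ⟨fun h1 => ⟨hg, h1.2⟩, fun h1 => ⟨U_mono hA hg, h1.2⟩⟩
    exact and_congr_left fun _ => hiff
  have h1 := (nhds_one_hasBasis_N (F := F') (A := A')).comap
    (Subgroup.inclusion (h.N_le_N h' hA))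
  simp_rw [key] at h1
  refine ⟨⟨(IsTopologicalGroup.isInducing_iff_nhds_one
    (f := Subgroup.inclusion (h.N_le_N h' hA))).2 ?_, Subgroup.inclusion_injective _⟩, ?_⟩
  · exact (nhds_one_hasBasis_N (F := F) (A := A)).eq_of_same_basis h1
  · have : Set.range (Subgroup.inclusion (h.N_le_N h' hA)) =
        ⋂ v, {g : N F' A' | localPerm (g : TreeAut Ω) v ∈ A} := by
      ext g
      rw [Set.mem_iInter]
      exact h.mem_range_inclusion_iff h' hA
    rw [this]
    exact isClosed_iInter fun v => (isClopen_localPerm_mem v A).isClosed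

/-- By `exists_mul_mem` the compact root stabilizer of the larger group maps onto the quotient. -/
theorem IsAmple.compactSpace_quotient (h : IsAmple F A) (h' : IsAmple F' A') (hA : A ≤ A') :
    CompactSpace (N F' A' ⧸ (Subgroup.inclusion (h.N_le_N h' hA)).range) := by
  have hcard := h.three_le_card
  obtain ⟨a, -⟩ : ∃ a : Ω, True := by
    have : Nonempty Ω := Fintype.card_pos_iff.1 (by omega)
    exact ⟨Classical.arbitrary Ω, trivial⟩
  refine ⟨?_⟩
  have h1 := h'.isCompact_rootStab.image
    (QuotientGroup.continuous_mk (N := (Subgroup.inclusion (h.N_le_N h' hA)).range))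
  refine h1.of_isClosed_subset isClosed_univ ?_
  intro q _
  obtain ⟨g, rfl⟩ := QuotientGroup.mk_surjective q
  obtain ⟨k, hk, hkU, hkr, -⟩ := h.toIsEvenPart.exists_mul_mem h'.toIsEvenPart hA
    (h'.N_eq.le (inv_mem g.2)) a
  have hkN : k ∈ N F' A' := h'.N_eq.ge (evenAut_mono hA hk)
  let z : N F' A' := ⟨k, hkN⟩
  have hz : z * g⁻¹ ∈ rootStab F' A' := mem_rootStab.2 ⟨hkU, hkr⟩
  refine ⟨(z * g⁻¹)⁻¹, (rootStab F' A').inv_mem hz, ?_⟩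
  rw [QuotientGroup.eq, inv_inv, inv_mul_cancel_right, h.mem_range_inclusion_iff h' hA]
  exact hk.1

end Inclusion

end LocalAction

namespace LocalAction

/-! ### The alternating group is ample -/

section Alternating

theorem exists_notMem_of_card_lt {Ω : Type*} [Fintype Ω] (s : Finset Ω) (h : s.card < Fintype.card Ω) : ∃ a, a ∉ s := by
  obtain ⟨c, -, hc⟩ := Finset.exists_mem_notMem_of_card_lt_card (s := s) (t := Finset.univ)
    (by rwa [Finset.card_univ])
  exact ⟨c, hc⟩

theorem isAmple_alternatingGroup {Ω : Type*} [Fintype Ω] [DecidableEq Ω] (h : 5 ≤ Fintype.card Ω) :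
    IsAmple (alternatingGroup Ω) ⊤ where
  mem_iff s := by simp [Equiv.Perm.mem_alternatingGroup]
  exists_apply_eq a b := by
    by_cases hab : a = b
    · exact ⟨1, one_mem _, hab⟩
    · obtain ⟨c, hc⟩ := exists_notMem_of_card_lt {a, b}
        (Finset.card_le_two.trans_lt (by omega))
      simp only [Finset.mem_insert, Finset.mem_singleton, not_or] at hc
      refine ⟨Equiv.swap a c * Equiv.swap a b, ?_, ?_⟩
      · rw [Equiv.Perm.mem_alternatingGroup, map_mul, Equiv.Perm.sign_swap (Ne.symm hc.1),
          Equiv.Perm.sign_swap hab]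
        rfl
      · rw [Equiv.Perm.mul_apply, Equiv.swap_apply_left,
          Equiv.swap_apply_of_ne_of_ne (Ne.symm hab) (Ne.symm hc.2)]
  exists_odd a := by
    obtain ⟨b, hb⟩ := exists_notMem_of_card_lt {a} (by rw [Finset.card_singleton]; omega)
    obtain ⟨c, hc⟩ := exists_notMem_of_card_lt {a, b}
      (Finset.card_le_two.trans_lt (by omega))
    simp only [Finset.mem_insert, Finset.mem_singleton, not_or] at hb hc
    exact ⟨Equiv.swap b c, trivial,
      Equiv.swap_apply_of_ne_of_ne (Ne.symm hb) (Ne.symm hc.1),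
      Equiv.Perm.sign_swap (Ne.symm hc.2)⟩
  three_le_card := by omega
  exists_move a b hab := by
    obtain ⟨c, hc⟩ := exists_notMem_of_card_lt {a, b}
      (Finset.card_le_two.trans_lt (by omega))
    obtain ⟨d, hd⟩ := exists_notMem_of_card_lt {a, b, c}
      (Finset.card_le_three.trans_lt (by omega))
    simp only [Finset.mem_insert, Finset.mem_singleton, not_or] at hc hd
    refine ⟨Equiv.swap b c * Equiv.swap b d, ?_, ?_, ?_⟩
    · rw [Equiv.Perm.mem_alternatingGroup, map_mul, Equiv.Perm.sign_swap (Ne.symm hc.2),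
        Equiv.Perm.sign_swap (Ne.symm hd.2.1)]
      rfl
    · rw [Equiv.Perm.mul_apply, Equiv.swap_apply_of_ne_of_ne hab (Ne.symm hd.1),
        Equiv.swap_apply_of_ne_of_ne hab (Ne.symm hc.1)]
    · rw [Equiv.Perm.mul_apply, Equiv.swap_apply_left,
        Equiv.swap_apply_of_ne_of_ne hd.2.1 hd.2.2]
      exact hd.2.1
  le_of_stabilizer_le X hX := by
    -- The three-cycles generate, and each of them fixes a point.
    rw [← Equiv.Perm.closure_three_cycles_eq_alternating, Subgroup.closure_le]
    intro s hs
    have hs : s.IsThreeCycle := hs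
    obtain ⟨a, ha⟩ := exists_notMem_of_card_lt s.support (by
      rw [hs.card_support]; omega)
    exact hX a s (Equiv.Perm.mem_alternatingGroup.2 hs.sign) (Equiv.Perm.notMem_support.1 ha)

end Alternating

/-! ### Zolotarev's lemma and the sign of a linear permutation -/

section Signs

open Equiv.Perm

/-- The sign of a permutation that acts on one coordinate of a function. -/
theorem sign_coordinate {ι R : Type*} [Fintype ι] [DecidableEq ι] [Fintype R] [DecidableEq R]
    (hR : Odd (Fintype.card R)) (i : ι) (e : Equiv.Perm R) (f : Equiv.Perm (ι → R))
    (hf : ∀ x, f x = Function.update x i (e (x i))) : sign f = sign e := by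
  -- The permutation f consists of one copy of e for each choice of the other coordinates, an odd
  -- number of copies.
  have h1 : sign f = sign (Equiv.prodCongrLeft fun _ : {j // j ≠ i} → R => e) := by
    refine sign_eq_sign_of_equiv f _ (Equiv.funSplitAt i R) fun x => ?_
    rw [hf]
    refine Prod.ext ?_ (funext fun j => ?_)
    · simp
    · simp [j.2]
  rw [h1, sign_prodCongrLeft, Finset.prod_const, Finset.card_univ, Fintype.card_fun]
  have hodd : Odd (Fintype.card R ^ Fintype.card {j // j ≠ i}) := hR.pow
  rcases Int.units_eq_one_or (sign e) with h | h
  · rw [h, one_pow]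
  · rw [h, hodd.neg_one_pow]

theorem sign_eq_one_of_mul_self {α : Type*} [Fintype α] [DecidableEq α] (s : Equiv.Perm α) :
    sign (s * s) = 1 := by
  rw [map_mul, Int.units_mul_self]

/-- The order of a translation divides the odd number |V|. -/
theorem sign_addRight {V : Type*} [AddCommGroup V] [Fintype V] [DecidableEq V]
    (hV : Odd (Fintype.card V)) (b : V) : sign (Equiv.addRight b) = 1 := by
  have h1 : (Equiv.addRight b) ^ Fintype.card V = 1 := by
    have h2 : ∀ (k : ℕ) (x : V), ((Equiv.addRight b) ^ k) x = x + k • b := by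
      intro k
      induction k with
      | zero => simp
      | succ k ih =>
        intro x
        rw [pow_succ', mul_apply, ih, succ_nsmul]
        exact add_assoc x (k • b) b
    ext x
    rw [h2, card_nsmul_eq_zero, add_zero, one_apply]
  have h2 := congrArg sign h1
  rw [map_pow, map_one] at h2
  rcases Int.units_eq_one_or (sign (Equiv.addRight b)) with h | h
  · exact h
  · rw [h, hV.neg_one_pow] at h2
    exact absurd h2 (by decide)

variable {K : Type*} [Field K] [Fintype K] [DecidableEq K]

/-- Zolotarev's lemma for finite fields. -/
theorem sign_mulLeft (hK : ringChar K ≠ 2) (u : Kˣ) :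
    (sign (Units.mulLeft u) : ℤ) = quadraticChar K u := by
  -- Both sides are multiplicative, so a generator g of the cyclic group Kˣ suffices. It is a
  -- nonsquare, and multiplication by it is a cycle of even length q - 1, hence odd.
  obtain ⟨g, hg⟩ := IsCyclic.exists_monoid_generator (α := Kˣ)
  have hodd := FiniteField.odd_card_of_char_ne_two hK
  have hmul : ∀ k : ℕ, Units.mulLeft (g ^ k) = (Units.mulLeft g) ^ k := by
    intro k
    induction k with
    | zero => ext; simp
    | succ k ih =>
      rw [pow_succ' (Units.mulLeft g), ← ih]
      ext x
      simp [pow_succ', mul_assoc]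
  have hgs : quadraticChar K g = -1 := by
    obtain ⟨a, ha⟩ := FiniteField.exists_nonsquare hK
    rw [quadraticChar_neg_one_iff_not_isSquare]
    intro hsq
    have ha0 : a ≠ 0 := fun h0 => ha (h0 ▸ IsSquare.zero)
    obtain ⟨k, hk⟩ := hg (Units.mk0 a ha0)
    apply ha
    have : a = (g : K) ^ k := by
      have := congrArg Units.val hk
      simpa using this.symm
    rw [this]
    exact hsq.pow k
  have hg1 : g ≠ 1 := by
    rintro rfl
    rw [Units.val_one, map_one] at hgs
    exact absurd hgs (by decide)
  have hsupp : (Units.mulLeft g).support = Finset.univ.erase (0 : K) := by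
    ext x
    simp only [mem_support, Units.mulLeft_apply, Finset.mem_erase, Finset.mem_univ, and_true]
    refine not_congr ⟨fun h => ?_, fun h => by rw [h, mul_zero]⟩
    by_contra hx
    exact hg1 (Units.ext (mul_right_cancel₀ hx (by rw [h, Units.val_one, one_mul])))
  have hcyc : (Units.mulLeft g).IsCycle := by
    refine ⟨1, ?_, fun y hy => ?_⟩
    · exact fun h => hg1 (Units.ext ((mul_one _).symm.trans h))
    · rw [← mem_support, hsupp, Finset.mem_erase] at hy
      obtain ⟨k, hk⟩ := hg (Units.mk0 y hy.1)
      refine ⟨k, ?_⟩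
      have hk : g ^ k = Units.mk0 y hy.1 := hk
      rw [zpow_natCast, ← hmul, hk]
      exact mul_one y
  have hsg : sign (Units.mulLeft g) = -1 := by
    rw [hcyc.sign, hsupp, Finset.card_erase_of_mem (Finset.mem_univ _), Finset.card_univ]
    have : Even (Fintype.card K - 1) := by
      exact ⟨Fintype.card K / 2, by omega⟩
    rw [this.neg_one_pow]
  obtain ⟨k, hk⟩ := hg u
  have hk : g ^ k = u := hk
  rw [← hk, hmul, map_pow, hsg, Units.val_pow_eq_pow_val, Units.val_pow_eq_pow_val, map_pow, hgs]
  rfl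

open Matrix

variable {n : ℕ}

omit [Fintype K] [DecidableEq K] in
/-- The permutation of `Kⁿ` by an invertible matrix. -/
def linPerm : GL (Fin n) K →* Equiv.Perm (Fin n → K) where
  toFun M := ⟨fun x => M.1 *ᵥ x, fun x => M⁻¹.1 *ᵥ x,
    fun x => by
      change M⁻¹.1 *ᵥ M.1 *ᵥ x = x
      rw [mulVec_mulVec, ← Units.val_mul, inv_mul_cancel, Units.val_one, one_mulVec],
    fun x => by
      change M.1 *ᵥ M⁻¹.1 *ᵥ x = x
      rw [mulVec_mulVec, ← Units.val_mul, mul_inv_cancel, Units.val_one, one_mulVec]⟩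
  map_one' := Equiv.ext fun x => one_mulVec x
  map_mul' M M' := Equiv.ext fun x => (mulVec_mulVec x M.1 M'.1).symm

omit [Fintype K] [DecidableEq K] in
theorem linPerm_apply (M : GL (Fin n) K) (x : Fin n → K) : linPerm M x = M.1 *ᵥ x := rfl

/-- Both sides come from homomorphisms on a product of copies of Kˣ, so it is enough to compare them
on one coordinate, by `sign_coordinate`. -/
theorem sign_piMul (hK : ringChar K ≠ 2) (D : Fin n → Kˣ) :
    (sign (Equiv.piCongrRight fun i => Units.mulLeft (D i)) : ℤ) =
      quadraticChar K (∏ i, (D i : K)) := by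
  let f : (Fin n → Kˣ) →* ℤˣ :=
    { toFun := fun D => sign (Equiv.piCongrRight fun i => Units.mulLeft (D i))
      map_one' := by
        convert map_one sign using 2
        ext x i
        simp
      map_mul' := fun D E => by
        rw [← map_mul (sign (α := _))]
        congr 1
        ext x i
        simp [mul_assoc] }
  let g : (Fin n → Kˣ) →* ℤˣ :=
    { toFun := fun D => sign (Units.mulLeft (∏ i, D i))
      map_one' := by
        convert map_one sign using 2
        ext x
        simp
      map_mul' := fun D E => by
        rw [← map_mul (sign (α := _))]
        congr 1
        ext x
        simp [Finset.prod_mul_distrib, mul_assoc] }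
  have hfg : f = g := by
    refine MonoidHom.pi_ext fun i x => ?_
    change sign _ = sign _
    rw [Finset.prod_pi_mulSingle', if_pos (Finset.mem_univ i)]
    refine sign_coordinate (Nat.odd_iff.2 (FiniteField.odd_card_of_char_ne_two hK)) i _ _
      fun y => ?_
    ext j
    by_cases hj : j = i
    · subst hj; simp
    · simp [hj]
  have h1 : f D = g D := by rw [hfg]
  change ((f D : ℤˣ) : ℤ) = _
  rw [h1]
  change (sign (Units.mulLeft (∏ i, D i)) : ℤ) = _
  rw [sign_mulLeft hK, Units.coe_prod]

/-- The sign of a linear permutation is the quadratic character of the determinant. -/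
theorem sign_linPerm (hK : ringChar K ≠ 2) (M : GL (Fin n) K) :
    (sign (linPerm M) : ℤ) = quadraticChar K M.1.det := by
  have hdet : ∀ M : GL (Fin n) K, M.1.det ≠ 0 := fun M =>
    ((Matrix.isUnit_iff_isUnit_det _).1 M.isUnit).ne_zero
  suffices h : ∀ M : Matrix (Fin n) (Fin n) K, M.det ≠ 0 → ∀ u : GL (Fin n) K, u.1 = M →
      (sign (linPerm u) : ℤ) = quadraticChar K M.det from h M.1 (hdet M) M rfl
  intro M hM
  refine diagonal_transvection_induction_of_det_ne_zero (fun M => ∀ u : GL (Fin n) K, u.1 = M →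
    (sign (linPerm u) : ℤ) = quadraticChar K M.det) M hM ?_ ?_ ?_
  · intro D hD u hu
    rw [det_diagonal] at hD ⊢
    rw [Finset.prod_ne_zero_iff] at hD
    have h1 := sign_piMul hK fun i => Units.mk0 (D i) (hD i (Finset.mem_univ i))
    simp only [Units.val_mk0] at h1
    rw [← h1]
    congr 2
    ext x i
    rw [linPerm_apply, hu]
    simp [mulVec_diagonal]
  · intro t u hu
    have : NeZero (2 : K) := ⟨Ring.two_ne_zero hK⟩
    -- A transvection is the square of the one with half its coefficient, hence even.
    have hdet2 : (transvection t.i t.j (t.c / 2)).det ≠ 0 := by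
      rw [det_transvection_of_ne _ _ t.hij]; exact one_ne_zero
    have hu2 : u = GeneralLinearGroup.mkOfDetNeZero _ hdet2 *
        GeneralLinearGroup.mkOfDetNeZero _ hdet2 := by
      apply Units.ext
      rw [hu]
      change _ = transvection t.i t.j (t.c / 2) * transvection t.i t.j (t.c / 2)
      rw [transvection_mul_transvection_same _ _ t.hij, add_halves]
      rfl
    rw [TransvectionStruct.det, map_one, hu2, map_mul, sign_eq_one_of_mul_self]
    rfl
  · intro A B hA hB ihA ihB u hu
    have hu2 : u = GeneralLinearGroup.mkOfDetNeZero A hA *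
        GeneralLinearGroup.mkOfDetNeZero B hB := Units.ext hu
    rw [det_mul, map_mul, ← ihA (GeneralLinearGroup.mkOfDetNeZero A hA) rfl,
      ← ihB (GeneralLinearGroup.mkOfDetNeZero B hB) rfl, hu2, map_mul, map_mul]
    rfl

end Signs

end LocalAction

namespace LocalAction

/-! ### The affine groups over fields with q ≡ 1 (mod 4) -/

section Affine

open Equiv.Perm Matrix

variable {K : Type*} [Field K] [Fintype K] [DecidableEq K] {n : ℕ}

theorem odd_card_fun (hK : Fintype.card K % 4 = 1) : Odd (Fintype.card (Fin n → K)) := by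
  rw [Fintype.card_fun]
  exact (Nat.odd_iff.2 (by omega)).pow

theorem ringChar_ne_two (hK : Fintype.card K % 4 = 1) : ringChar K ≠ 2 := by
  rw [Ne, FiniteField.even_card_iff_char_two]
  omega

theorem sign_affine (hK : Fintype.card K % 4 = 1) {s : Equiv.Perm (Fin n → K)}
    {A : GL (Fin n) K} {b : Fin n → K} (hs : ∀ x, s x = A.1 *ᵥ x + b) :
    (sign s : ℤ) = quadraticChar K A.1.det := by
  have h1 : s = Equiv.addRight b * linPerm A := Equiv.ext hs
  rw [h1, map_mul, sign_addRight (odd_card_fun hK), one_mul, sign_linPerm (ringChar_ne_two hK)]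

theorem det_ne_zero_of_unit (A : GL (Fin n) K) : A.1.det ≠ 0 :=
  ((Matrix.isUnit_iff_isUnit_det _).1 A.isUnit).ne_zero

theorem sign_affine_eq_one_iff (hK : Fintype.card K % 4 = 1) {s : Equiv.Perm (Fin n → K)}
    {A : GL (Fin n) K} {b : Fin n → K} (hs : ∀ x, s x = A.1 *ᵥ x + b) :
    sign s = 1 ↔ IsSquare A.1.det := by
  rw [← quadraticChar_one_iff_isSquare (det_ne_zero_of_unit A), ← sign_affine hK hs,
    Units.val_eq_one]

theorem mem_squareAffine_iff (hK : Fintype.card K % 4 = 1) (s : Equiv.Perm (Fin n → K)) :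
    s ∈ squareAffine n K ↔ s ∈ affine n K ∧ sign s = 1 := by
  constructor
  · rintro ⟨A, b, hA, hs⟩
    exact ⟨⟨A, b, hs⟩, (sign_affine_eq_one_iff hK hs).2 hA⟩
  · rintro ⟨⟨A, b, hs⟩, h⟩
    exact ⟨A, b, (sign_affine_eq_one_iff hK hs).1 h, hs⟩

/-- The affine permutation with the linear part `A` that fixes `a`. -/
theorem exists_affine_fixing (A : GL (Fin n) K) (a : Fin n → K) :
    ∃ s : Equiv.Perm (Fin n → K), ∀ x, s x = A.1 *ᵥ (x - a) + a :=
  ⟨Equiv.addRight a * linPerm A * Equiv.addRight (-a), fun x => by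
    simp [linPerm_apply, sub_eq_add_neg]⟩

theorem affine_fixing_eq {A : GL (Fin n) K} {a x : Fin n → K} :
    A.1 *ᵥ (x - a) + a = A.1 *ᵥ x + (a - A.1 *ᵥ a) := by
  rw [mulVec_sub]
  abel

/-- The square of any m other than 0, 1, -1; such m exists as q ≥ 5. Homotheties of this ratio are
even and fix only their centre. -/
theorem exists_scalar (hK : Fintype.card K % 4 = 1) : ∃ l : K, IsSquare l ∧ l ≠ 0 ∧ l ≠ 1 := by
  have hcard : 1 < Fintype.card K := Fintype.one_lt_card
  obtain ⟨m, hm⟩ := exists_notMem_of_card_lt ({0, 1, -1} : Finset K)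
    (Finset.card_le_three.trans_lt (by omega))
  simp only [Finset.mem_insert, Finset.mem_singleton, not_or] at hm
  refine ⟨m * m, ⟨m, rfl⟩, mul_ne_zero hm.1 hm.1, fun h => ?_⟩
  rcases mul_self_eq_one_iff.1 h with h | h
  · exact hm.2.1 h
  · exact hm.2.2 h

/-- Homotheties with a square ratio. -/
theorem exists_homothety {l : K} (hl : IsSquare l) (hl0 : l ≠ 0) (a : Fin n → K) :
    ∃ s ∈ squareAffine n K, ∀ x, s x = l • (x - a) + a := by
  have hdet : (Matrix.diagonal fun _ : Fin n => l).det = l ^ n := by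
    rw [det_diagonal, Finset.prod_const, Finset.card_univ, Fintype.card_fin]
  have hdet0 : (Matrix.diagonal fun _ : Fin n => l).det ≠ 0 := by
    rw [hdet]; exact pow_ne_zero _ hl0
  have hmul : ∀ x : Fin n → K, (Matrix.diagonal fun _ : Fin n => l) *ᵥ x = l • x := fun x => by
    ext i
    simp [mulVec_diagonal]
  obtain ⟨s, hs⟩ := exists_affine_fixing (GeneralLinearGroup.mkOfDetNeZero _ hdet0) a
  refine ⟨s, ⟨GeneralLinearGroup.mkOfDetNeZero _ hdet0, _, ?_, fun x => (hs x).trans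
    affine_fixing_eq⟩, fun x => ?_⟩
  · change IsSquare (Matrix.diagonal fun _ : Fin n => l).det
    rw [hdet]
    exact hl.pow n
  · rw [hs]
    change (Matrix.diagonal fun _ : Fin n => l) *ᵥ (x - a) + a = _
    rw [hmul]

theorem isAmple_affine (hn : 1 ≤ n) (hK : Fintype.card K % 4 = 1) :
    IsAmple (squareAffine n K) (affine n K) where
  mem_iff := mem_squareAffine_iff hK
  exists_apply_eq a b := ⟨Equiv.addRight (b - a), ⟨1, b - a, by simp, fun x => by simp⟩,
    by simp⟩
  exists_odd a := by
    obtain ⟨c, hc⟩ := FiniteField.exists_nonsquare (ringChar_ne_two hK)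
    have hc0 : c ≠ 0 := fun h0 => hc (h0 ▸ IsSquare.zero)
    let i : Fin n := ⟨0, hn⟩
    have hdet : (Matrix.diagonal (Pi.mulSingle i c)).det = c := by
      rw [det_diagonal, Finset.prod_pi_mulSingle', if_pos (Finset.mem_univ i)]
    have hdet0 : (Matrix.diagonal (Pi.mulSingle i c)).det ≠ 0 := by rwa [hdet]
    obtain ⟨s, hs⟩ := exists_affine_fixing (GeneralLinearGroup.mkOfDetNeZero _ hdet0) a
    refine ⟨s, ⟨GeneralLinearGroup.mkOfDetNeZero _ hdet0, _, fun x => (hs x).trans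
      affine_fixing_eq⟩, ?_, ?_⟩
    · rw [hs, sub_self, mulVec_zero, zero_add]
    · refine (Int.units_eq_one_or _).resolve_left fun h1 => hc ?_
      have := (sign_affine_eq_one_iff hK fun x => (hs x).trans affine_fixing_eq).1 h1
      rw [← hdet]
      exact this
  three_le_card := by
    have hcard : 1 < Fintype.card K := Fintype.one_lt_card
    rw [Fintype.card_fun, Fintype.card_fin]
    calc 3 ≤ Fintype.card K := by omega
      _ = Fintype.card K ^ 1 := (pow_one _).symm
      _ ≤ Fintype.card K ^ n := Nat.pow_le_pow_right (by omega) hn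
  exists_move a b hab := by
    obtain ⟨l, hl, hl0, hl1⟩ := exists_scalar hK
    obtain ⟨s, hs, hsx⟩ := exists_homothety hl hl0 a
    refine ⟨s, hs, by simp [hsx], fun h => ?_⟩
    rw [hsx, ← eq_sub_iff_add_eq] at h
    have h1 : (l - 1) • (b - a) = 0 := by rw [sub_smul, one_smul, h, sub_self]
    rcases smul_eq_zero.1 h1 with h1 | h1
    · exact hl1 (sub_eq_zero.1 h1)
    · exact hab (sub_eq_zero.1 h1).symm
  le_of_stabilizer_le X hX := by
    rintro s ⟨A, b, hA, hs⟩
    obtain ⟨l, hl, hl0, hl1⟩ := exists_scalar hK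
    have hl1' : 1 - l ≠ 0 := sub_ne_zero.2 (Ne.symm hl1)
    -- The translation by b is a quotient of two homotheties of ratio l. With the second centred at
    -- 0, the first has to be centred at (1 - l)⁻¹ b. Thus translations lie in the group generated
    -- by the point stabilizers.
    obtain ⟨s₁, hs₁, hs₁x⟩ := exists_homothety hl hl0 ((1 - l)⁻¹ • b)
    obtain ⟨s₂, hs₂, hs₂x⟩ := exists_homothety (n := n) hl hl0 0
    have h1 : s₁ ∈ X := hX _ s₁ hs₁ (by rw [hs₁x, sub_self, smul_zero, zero_add])
    have h2 : s₂ ∈ X := hX _ s₂ hs₂ (by rw [hs₂x, sub_self, smul_zero, zero_add])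
    have h3 : linPerm A ∈ X := hX 0 _ ⟨A, 0, hA, fun x => by rw [linPerm_apply, add_zero]⟩
      (by rw [linPerm_apply, mulVec_zero])
    have h4 : s = s₁ * s₂⁻¹ * linPerm A := by
      have h5 : s₁ = Equiv.addRight b * s₂ := by
        ext1 x
        rw [mul_apply, hs₁x, hs₂x, Equiv.coe_addRight]
        dsimp only
        have : b = (1 - l) • (1 - l)⁻¹ • b := (smul_inv_smul₀ hl1' b).symm
        conv_rhs => rw [this]
        rw [sub_zero, add_zero, smul_sub, sub_smul, one_smul]
        abel
      rw [h5, mul_inv_cancel_right]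
      ext1 x
      rw [hs]
      rfl
    rw [h4]
    exact X.mul_mem (X.mul_mem h1 (X.inv_mem h2)) h3

/-- Affine involutions are even. -/
theorem sign_eq_one_of_affine_of_mul_self (hK : Fintype.card K % 4 = 1)
    {s : Equiv.Perm (Fin n → K)} (hs : s ∈ affine n K) (h : s * s = 1) : sign s = 1 := by
  obtain ⟨A, b, hs⟩ := hs
  rw [sign_affine_eq_one_iff hK hs]
  have h1 : ∀ x, A.1 *ᵥ (A.1 *ᵥ x + b) + b = x := fun x => by
    rw [← hs, ← hs, ← mul_apply, h, one_apply]
  have h2 : A.1 * A.1 = 1 := by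
    apply Matrix.ext_of_mulVec_single
    intro i
    have h3 := h1 (Pi.single i 1)
    have h4 := h1 0
    rw [mulVec_zero, zero_add] at h4
    rw [mulVec_add, add_assoc, h4, add_zero, mulVec_mulVec] at h3
    rw [h3, one_mulVec]
  have h3 : A.1.det * A.1.det = 1 := by rw [← det_mul, h2, det_one]
  -- The determinant is ±1, and -1 is a square because q ≡ 1 (mod 4).
  rcases mul_self_eq_one_iff.1 h3 with h4 | h4
  · rw [h4]; exact IsSquare.one
  · rw [h4, FiniteField.isSquare_neg_one_iff]
    omega

theorem five_le_card (hK : Fintype.card K % 4 = 1) : 5 ≤ Fintype.card K := by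
  have : 1 < Fintype.card K := Fintype.one_lt_card
  omega

theorem five_le_card_fun (hn : 1 ≤ n) (hK : Fintype.card K % 4 = 1) :
    5 ≤ Fintype.card (Fin n → K) := by
  rw [Fintype.card_fun, Fintype.card_fin]
  exact (five_le_card hK).trans (Nat.le_self_pow (by omega) _)

/-- For n = 1 there is equality at d = 5. For n ≥ 2 let t be the binary length of d. From 4^n ≤ d <
2^t follows 2n < t, so (d - 1)^n ≤ 2^(tn) with tn ≤ t(t - 1)/2 ≤ 2^(t-1) - 3 ≤ d - 3. -/
theorem pow_le_two_pow {n d : ℕ} (hn : 1 ≤ n) (hd : 5 ^ n ≤ d) :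
    (d - 1) ^ n ≤ 2 ^ (d - 3) := by
  have hbase : ∀ d, 5 ≤ d → d - 1 ≤ 2 ^ (d - 3) := by
    intro d hd
    induction d, hd using Nat.le_induction with
    | base => norm_num
    | succ d hd ih =>
      rw [show d + 1 - 3 = (d - 3) + 1 by omega, pow_succ]
      omega
  rcases Nat.lt_or_ge n 2 with h2 | h2
  · obtain rfl : n = 1 := by omega
    rw [pow_one]
    exact hbase d (by omega)
  · set t := Nat.size d with ht
    have hdt : d < 2 ^ t := Nat.lt_size_self d
    have h25 : 25 ≤ d := le_trans (by
      calc 25 = 5 ^ 2 := by norm_num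
        _ ≤ 5 ^ n := Nat.pow_le_pow_right (by norm_num) h2) hd
    have ht5 : 5 ≤ t := by
      by_contra hcon
      have : 2 ^ t ≤ 2 ^ 4 := Nat.pow_le_pow_right (by norm_num) (by omega)
      omega
    have hdt' : 2 ^ (t - 1) ≤ d := by
      rw [← Nat.lt_size]
      omega
    have hnt : 2 * n < t := by
      have h1 : 2 ^ (2 * n) < 2 ^ t := by
        calc 2 ^ (2 * n) = 4 ^ n := by rw [pow_mul]; norm_num
          _ ≤ 5 ^ n := Nat.pow_le_pow_left (by norm_num) n
          _ < 2 ^ t := by omega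
      exact (Nat.pow_lt_pow_iff_right (by norm_num)).1 h1
    have hquad : ∀ t, 5 ≤ t → t * (t - 1) ≤ 2 * (2 ^ (t - 1) - 3) := by
      intro t ht
      induction t, ht using Nat.le_induction with
      | base => norm_num
      | succ t ht ih =>
        obtain ⟨u, rfl⟩ : ∃ u, t = u + 5 := ⟨t - 5, by omega⟩
        have h3 : 3 ≤ 2 ^ (u + 4) := by
          calc 3 ≤ 2 ^ 4 := by norm_num
            _ ≤ 2 ^ (u + 4) := Nat.pow_le_pow_right (by norm_num) (by omega)
        have e1 : u + 5 - 1 = u + 4 := by omega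
        have e2 : u + 5 + 1 - 1 = (u + 4) + 1 := by omega
        rw [e1] at ih
        rw [e2, pow_succ]
        zify [h3, show 3 ≤ 2 ^ (u + 4) * 2 by omega] at ih ⊢
        nlinarith
    have hexp : t * n ≤ d - 3 := by
      have h1 := hquad t ht5
      have h3 : t * (2 * n) ≤ t * (t - 1) := Nat.mul_le_mul_left _ (by omega)
      have h4 : t * (2 * n) = 2 * (t * n) := by ring
      omega
    calc (d - 1) ^ n ≤ (2 ^ t) ^ n := Nat.pow_le_pow_left (by omega) n
      _ = 2 ^ (t * n) := (pow_mul _ _ _).symm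
      _ ≤ 2 ^ (d - 3) := Nat.pow_le_pow_right (by norm_num) hexp

/-- An affine map fixing a is determined by the images of the n points a + e_i, which differ from a.
This gives at most (d - 1)^n maps, where d is the number of points. -/
theorem card_stabilizer_squareAffine_le (hn : 1 ≤ n) (hK : Fintype.card K % 4 = 1)
    (a : Fin n → K) :
    Nat.card {s // s ∈ squareAffine n K ∧ s a = a} ≤ 2 ^ (Fintype.card (Fin n → K) - 3) := by
  let f : {s // s ∈ squareAffine n K ∧ s a = a} → (Fin n → {x : Fin n → K // x ≠ a}) :=
    fun s i => ⟨s.1 (a + Pi.single i 1), fun h => by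
      have h1 := s.1.injective (h.trans s.2.2.symm)
      have h2 := congrFun (add_eq_left.1 h1) i
      simp at h2⟩
  have hf : Function.Injective f := by
    rintro ⟨s, ⟨A, b, hA, hs⟩, hsa⟩ ⟨t, ⟨B, c, hB, ht⟩, hta⟩ h
    have h1 : ∀ i, A.1 *ᵥ Pi.single i 1 = B.1 *ᵥ Pi.single i 1 := by
      intro i
      have h2 : s (a + Pi.single i 1) = t (a + Pi.single i 1) :=
        congrArg Subtype.val (congrFun h i)
      rw [hs, ht, mulVec_add, mulVec_add, add_right_comm, ← hs, hsa, add_right_comm, ← ht, hta]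
        at h2
      exact add_left_cancel h2
    have hAB : A.1 = B.1 := Matrix.ext_of_mulVec_single h1
    have hbc : b = c := by
      have h2 := hsa.trans hta.symm
      rw [hs, ht, hAB] at h2
      exact add_left_cancel h2
    apply Subtype.ext
    ext1 x
    change s x = t x
    rw [hs, ht, hAB, hbc]
  have h1 := Nat.card_le_card_of_injective f hf
  rw [Nat.card_fun, Nat.card_fin, Nat.card_eq_fintype_card (α := {x : Fin n → K // x ≠ a}),
    Fintype.card_subtype_compl, Fintype.card_subtype_eq] at h1
  refine h1.trans (pow_le_two_pow hn ?_)
  rw [Fintype.card_fun, Fintype.card_fin]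
  exact Nat.pow_le_pow_left (five_le_card hK) n

end Affine

/-! ### Translations and an odd involution -/

section Reflection

open Equiv.Perm

/-- The translations and the reflections composed from translations and the involution `τ`. -/
def dihedral {V : Type*} [AddCommGroup V] (τ : V ≃+ V) (hτ : ∀ x, τ (τ x) = x) :
    Subgroup (Equiv.Perm V) where
  carrier := {s | ∃ b, (∀ x, s x = x + b) ∨ ∀ x, s x = τ x + b}
  one_mem' := ⟨0, Or.inl fun x => by simp⟩
  mul_mem' := by
    rintro s t ⟨b, hs | hs⟩ ⟨c, ht | ht⟩
    · exact ⟨c + b, Or.inl fun x => by rw [mul_apply, ht, hs, add_assoc]⟩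
    · exact ⟨c + b, Or.inr fun x => by rw [mul_apply, ht, hs, add_assoc]⟩
    · exact ⟨τ c + b, Or.inr fun x => by rw [mul_apply, ht, hs, map_add, add_assoc]⟩
    · exact ⟨τ c + b, Or.inl fun x => by rw [mul_apply, ht, hs, map_add, hτ, add_assoc]⟩
  inv_mem' := by
    rintro s ⟨b, hs | hs⟩
    · refine ⟨-b, Or.inl fun x => s.injective ?_⟩
      rw [show s (s⁻¹ x) = x from s.apply_symm_apply x, hs, neg_add_cancel_right]
    · refine ⟨-τ b, Or.inr fun x => s.injective ?_⟩
      rw [show s (s⁻¹ x) = x from s.apply_symm_apply x, hs, map_add, map_neg, hτ, hτ,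
        neg_add_cancel_right]

/-- The group of the translations. -/
def translations (V : Type*) [AddCommGroup V] : Subgroup (Equiv.Perm V) where
  carrier := {s | ∃ b, ∀ x, s x = x + b}
  one_mem' := ⟨0, fun x => by simp⟩
  mul_mem' := by
    rintro s t ⟨b, hs⟩ ⟨c, ht⟩
    exact ⟨c + b, fun x => by rw [mul_apply, ht, hs, add_assoc]⟩
  inv_mem' := by
    rintro s ⟨b, hs⟩
    refine ⟨-b, fun x => s.injective ?_⟩
    rw [show s (s⁻¹ x) = x from s.apply_symm_apply x, hs, neg_add_cancel_right]

theorem eq_one_of_mem_translations {V : Type*} [AddCommGroup V] {s : Equiv.Perm V}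
    (hs : s ∈ translations V) {a : V} (ha : s a = a) : s = 1 := by
  obtain ⟨b, hs⟩ := hs
  rw [hs, add_eq_left] at ha
  ext x
  rw [hs, ha, add_zero, one_apply]

/-- Translations are even and τ is odd, so the sign separates the two kinds of elements. The map x ↦
τ x + (a - τ a) is an odd one fixing a. -/
theorem isEvenPart_translations {V : Type*} [AddCommGroup V] [Fintype V] [DecidableEq V]
    (hV : Odd (Fintype.card V)) (τ : V ≃+ V) (hτ : ∀ x, τ (τ x) = x)
    (hs : sign τ.toEquiv = -1) : IsEvenPart (translations V) (dihedral τ hτ) where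
  mem_iff s := by
    have h1 : ∀ b, sign (Equiv.addRight b * τ.toEquiv) = -1 := fun b => by
      rw [map_mul, hs, sign_addRight hV, one_mul]
    constructor
    · rintro ⟨b, hb⟩
      refine ⟨⟨b, Or.inl hb⟩, ?_⟩
      rw [show s = Equiv.addRight b from Equiv.ext hb, sign_addRight hV]
    · rintro ⟨⟨b, hb | hb⟩, h2⟩
      · exact ⟨b, hb⟩
      · rw [show s = Equiv.addRight b * τ.toEquiv from Equiv.ext hb, h1] at h2
        exact absurd h2 (by decide)
  exists_apply_eq a b := ⟨Equiv.addRight (b - a), ⟨b - a, fun x => rfl⟩, by simp⟩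
  exists_odd a := by
    refine ⟨Equiv.addRight (a - τ a) * τ.toEquiv, ⟨a - τ a, Or.inr fun x => rfl⟩, ?_, ?_⟩
    · change τ a + (a - τ a) = a
      abel
    · rw [map_mul, hs, sign_addRight hV, one_mul]

/-- An odd additive involution of a vector space over a field with `p` elements,
`p ≡ 3 (mod 4)`. -/
theorem exists_odd_involution {p : ℕ} [Fact p.Prime] (hp : p % 4 = 3) (V : Type*)
    [AddCommGroup V] [Module (ZMod p) V] [Fintype V] [DecidableEq V] [Nontrivial V] :
    ∃ τ : V ≃+ V, (∀ x, τ (τ x) = x) ∧ sign τ.toEquiv = -1 := by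
  have hpos : 0 < Module.finrank (ZMod p) V := Module.finrank_pos
  let i : Fin (Module.finrank (ZMod p) V) := ⟨0, hpos⟩
  let e : V ≃ₗ[ZMod p] (Fin (Module.finrank (ZMod p) V) → ZMod p) :=
    (Module.finBasis (ZMod p) V).equivFun
  let ν : (Fin (Module.finrank (ZMod p) V) → ZMod p) ≃+
      (Fin (Module.finrank (ZMod p) V) → ZMod p) :=
    { toFun := fun x => Function.update x i (-x i)
      invFun := fun x => Function.update x i (-x i)
      left_inv := fun x => by simp
      right_inv := fun x => by simp
      map_add' := fun x y => by
        ext j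
        by_cases hj : j = i
        · subst hj; simp [add_comm]
        · simp [hj] }
  have hν : ∀ x, ν (ν x) = x := ν.left_inv
  have hchar : ringChar (ZMod p) ≠ 2 := by
    rw [ZMod.ringChar_zmod_n]
    omega
  refine ⟨(e.toAddEquiv.trans ν).trans e.symm.toAddEquiv, fun x => ?_, ?_⟩
  · simp [hν]
  · have h1 : sign (((e.toAddEquiv.trans ν).trans e.symm.toAddEquiv).toEquiv) =
        sign ν.toEquiv := by
      refine sign_eq_sign_of_equiv _ _ e.toEquiv fun x => ?_
      simp
    have hodd : Odd (Fintype.card (ZMod p)) := by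
      rw [ZMod.card, Nat.odd_iff]
      omega
    -- Negating a single coordinate has the sign of negation on the prime field, which is -1 because
    -- -1 is not a square modulo p.
    rw [h1, sign_coordinate hodd i (Units.mulLeft (-1)) ν.toEquiv fun x => by simp [ν]]
    have h2 := sign_mulLeft hchar (-1 : (ZMod p)ˣ)
    rw [Units.val_neg, Units.val_one, quadraticChar_neg_one_iff_not_isSquare.2] at h2
    · exact Units.ext h2
    · rw [FiniteField.isSquare_neg_one_iff, ZMod.card]
      omega

end Reflection

end LocalAction

open MeasureTheory Measure

/-! ### Unimodularity of simple groups -/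

section Unimodular

variable {G : Type*} [Group G] [TopologicalSpace G] [IsTopologicalGroup G] [LocallyCompactSpace G]

/-- A simple nonabelian locally compact group is unimodular. -/
theorem modularCharacterFun_eq_one [IsSimpleGroup G] {x y : G} (hxy : x * y ≠ y * x) (g : G) :
    modularCharacterFun g = 1 := by
  rcases (inferInstance : (modularCharacter (G := G)).ker.Normal).eq_bot_or_eq_top with h | h
  · have h1 : x * y * (y * x)⁻¹ ∈ (modularCharacter (G := G)).ker := by
      have h2 : modularCharacter (x * y) = modularCharacter (y * x) := by
        rw [map_mul, map_mul, mul_comm]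
      rw [MonoidHom.mem_ker, map_mul, h2, ← map_mul, mul_inv_cancel, map_one]
    rw [h, Subgroup.mem_bot, mul_inv_eq_one] at h1
    exact absurd h1 hxy
  · have h1 : g ∈ (modularCharacter (G := G)).ker := h ▸ Subgroup.mem_top g
    exact h1

theorem isMulRightInvariant_of_modularCharacterFun [MeasurableSpace G] [BorelSpace G]
    (h : ∀ g : G, modularCharacterFun g = 1) (μ : Measure G) [IsHaarMeasure μ] [Regular μ] :
    IsMulRightInvariant μ where
  map_mul_right_eq_self g := by
    have := Regular.map (μ := μ) (Homeomorph.mulRight g)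
    have h1 : Regular (map (· * g) μ) := this
    rw [isMulLeftInvariant_eq_smul_of_regular (map (· * g) μ) μ,
      ← modularCharacterFun_eq_haarScalarFactor, h, one_smul]

end Unimodular

/-! ### Complements of compact open subgroups are lattices -/

section Complement

variable {G : Type*} [Group G] [TopologicalSpace G] [IsTopologicalGroup G]

theorem isFundamentalDomain_of_complement [MeasurableSpace G] [BorelSpace G] {V Γ : Subgroup G}
    (hV : IsOpen (V : Set G)) (hdisj : ∀ g ∈ V, g ∈ Γ → g = 1)
    (hmul : ∀ g : G, ∃ γ ∈ Γ, g * γ ∈ V) (μ : Measure G) :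
    IsFundamentalDomain Γ.op (V : Set G) μ := by
  refine IsFundamentalDomain.mk' hV.measurableSet.nullMeasurableSet fun x => ?_
  obtain ⟨γ, hγ, hx⟩ := hmul x
  refine ⟨⟨MulOpposite.op γ, hγ⟩, hx, ?_⟩
  rintro ⟨δ, hδ⟩ hδx
  have hδx : x * δ.unop ∈ V := hδx
  have h1 : (x * γ)⁻¹ * (x * δ.unop) ∈ V := V.mul_mem (V.inv_mem hx) hδx
  have h2 : (x * γ)⁻¹ * (x * δ.unop) = γ⁻¹ * δ.unop := by group
  rw [h2] at h1
  have h3 := hdisj _ h1 (Γ.mul_mem (Γ.inv_mem hγ) hδ)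
  apply Subtype.ext
  apply MulOpposite.unop_injective
  exact (inv_mul_eq_one.1 h3).symm

/-- In a unimodular group, a countable complement of a compact open subgroup is a lattice. -/
theorem isLattice_of_complement [T2Space G] [LocallyCompactSpace G]
    (huni : ∀ g : G, modularCharacterFun g = 1) {V Γ : Subgroup G} [Countable Γ]
    (hV : IsOpen (V : Set G)) (hVc : IsCompact (V : Set G)) (hdisj : ∀ g ∈ V, g ∈ Γ → g = 1)
    (hmul : ∀ g : G, ∃ γ ∈ Γ, g * γ ∈ V) : IsLattice Γ := by
  have hdisc : DiscreteTopology Γ := by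
    refine discreteTopology_of_isOpen_singleton_one ?_
    have : ({1} : Set Γ) = Subtype.val ⁻¹' (V : Set G) := by
      ext γ
      refine ⟨fun h => ?_, fun h => Subtype.ext (hdisj _ h γ.2)⟩
      rw [Set.mem_singleton_iff.1 h]
      exact V.one_mem
    rw [this]
    exact hV.preimage continuous_subtype_val
  refine ⟨hdisc, ?_⟩
  have hclosed : IsClosed (Γ : Set G) := Γ.isClosed_of_discrete
  borelize G
  let _ : MeasurableSpace (G ⧸ Γ) := borel (G ⧸ Γ)
  have : BorelSpace (G ⧸ Γ) := ⟨rfl⟩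
  have hinv : IsMulRightInvariant (haar : Measure G) :=
    isMulRightInvariant_of_modularCharacterFun huni haar
  have hcont : Continuous (QuotientGroup.mk : G → G ⧸ Γ) := continuous_quotient_mk'
  have hfin : IsFiniteMeasure ((haar : Measure G).restrict V) :=
    ⟨by rw [restrict_apply_univ]; exact hVc.measure_lt_top⟩
  let ν : Measure (G ⧸ Γ) := map QuotientGroup.mk ((haar : Measure G).restrict V)
  have hν : IsFiniteMeasure ν := inferInstance
  have hνA : ∀ A : Set (G ⧸ Γ), MeasurableSet A →
      ν A = haar ((QuotientGroup.mk ⁻¹' A : Set G) ∩ V) := fun A hA => by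
    rw [map_apply hcont.measurable hA, restrict_apply (hcont.measurable hA)]
  refine ⟨ν, ?_, hν, ?_, ?_⟩
  · intro h
    have h1 := hνA Set.univ MeasurableSet.univ
    rw [h, Set.preimage_univ, Set.univ_inter] at h1
    exact (hV.measure_pos haar ⟨1, V.one_mem⟩).ne h1
  · have h1 : InnerRegular ν := InnerRegular.map_of_continuous hcont
    infer_instance
  · refine ⟨fun g A hA => ?_⟩
    -- V and g V are both fundamental domains for right multiplication by Γ, since left and right
    -- multiplications commute. They meet a right Γ-invariant set in equal Haar measure, as Haar
    -- measure is right invariant; this is the invariance of ν.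
    have hfd := isFundamentalDomain_of_complement hV hdisj hmul (haar : Measure G)
    have hfd' : IsFundamentalDomain Γ.op (g • (V : Set G)) (haar : Measure G) :=
      hfd.smul_of_comm g
    have hgA : MeasurableSet ((fun x : G ⧸ Γ => g • x) ⁻¹' A) :=
      (continuous_const_smul g).measurable hA
    rw [hνA _ hgA, hνA _ hA]
    have h1 : (QuotientGroup.mk ⁻¹' ((fun x : G ⧸ Γ => g • x) ⁻¹' A) : Set G) ∩ V =
        (fun x => g * x) ⁻¹' ((QuotientGroup.mk ⁻¹' A) ∩ g • (V : Set G)) := by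
      ext x
      simp only [Set.mem_inter_iff, Set.mem_preimage]
      refine and_congr Iff.rfl ?_
      exact (Set.smul_mem_smul_set_iff (a := g) (s := (V : Set G)) (x := x)).symm
    rw [h1, measure_preimage_mul]
    refine hfd'.measure_set_eq hfd (hcont.measurable hA) fun γ => ?_
    ext x
    have h2 : (QuotientGroup.mk (γ • x) : G ⧸ Γ) = QuotientGroup.mk x :=
      QuotientGroup.eq.2 (by
        have h3 : γ.1.unop ∈ Γ := γ.2
        have h4 : (γ • x)⁻¹ * x = γ.1.unop⁻¹ := by
          change (x * γ.1.unop)⁻¹ * x = _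
          group
        rw [h4]
        exact Γ.inv_mem h3)
    simp only [Set.mem_preimage, h2]

end Complement

namespace LocalAction

/-! ### A lattice from a regular even part -/

section Lattice

variable {Ω : Type*} [Fintype Ω] [DecidableEq Ω] {F A P A' : Subgroup (Equiv.Perm Ω)}

/-- Where g and k agree on an edge, their local permutations at its end differ by an even element of
A' fixing a colour, which is trivial because P acts freely. So agreement spreads from one edge over
the whole tree. -/
theorem IsEvenPart.treeAut_eq (hP : IsEvenPart P A') (hfree : ∀ s ∈ P, ∀ a, s a = a → s = 1)
    {g k : TreeAut Ω} (hg : g ∈ U A') (hk : k ∈ U A') (hs : ∀ v, sgn g v = sgn k v) {a : Ω}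
    (hr : g root = k root) (ha : g (step a root) = k (step a root)) : g = k := by
  have key : ∀ v b, g v = k v → g (step b v) = k (step b v) → localPerm g v = localPerm k v := by
    intro v b h1 h2
    rw [apply_step, apply_step, h1] at h2
    have h3 := step_left_injective _ h2
    have h4 : (localPerm k v)⁻¹ * localPerm g v ∈ P := by
      rw [hP.mem_iff, map_mul, map_inv]
      refine ⟨A'.mul_mem (A'.inv_mem (hk v)) (hg v), ?_⟩
      exact inv_mul_eq_one.2 (hs v).symm
    refine (inv_mul_eq_one.1 (hfree _ h4 b ?_)).symm
    rw [Equiv.Perm.mul_apply, h3]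
    exact (localPerm k v).symm_apply_apply b
  have h : ∀ v, g v = k v ∧ localPerm g v = localPerm k v := by
    intro v
    induction v using Vert.step_induction with
    | h0 => exact ⟨hr, key _ a hr ha⟩
    | hs b v ih =>
      have h1 : g (step b v) = k (step b v) := by rw [apply_step, apply_step, ih.1, ih.2]
      exact ⟨h1, key _ b h1 (by rw [step_step]; exact ih.1)⟩
  exact RelIso.ext fun v => (h v).1

/-- If `A` contains a group `A'` whose even part acts regularly, then `N(F, A)` has a lattice. -/
theorem IsAmple.hasLattice (h : IsAmple F A) (hP : IsEvenPart P A') (hA : A' ≤ A)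
    (hfree : ∀ s ∈ P, ∀ a, s a = a → s = 1) : HasLattice (N F A) := by
  obtain ⟨a⟩ : Nonempty Ω := Fintype.card_pos_iff.1 (by have := h.three_le_card; omega)
  have := t2Space_N (F := F) (A := A)
  have := h.locallyCompactSpace_N
  have := h.isSimpleGroup_N
  obtain ⟨x, hx, y, hy, hxy⟩ := h.exists_not_commute
  let V : Subgroup (N F A) := (U F ⊓ fixing {root, step a root}).subgroupOf (N F A)
  have hV : IsOpen (V : Set (N F A)) := Subgroup.isOpen_of_mem_nhds _ (g := 1)
    (nhds_one_hasBasis_N.mem_of_mem (Set.toFinite {root, step a root}))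
  have hVc : IsCompact (V : Set (N F A)) :=
    h.isCompact_rootStab.of_isClosed_subset (V.isClosed_of_isOpen hV) fun g hg =>
      mem_rootStab.2 ⟨hg.1, hg.2 root (Set.mem_insert _ _)⟩
  let Γ : Subgroup (N F A) := (evenAut A').subgroupOf (N F A)
  -- By rigidity an element of Γ is determined by the image of one edge and its finite set of odd
  -- vertices.
  have hcount : Countable Γ := by
    have hvert : Countable (Vert Ω) := Subtype.countable
    refine Function.Injective.countable (β := Vert Ω × Vert Ω × Finset (Vert Ω))
      (f := fun γ => ((γ.1 : TreeAut Ω) root, (γ.1 : TreeAut Ω) (step a root),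
        Set.Finite.toFinset (mem_evenAut.1 γ.2).2.1)) ?_
    intro γ δ heq
    simp only [Prod.mk.injEq, Set.Finite.toFinset_inj] at heq
    apply Subtype.ext
    apply Subtype.ext
    refine hP.treeAut_eq hfree (mem_evenAut.1 γ.2).1 (mem_evenAut.1 δ.2).1 (fun v => ?_)
      heq.1 heq.2.1
    have h1 : v ∈ oddSet (γ.1 : TreeAut Ω) ↔ v ∈ oddSet (δ.1 : TreeAut Ω) :=
      iff_of_eq (congrArg (v ∈ ·) heq.2.2)
    rw [mem_oddSet, mem_oddSet, not_iff_not] at h1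
    rcases Int.units_eq_one_or (sgn (γ.1 : TreeAut Ω) v) with h2 | h2
    · rw [h2, h1.1 h2]
    · rcases Int.units_eq_one_or (sgn (δ.1 : TreeAut Ω) v) with h3 | h3
      · rw [h3, h1.2 h3]
      · rw [h2, h3]
  refine ⟨Γ, isLattice_of_complement
    (modularCharacterFun_eq_one (x := (⟨x, hx⟩ : N F A)) (y := ⟨y, hy⟩) fun hc =>
      hxy (congrArg Subtype.val hc)) hV hVc ?_ ?_⟩
  · intro g hg hgΓ
    apply Subtype.ext
    refine hP.treeAut_eq (a := a) hfree (mem_evenAut.1 hgΓ).1 (U A').one_mem (fun v => ?_)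
      (hg.2 root (Set.mem_insert _ _)) (hg.2 _ (Set.mem_insert_of_mem _ rfl))
    exact (h.sgn_eq_one hg.1 v).trans (sgn_one v).symm
  · intro g
    -- The correction argument for cocompactness, now with `evenAut A'` as the smaller group and
    -- fixing an edge, factors the whole group as V Γ.
    obtain ⟨k, hk, hkU, hkr, hka⟩ := hP.exists_mul_mem h.toIsEvenPart hA
      ((evenAut A).inv_mem (h.N_eq.le g.2)) a
    have hkN : k ∈ N F A := h.N_eq.ge (evenAut_mono hA hk)
    let z : N F A := ⟨k, hkN⟩
    refine ⟨z⁻¹, Γ.inv_mem hk, ?_⟩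
    have h1 : z * g⁻¹ ∈ V := ⟨hkU, by
      rintro v (rfl | rfl)
      · exact hkr
      · exact hka⟩
    have h2 := V.inv_mem h1
    rwa [mul_inv_rev, inv_inv] at h2

end Lattice

end LocalAction

open MeasureTheory Measure

/-! ### Measures of images of open subgroups in the quotient -/

section Translates

variable {G : Type*} [Group G] [TopologicalSpace G] [IsTopologicalGroup G] {Γ : Subgroup G}
  [MeasurableSpace (G ⧸ Γ)] [BorelSpace (G ⧸ Γ)] {μ : Measure (G ⧸ Γ)}
  [SMulInvariantMeasure G (G ⧸ Γ) μ]

theorem measure_image_mk_le {ι : Type*} [Fintype ι] {S T : Set G} (t : ι → G)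
    (h : ∀ g ∈ S, ∃ i, (t i)⁻¹ * g ∈ T) :
    μ (QuotientGroup.mk '' S) ≤ Fintype.card ι * μ (QuotientGroup.mk '' T) := by
  calc μ (QuotientGroup.mk '' S)
      ≤ μ (⋃ i, t i • ((QuotientGroup.mk : G → G ⧸ Γ) '' T)) := by
        refine measure_mono ?_
        rintro _ ⟨g, hg, rfl⟩
        obtain ⟨i, hi⟩ := h g hg
        refine Set.mem_iUnion.2 ⟨i, Set.mem_smul_set_iff_inv_smul_mem.2 ⟨_, hi, rfl⟩⟩
    _ ≤ ∑ i, μ (t i • ((QuotientGroup.mk : G → G ⧸ Γ) '' T)) := measure_iUnion_fintype_le _ _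
    _ = Fintype.card ι * μ (QuotientGroup.mk '' T) := by
        simp [measure_smul]

theorem le_measure_univ {ι : Type*} [Fintype ι] {T : Subgroup G} (hT : IsOpen (T : Set G))
    (t : ι → G) (h : ∀ i j, ∀ g ∈ T, ∀ g' ∈ T, (t i * g)⁻¹ * (t j * g') ∈ Γ → i = j) :
    Fintype.card ι * μ (QuotientGroup.mk '' (T : Set G)) ≤ μ Set.univ := by
  have hopen : IsOpen ((QuotientGroup.mk : G → G ⧸ Γ) '' T) := QuotientGroup.isOpenMap_coe _ hT
  calc Fintype.card ι * μ (QuotientGroup.mk '' (T : Set G))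
      = ∑ i, μ (t i • ((QuotientGroup.mk : G → G ⧸ Γ) '' T)) := by simp [measure_smul]
    _ = μ (⋃ i, t i • ((QuotientGroup.mk : G → G ⧸ Γ) '' T)) := by
        rw [measure_iUnion, tsum_fintype]
        · intro i j hij
          refine Set.disjoint_left.2 ?_
          rintro _ ⟨_, ⟨g, hg, rfl⟩, rfl⟩ ⟨_, ⟨g', hg', rfl⟩, heq⟩
          exact hij (h i j g hg g' hg' (QuotientGroup.eq.1 heq.symm))
        · exact fun i => (hopen.smul (t i)).measurableSet
    _ ≤ μ Set.univ := measure_mono (Set.subset_univ _)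

/-- If the image were null, every point would have a null neighbourhood, a translate of it. Compact
sets would then be null, and so would the whole space by inner regularity. -/
theorem measure_image_mk_ne_zero [μ.Regular] (hμ : μ ≠ 0) {T : Set G} (hT : IsOpen T)
    (h1 : (1 : G) ∈ T) : μ (QuotientGroup.mk '' T) ≠ 0 := by
  intro h0
  refine hμ (measure_univ_eq_zero.1 ?_)
  rw [isOpen_univ.measure_eq_iSup_isCompact]
  simp only [ENNReal.iSup_eq_zero]
  intro C _ hC
  refine hC.measure_zero_of_nhdsWithin fun x _ => ?_
  obtain ⟨g, rfl⟩ := QuotientGroup.mk_surjective x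
  refine ⟨g • ((QuotientGroup.mk : G → G ⧸ Γ) '' T), mem_nhdsWithin_of_mem_nhds ?_, ?_⟩
  · refine ((QuotientGroup.isOpenMap_coe _ hT).smul g).mem_nhds ?_
    exact ⟨_, ⟨1, h1, rfl⟩, congrArg QuotientGroup.mk (mul_one g)⟩
  · rw [measure_smul, h0]

end Translates

open MeasureTheory Measure

namespace LocalAction

/-! ### Stabilizers of balls with prescribed signs on a sphere -/

section Levels

variable {Ω : Type*} [Fintype Ω] [DecidableEq Ω] {F A : Subgroup (Equiv.Perm Ω)}

/-- The stabilizer in `N(F, A) ∩ U(F)` of the ball of radius `n` around the root. -/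
def ballStab (F A : Subgroup (Equiv.Perm Ω)) (n : ℕ) : Subgroup (N F A) :=
  (U F ⊓ fixing {v | v.1.length ≤ n}).subgroupOf (N F A)

/-- The elements of `N(F, A)` that fix the ball of radius `n` around the root, with all local
permutations in `F` outside of the sphere of radius `n`. -/
def levelStab (F A : Subgroup (Equiv.Perm Ω)) (n : ℕ) : Subgroup (N F A) where
  carrier := {g | (∀ v, v.1.length ≤ n → (g : TreeAut Ω) v = v) ∧
    ∀ v, v.1.length ≠ n → localPerm (g : TreeAut Ω) v ∈ F}
  one_mem' := ⟨fun _ _ => rfl, fun v _ => by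
    rw [Subgroup.coe_one, localPerm_one]
    exact F.one_mem⟩
  mul_mem' := by
    rintro g k ⟨hg, hg'⟩ ⟨hk, hk'⟩
    refine ⟨fun v hv => ?_, fun v hv => ?_⟩
    · rw [Subgroup.coe_mul, RelIso.mul_apply, hk v hv, hg v hv]
    · rw [Subgroup.coe_mul, localPerm_mul]
      refine F.mul_mem (hg' _ ?_) (hk' v hv)
      rwa [length_apply_of_root (hk root (Nat.zero_le _))]
  inv_mem' := by
    rintro g ⟨hg, hg'⟩
    have h1 : ∀ v : Vert Ω, v.1.length ≤ n → (g : TreeAut Ω)⁻¹ v = v := fun v hv => by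
      conv_lhs => rw [← hg v hv]
      exact RelIso.inv_apply_self _ _
    refine ⟨h1, fun v hv => ?_⟩
    rw [Subgroup.coe_inv, localPerm_inv]
    refine F.inv_mem (hg' _ ?_)
    rwa [length_apply_of_root (h1 root (Nat.zero_le _))]

theorem ballStab_le_levelStab (n : ℕ) : ballStab F A n ≤ levelStab F A n :=
  fun _ hg => ⟨hg.2, fun v _ => hg.1 v⟩

theorem isOpen_ballStab (n : ℕ) : IsOpen (ballStab F A n : Set (N F A)) :=
  Subgroup.isOpen_of_mem_nhds _ (g := 1)
    (nhds_one_hasBasis_N.mem_of_mem (finite_ball n))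

theorem IsEvenPart.exists_level (h : IsEvenPart F A) {n : ℕ} (hn : 1 ≤ n) (T : Set (Vert Ω)) :
    ∃ g ∈ U A, (∀ v, v.1.length ≤ n → g v = v) ∧ (∀ v, v.1.length ≠ n → localPerm g v ∈ F) ∧
      ∀ v, v.1.length = n → (sgn g v = 1 ↔ v ∉ T) := by
  classical
  choose o hoA ho hos using h.exists_odd
  -- The colour towards the root, the first letter of the word, has to stay fixed, so odd elements
  -- of its stabilizer are used. The value at the root is irrelevant since n ≥ 1.
  let τ : Vert Ω → Equiv.Perm Ω := fun v =>
    if v ∈ T then (v.1.head?).elim 1 o else 1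
  have hτ : ∀ v, τ v ∈ A := fun v => by
    simp only [τ]
    split_ifs
    · cases v.1.head? with
      | none => exact A.one_mem
      | some a => exact hoA a
    · exact A.one_mem
  obtain ⟨g, h1, h2, h3, h4, -⟩ := exists_aut_of_level h.exists_apply_eq hn τ (by
    intro a v hv _
    simp only [τ, head?_step_of_ne hv]
    split_ifs
    · exact ho a
    · rfl)
  have h5 : ∀ v, v.1.length ≠ n → localPerm g v ∈ F := by
    intro v hv
    rcases lt_or_gt_of_ne hv with hv | hv
    · rw [h2 v hv]
      exact F.one_mem
    · exact h4 v hv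
  refine ⟨g, fun v => ?_, h1, h5, fun v hv => ?_⟩
  · by_cases hv : v.1.length = n
    · rw [h3 v hv]
      exact hτ v
    · exact h.le (h5 v hv)
  · have hr : v ≠ root := by
      rintro rfl
      rw [root_val, List.length_nil] at hv
      omega
    obtain ⟨a, u, hu, rfl⟩ := exists_step_eq hr
    rw [sgn, h3 _ hv]
    simp only [τ, head?_step_of_ne hu]
    split_ifs with hT
    · simp [hT, hos]
    · simp [hT]

/-- The sign at w is left free in order to satisfy the parity condition; signs at all other vertices
of the sphere can be prescribed. -/
theorem IsAmple.exists_mem_levelStab (h : IsAmple F A) {n : ℕ} (hn : 1 ≤ n) {w : Vert Ω}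
    (hw : w.1.length = n) (T : Set (Vert Ω)) :
    ∃ g ∈ levelStab F A n, ∀ v, v.1.length = n → v ≠ w →
      (sgn (g : TreeAut Ω) v = 1 ↔ v ∉ T) := by
  have hodd : ∀ k : TreeAut Ω, (∀ v, v.1.length ≠ n → localPerm k v ∈ F) →
      (∀ v, v.1.length ≠ n → sgn k v = 1) ∧ (oddSet k).Finite := by
    intro k hk
    have h1 : ∀ v, v.1.length ≠ n → sgn k v = 1 := fun v hv => ((h.mem_iff _).1 (hk v hv)).2
    refine ⟨h1, (finite_sphere n).subset fun v hv => ?_⟩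
    by_contra hc
    exact hv (h1 v hc)
  have hpar : ∀ k : TreeAut Ω, (∀ v, v.1.length ≠ n → localPerm k v ∈ F) →
      ∀ i, i ≠ n % 2 → parity i k = 1 := by
    intro k hk i hi
    rw [parity]
    refine finprod_eq_one_of_forall_eq_one fun v => ?_
    split_ifs with hv
    · exact (hodd k hk).1 v fun hvn => hi (by rw [← hv, hvn])
    · rfl
  obtain ⟨g, hgA, hg1, hg2, hg3⟩ := h.toIsEvenPart.exists_level hn T
  have hgt : g ∈ typePreserving Ω := mem_typePreserving_of_fixed (hg1 root (Nat.zero_le _))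
  by_cases hp : parity (n % 2) g = 1
  · have hgE : g ∈ evenAut A := ⟨hgA, (hodd g hg2).2, hgt, fun i => by
      by_cases hi : i = n % 2
      · rw [hi, hp]
      · exact hpar g hg2 i hi⟩
    exact ⟨⟨g, h.N_eq.ge hgE⟩, ⟨hg1, hg2⟩, fun v hv _ => hg3 v hv⟩
  · obtain ⟨k, hkA, hk1, hk2, hk3⟩ := h.toIsEvenPart.exists_level hn {w}
    have hkt : k ∈ typePreserving Ω := mem_typePreserving_of_fixed (hk1 root (Nat.zero_le _))
    have hk4 : ∀ v, v ≠ w → sgn k v = 1 := fun v hv => by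
      by_cases hvn : v.1.length = n
      · exact (hk3 v hvn).2 hv
      · exact (hodd k hk2).1 v hvn
    have hkp : parity (n % 2) k ≠ 1 := by
      have := parity_eq_neg_one (g := k) (v := w)
        (fun hc => (hk3 w hw).1 hc rfl) fun v _ hv => hk4 v hv
      rwa [hw] at this
    have h1 : ∀ v, v.1.length ≤ n → (g * k) v = v := fun v hv => by
      rw [RelIso.mul_apply, hk1 v hv, hg1 v hv]
    have h2 : ∀ v, v.1.length ≠ n → localPerm (g * k) v ∈ F := fun v hv => by
      rw [localPerm_mul]
      refine F.mul_mem (hg2 _ ?_) (hk2 v hv)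
      rwa [length_apply_of_root (hk1 root (Nat.zero_le _))]
    have hE : g * k ∈ evenAut A := ⟨(U A).mul_mem hgA hkA, (hodd _ h2).2,
      Subgroup.mul_mem _ hgt hkt, fun i => by
        by_cases hi : i = n % 2
        · rw [hi, parity_mul (hodd g hg2).2 (hodd k hk2).2 hkt]
          exact units_mul_eq_one hp hkp
        · exact hpar _ h2 i hi⟩
    refine ⟨⟨g * k, h.N_eq.ge hE⟩, ⟨h1, h2⟩, fun v hv hvw => ?_⟩
    rw [← hg3 v hv]
    change sgn (g * k) v = 1 ↔ _
    rw [sgn_mul, hk4 v hvw, mul_one, hk1 v hv.le]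

/-- The local permutations on the sphere of radius `n` determine an element of the stabilizer of
the ball of radius `n` modulo the stabilizer of the ball of radius `n + 1`. -/
theorem inv_mul_mem_ballStab {n : ℕ} {g k : N F A} (hg : g ∈ ballStab F A n)
    (hk : k ∈ ballStab F A n)
    (h : ∀ v, v.1.length = n → localPerm (g : TreeAut Ω) v = localPerm (k : TreeAut Ω) v) :
    g⁻¹ * k ∈ ballStab F A (n + 1) := by
  have h1 : g⁻¹ * k ∈ ballStab F A n := Subgroup.mul_mem _ (Subgroup.inv_mem _ hg) hk
  refine ⟨h1.1, fun v hv => ?_⟩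
  have hv : v.1.length ≤ n + 1 := hv
  rcases Nat.lt_or_ge n v.1.length with hn | hn
  · have hr : v ≠ root := by
      rintro rfl
      rw [root_val, List.length_nil] at hn
      omega
    obtain ⟨a, u, hu, rfl⟩ := exists_step_eq hr
    rw [length_step_of_ne hu] at hn hv
    have hun : u.1.length = n := by omega
    have hgk : (g : TreeAut Ω) (step a u) = (k : TreeAut Ω) (step a u) := by
      have hgu : (g : TreeAut Ω) u = u := hg.2 u hun.le
      have hku : (k : TreeAut Ω) u = u := hk.2 u hun.le
      rw [apply_step, apply_step, h u hun, hgu, hku]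
    change (g : TreeAut Ω)⁻¹ ((k : TreeAut Ω) (step a u)) = step a u
    rw [← hgk]
    exact RelIso.inv_apply_self _ _
  · exact h1.2 v hn

end Levels

end LocalAction

open MeasureTheory Measure

/-- The growth estimate behind the absence of lattices. -/
theorem false_of_growth {d k : ℕ} (hd : 3 ≤ d) {s : ℕ → ℕ} {m : ℕ → ℝ} {C : ℝ}
    (hs : ∀ n, k ≤ n → 1 ≤ s n) (hs' : ∀ n, k ≤ n → (d - 1) * s n ≤ s (n + 1))
    (hm : ∀ n, 0 < m n) (hm' : ∀ n, k ≤ n → m n ≤ (2 ^ (d - 3)) ^ s n * m (n + 1))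
    (hC : ∀ n, k ≤ n → 2 ^ (s n - 1) * m n ≤ C) : False := by
  have h1 : ∀ n, k ≤ n → 2 * (2 ^ s n * m n) ≤ 2 ^ s (n + 1) * m (n + 1) := by
    intro n hn
    -- Of the d - 1 copies of s n, d - 3 absorb the loss of measure, one restores the exponent s n,
    -- and the last is at least 1 and yields the factor 2.
    have h2 : 1 + s n + (d - 3) * s n ≤ s (n + 1) := by
      refine le_trans ?_ (hs' n hn)
      obtain ⟨e, rfl⟩ := Nat.exists_eq_add_of_le hd
      rw [show 3 + e - 1 = e + 2 by omega, show 3 + e - 3 = e by omega, add_mul]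
      have := hs n hn
      omega
    calc 2 * (2 ^ s n * m n) ≤ 2 * (2 ^ s n * ((2 ^ (d - 3)) ^ s n * m (n + 1))) := by
          gcongr
          exact hm' n hn
      _ = 2 ^ (1 + s n + (d - 3) * s n) * m (n + 1) := by
          rw [← pow_mul]
          ring
      _ ≤ 2 ^ s (n + 1) * m (n + 1) := by
          gcongr
          · exact (hm _).le
          · norm_num
  have h2 : ∀ j, 2 ^ j * (2 ^ s k * m k) ≤ 2 ^ s (k + j) * m (k + j) := by
    intro j
    induction j with
    | zero => simp
    | succ j ih =>
      refine le_trans ?_ (h1 (k + j) (Nat.le_add_right _ _))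
      rw [pow_succ', mul_assoc]
      gcongr
  have h3 : ∀ j, 2 ^ s (k + j) * m (k + j) ≤ 2 * C := by
    intro j
    have h4 := hC (k + j) (Nat.le_add_right _ _)
    have h5 : s (k + j) = s (k + j) - 1 + 1 := by
      have := hs (k + j) (Nat.le_add_right _ _)
      omega
    rw [h5, pow_succ', mul_assoc]
    gcongr
  have hpos : 0 < 2 ^ s k * m k := mul_pos (by positivity) (hm k)
  obtain ⟨j, hj⟩ := pow_unbounded_of_one_lt (2 * C / (2 ^ s k * m k)) (one_lt_two (α := ℝ))
  rw [div_lt_iff₀ hpos] at hj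
  exact absurd ((h2 j).trans (h3 j)) (not_le.2 hj)

namespace LocalAction

/-! ### Absence of lattices -/

section NoLattice

variable {Ω : Type*} [Fintype Ω] [DecidableEq Ω] {F A : Subgroup (Equiv.Perm Ω)}

/-- The vertices at distance `n` from the root. -/
noncomputable def sphere (Ω : Type*) [Finite Ω] (n : ℕ) : Finset (Vert Ω) :=
  (finite_sphere n).toFinset

theorem mem_sphere {n : ℕ} {v : Vert Ω} : v ∈ sphere Ω n ↔ v.1.length = n :=
  Set.Finite.mem_toFinset _

theorem exists_step_of_mem_sphere {n : ℕ} (hn : 1 ≤ n) {v : Vert Ω} (hv : v ∈ sphere Ω n) :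
    ∃ a u, u.1.head? ≠ some a ∧ step a u = v := by
  refine exists_step_eq ?_
  rintro rfl
  rw [mem_sphere, root_val, List.length_nil] at hv
  omega

theorem mul_card_sphere_le {n : ℕ} (hn : 1 ≤ n) :
    (Fintype.card Ω - 1) * (sphere Ω n).card ≤ (sphere Ω (n + 1)).card := by
  classical
  let t : Vert Ω → Finset Ω := fun v => Finset.univ.filter fun a => v.1.head? ≠ some a
  calc (Fintype.card Ω - 1) * (sphere Ω n).card
      = ∑ v ∈ sphere Ω n, (t v).card := by
        rw [Finset.sum_const_nat (m := Fintype.card Ω - 1), mul_comm]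
        intro v hv
        obtain ⟨a, u, hu, rfl⟩ := exists_step_of_mem_sphere hn hv
        have : t (step a u) = Finset.univ.erase a := by
          ext b
          simp [t, head?_step_of_ne hu, eq_comm]
        rw [this, Finset.card_erase_of_mem (Finset.mem_univ a), Finset.card_univ]
    _ = ((sphere Ω n).sigma t).card := (Finset.card_sigma _ _).symm
    _ ≤ (sphere Ω (n + 1)).card := by
        refine Finset.card_le_card_of_injOn (fun p => step p.2 p.1) ?_ ?_
        · rintro ⟨v, a⟩ hp
          obtain ⟨hv, ha⟩ := Finset.mem_sigma.1 (Finset.mem_coe.1 hp)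
          have ha : v.1.head? ≠ some a := (Finset.mem_filter.1 ha).2
          exact Finset.mem_coe.2 (mem_sphere.2 (by
            rw [length_step_of_ne ha, mem_sphere.1 hv]))
        · rintro ⟨v, a⟩ hp ⟨w, b⟩ hq heq
          have ha : v.1.head? ≠ some a :=
            (Finset.mem_filter.1 (Finset.mem_sigma.1 (Finset.mem_coe.1 hp)).2).2
          have hb : w.1.head? ≠ some b :=
            (Finset.mem_filter.1 (Finset.mem_sigma.1 (Finset.mem_coe.1 hq)).2).2
          have h1 := congrArg Subtype.val heq
          dsimp only at h1
          rw [step_val_of_ne ha, step_val_of_ne hb, List.cons.injEq] at h1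
          obtain ⟨rfl, h2⟩ := h1
          have h3 := Subtype.ext h2
          subst h3
          rfl

theorem card_sphere_pos (hd : 2 ≤ Fintype.card Ω) {n : ℕ} (hn : 1 ≤ n) :
    1 ≤ (sphere Ω n).card := by
  induction n, hn using Nat.le_induction with
  | base =>
    obtain ⟨a⟩ : Nonempty Ω := Fintype.card_pos_iff.1 (by omega)
    exact Finset.card_pos.2 ⟨step a root, mem_sphere.2 (length_step_root a)⟩
  | succ n hn ih =>
    refine le_trans ?_ (mul_card_sphere_le hn)
    exact Nat.mul_pos (by omega) ih

theorem localPerm_apply_of_mem_ballStab {n : ℕ} {g : N F A} (hg : g ∈ ballStab F A n) {a : Ω}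
    {u : Vert Ω} (hu : u.1.head? ≠ some a) (hn : (step a u).1.length = n) :
    localPerm (g : TreeAut Ω) (step a u) a = a := by
  rw [length_step_of_ne hu] at hn
  rw [localPerm_step]
  have h1 : (g : TreeAut Ω) u = u := hg.2 u (show u.1.length ≤ n by omega)
  have h2 : (g : TreeAut Ω) (step a u) = step a u := hg.2 _ (by
    change (step a u).1.length ≤ n
    rw [length_step_of_ne hu, hn])
  rw [apply_step, h1] at h2
  exact step_left_injective u h2

variable {Γ : Subgroup (N F A)} [MeasurableSpace (N F A ⧸ Γ)] [BorelSpace (N F A ⧸ Γ)]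
  {μ : Measure (N F A ⧸ Γ)} [SMulInvariantMeasure (N F A) (N F A ⧸ Γ) μ]

/-- A coset of the next ball stabilizer is determined by the local permutations on the sphere. Each
of them lies in F and fixes the colour towards the root, so there are at most M of them at each
vertex. -/
theorem measure_ballStab_le {M : ℕ} (hM : ∀ a, Nat.card {s // s ∈ F ∧ s a = a} ≤ M) {n : ℕ}
    (hn : 1 ≤ n) :
    μ (QuotientGroup.mk '' (ballStab F A n : Set (N F A))) ≤
      (M : ENNReal) ^ (sphere Ω n).card *
        μ (QuotientGroup.mk '' (ballStab F A (n + 1) : Set (N F A))) := by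
  classical
  have hsph : ∀ v : sphere Ω n, ∃ a u, u.1.head? ≠ some a ∧ step a u = v.1 := fun v =>
    exists_step_of_mem_sphere hn v.2
  choose a u hu hau using hsph
  let ι := ∀ v : sphere Ω n, {s // s ∈ F ∧ s (a v) = a v}
  have hι : Fintype.card ι ≤ M ^ (sphere Ω n).card := by
    rw [Fintype.card_pi]
    calc ∏ v : sphere Ω n, Fintype.card {s // s ∈ F ∧ s (a v) = a v}
        ≤ ∏ _v : sphere Ω n, M := Finset.prod_le_prod' fun v _ => by
          rw [← Nat.card_eq_fintype_card]
          exact hM _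
      _ = M ^ (sphere Ω n).card := by simp
  let R : ι → N F A → Prop := fun i g =>
    g ∈ ballStab F A n ∧ ∀ v : sphere Ω n, localPerm (g : TreeAut Ω) v.1 = i v
  -- Tuples that are not realized get the dummy representative 1; only a covering is needed.
  let t : ι → N F A := fun i => if h : ∃ g, R i g then h.choose else 1
  refine (measure_image_mk_le t fun g hg => ?_).trans
    (mul_le_mul_left ((Nat.cast_le.2 hι).trans_eq (Nat.cast_pow _ _)) _)
  have hfix : ∀ v : sphere Ω n, localPerm (g : TreeAut Ω) v.1 (a v) = a v := fun v => by
    conv_lhs => rw [← hau v]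
    exact localPerm_apply_of_mem_ballStab hg (hu v) (by rw [hau, mem_sphere.1 v.2])
  let i : ι := fun v => ⟨localPerm (g : TreeAut Ω) v.1, hg.1 _, hfix v⟩
  have hi : ∃ k, R i k := ⟨g, hg, fun _ => rfl⟩
  refine ⟨i, ?_⟩
  have ht : t i = hi.choose := dif_pos hi
  rw [ht]
  exact inv_mul_mem_ballStab hi.choose_spec.1 hg fun v hv =>
    hi.choose_spec.2 ⟨v, mem_sphere.2 hv⟩

/-- Subsets of the sphere without w index elements of `levelStab` with different sign patterns.
Multiplying by the ball stabilizer does not change the signs there. As Γ meets `levelStab`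
trivially, the corresponding translates have disjoint images. -/
theorem IsAmple.mul_measure_ballStab_le (h : IsAmple F A) {n : ℕ} (hn : 1 ≤ n)
    (hΓ : ∀ g ∈ Γ, g ∈ levelStab F A n → g = 1) :
    2 ^ ((sphere Ω n).card - 1) * μ (QuotientGroup.mk '' (ballStab F A n : Set (N F A))) ≤
      μ Set.univ := by
  classical
  obtain ⟨w, hw⟩ : (sphere Ω n).Nonempty := Finset.card_pos.1
    (card_sphere_pos (by have := h.three_le_card; omega) hn)
  let E := ((sphere Ω n).erase w).powerset
  choose t ht hts using fun T : E => h.exists_mem_levelStab hn (mem_sphere.1 hw) (T.1 : Set _)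
  have hE : ((Fintype.card E : ℕ) : ENNReal) = 2 ^ ((sphere Ω n).card - 1) := by
    rw [Fintype.card_coe, Finset.card_powerset, Finset.card_erase_of_mem hw]
    norm_num
  rw [← hE]
  refine le_measure_univ (isOpen_ballStab n) t fun S T g hg g' hg' hmem => ?_
  have hL : ∀ (T : E) (g : N F A), g ∈ ballStab F A n → t T * g ∈ levelStab F A n :=
    fun T g hg => (levelStab F A n).mul_mem (ht T) (ballStab_le_levelStab n hg)
  have h1 : t S * g = t T * g' := inv_mul_eq_one.1 (hΓ _ hmem
    ((levelStab F A n).mul_mem ((levelStab F A n).inv_mem (hL S g hg)) (hL T g' hg')))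
  have h2 : ∀ (T : E) (g : N F A), g ∈ ballStab F A n → ∀ v, v.1.length = n →
      sgn ((t T * g : N F A) : TreeAut Ω) v = sgn (t T : TreeAut Ω) v := by
    intro T g hg v hv
    have h3 : (g : TreeAut Ω) v = v := hg.2 v hv.le
    have h4 : sgn (g : TreeAut Ω) v = 1 := h.sgn_eq_one hg.1 v
    rw [Subgroup.coe_mul, sgn_mul, h4, mul_one, h3]
  apply Subtype.ext
  ext v
  by_cases hv : v ∈ (sphere Ω n).erase w
  · obtain ⟨hvw, hvn⟩ := Finset.mem_erase.1 hv
    have hvn := mem_sphere.1 hvn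
    have h3 := hts S v hvn hvw
    rw [← h2 S g hg v hvn, h1, h2 T g' hg' v hvn, hts T v hvn hvw] at h3
    exact not_iff_not.1 h3.symm
  · exact ⟨fun hc => absurd (Finset.mem_powerset.1 S.2 hc) hv,
      fun hc => absurd (Finset.mem_powerset.1 T.2 hc) hv⟩

omit [MeasurableSpace (N F A ⧸ Γ)] [BorelSpace (N F A ⧸ Γ)] in
theorem exists_ballStab_disjoint [DiscreteTopology Γ] :
    ∃ k, 1 ≤ k ∧ ∀ n, k ≤ n → ∀ g ∈ Γ, g ∈ ballStab F A n → g = 1 := by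
  obtain ⟨V, hV, hV1⟩ := isOpen_induced_iff.1 (isOpen_discrete ({1} : Set Γ))
  have h1 : (1 : N F A) ∈ V := by
    have : (1 : Γ) ∈ (Subtype.val ⁻¹' V : Set Γ) := hV1 ▸ Set.mem_singleton _
    exact this
  obtain ⟨S, hS, hSV⟩ := nhds_one_hasBasis_N.mem_iff.1 (hV.mem_nhds h1)
  obtain ⟨k, hk⟩ := (hS.image fun v : Vert Ω => v.1.length).bddAbove
  refine ⟨k + 1, Nat.le_add_left _ _, fun n hn g hg hgn => ?_⟩
  have h2 : g ∈ V := hSV ⟨hgn.1, fun v hv => hgn.2 v (by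
    have := hk (Set.mem_image_of_mem _ hv)
    exact this.trans (by omega))⟩
  have h3 : (⟨g, hg⟩ : Γ) ∈ ({1} : Set Γ) := hV1 ▸ h2
  exact congrArg Subtype.val (Set.mem_singleton_iff.1 h3)

-- Squares are even, so g² lies in the ball stabilizer and is trivial. Then g acts on the sphere by
-- local involutions, which are even by `hinv`; so g itself lies in the ball stabilizer and is
-- trivial.
omit [MeasurableSpace (N F A ⧸ Γ)] [BorelSpace (N F A ⧸ Γ)] in
theorem IsAmple.eq_one_of_mem_levelStab (h : IsAmple F A)
    (hinv : ∀ s ∈ A, s * s = 1 → Equiv.Perm.sign s = 1) {n : ℕ}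
    (hΓ : ∀ g ∈ Γ, g ∈ ballStab F A n → g = 1) {g : N F A} (hg : g ∈ Γ)
    (hgn : g ∈ levelStab F A n) : g = 1 := by
  have hA : ∀ v, localPerm (g : TreeAut Ω) v ∈ A := (h.N_eq.le g.2).1
  have hsq : ∀ v, v.1.length = n → localPerm ((g * g : N F A) : TreeAut Ω) v =
      localPerm (g : TreeAut Ω) v * localPerm (g : TreeAut Ω) v := fun v hv => by
    rw [Subgroup.coe_mul, localPerm_mul, hgn.1 v hv.le]
  have hgg := (levelStab F A n).mul_mem hgn hgn
  have h1 : g * g = 1 := by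
    refine hΓ _ (Γ.mul_mem hg hg) ⟨fun v => ?_, hgg.1⟩
    by_cases hv : v.1.length = n
    · change localPerm ((g * g : N F A) : TreeAut Ω) v ∈ F
      rw [hsq v hv, h.mem_iff, map_mul, Int.units_mul_self]
      exact ⟨A.mul_mem (hA v) (hA v), rfl⟩
    · exact hgg.2 v hv
  refine hΓ g hg ⟨fun v => ?_, hgn.1⟩
  by_cases hv : v.1.length = n
  · refine (h.mem_iff _).2 ⟨hA v, hinv _ (hA v) ?_⟩
    exact (hsq v hv).symm.trans ((congrArg (fun k : N F A => localPerm (k : TreeAut Ω) v) h1).trans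
      (localPerm_one v))
  · exact hgn.2 v hv

/-- If all the involutions in `A` are even and the point stabilizers in `F` are small, then
`N(F, A)` has no lattice. -/
theorem IsAmple.not_hasLattice (h : IsAmple F A)
    (hinv : ∀ s ∈ A, s * s = 1 → Equiv.Perm.sign s = 1)
    (hcard : ∀ a, Nat.card {s // s ∈ F ∧ s a = a} ≤ 2 ^ (Fintype.card Ω - 3)) :
    ¬ HasLattice (N F A) := by
  rintro ⟨Γ, hΓ, μ, hμ, hfin, hreg, hsmul⟩
  let _ : MeasurableSpace (N F A ⧸ Γ) := borel (N F A ⧸ Γ)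
  have : BorelSpace (N F A ⧸ Γ) := ⟨rfl⟩
  obtain ⟨k, hk, hkΓ⟩ := exists_ballStab_disjoint (Γ := Γ)
  have hd := h.three_le_card
  have hne : ∀ n, μ (QuotientGroup.mk '' (ballStab F A n : Set (N F A))) ≠ ⊤ :=
    fun n => measure_ne_top _ _
  refine false_of_growth hd (k := k) (s := fun n => (sphere Ω n).card)
    (m := fun n => (μ (QuotientGroup.mk '' (ballStab F A n : Set (N F A)))).toReal)
    (C := (μ Set.univ).toReal) (fun n hn => card_sphere_pos (by omega) (hk.trans hn))
    (fun n hn => mul_card_sphere_le (hk.trans hn)) (fun n => ?_) (fun n hn => ?_)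
    fun n hn => ?_
  · exact ENNReal.toReal_pos (measure_image_mk_ne_zero hμ (isOpen_ballStab n)
      (ballStab F A n).one_mem) (hne n)
  · have h1 := ENNReal.toReal_mono (ENNReal.mul_ne_top (ENNReal.pow_ne_top
      (ENNReal.natCast_ne_top _)) (hne (n + 1))) (measure_ballStab_le (μ := μ) hcard (hk.trans hn))
    simpa using h1
  · have h1 := ENNReal.toReal_mono (measure_ne_top _ _)
      (h.mul_measure_ballStab_le (μ := μ) (hk.trans hn) fun g hg hgn =>
        h.eq_one_of_mem_levelStab hinv (hkΓ n hn) hg hgn)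
    simpa using h1

end NoLattice

end LocalAction

open MeasureTheory Measure

/-! ### Transport along isomorphisms of topological groups -/

section Transport

variable {G H : Type*} [Group G] [TopologicalSpace G] [IsTopologicalGroup G] [Group H]
  [TopologicalSpace H] [IsTopologicalGroup H]

theorem HasLattice.of_continuousMulEquiv [T2Space G] (e : G ≃ₜ* H) (h : HasLattice H) :
    HasLattice G := by
  obtain ⟨Γ, hΓ, μ, hμ, hfin, hreg, hsmul⟩ := h
  let _ : MeasurableSpace (H ⧸ Γ) := borel (H ⧸ Γ)
  have : BorelSpace (H ⧸ Γ) := ⟨rfl⟩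
  let Δ : Subgroup G := Γ.comap (e : G →* H)
  let f : H ⧸ Γ → G ⧸ Δ := Quotient.map' e.symm fun x y hxy => by
    rw [QuotientGroup.leftRel_apply] at hxy ⊢
    change e ((e.symm x)⁻¹ * e.symm y) ∈ Γ
    simpa using hxy
  have hf : Continuous f := e.symm.continuous.quotient_map' _
  have hdisc : DiscreteTopology Δ := by
    refine DiscreteTopology.of_continuous_injective (β := Γ) (f := fun g => ⟨e g.1, g.2⟩)
      ((e.continuous.comp continuous_subtype_val).subtype_mk _) fun x y hxy => ?_
    exact Subtype.ext (e.injective (congrArg Subtype.val hxy))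
  have hclosed : IsClosed (Δ : Set G) := Δ.isClosed_of_discrete
  refine ⟨Δ, hdisc, ?_⟩
  let _ : MeasurableSpace (G ⧸ Δ) := borel (G ⧸ Δ)
  have : BorelSpace (G ⧸ Δ) := ⟨rfl⟩
  have hfin' : IsFiniteMeasure (map f μ) := inferInstance
  refine ⟨map f μ, fun h0 => hμ ?_, hfin', ?_, ⟨fun g A hA => ?_⟩⟩
  · exact (map_eq_zero_iff hf.aemeasurable).1 h0
  · have : InnerRegular (map f μ) := InnerRegular.map_of_continuous hf
    infer_instance
  · have hgA : MeasurableSet ((fun x : G ⧸ Δ => g • x) ⁻¹' A) :=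
      (continuous_const_smul g).measurable hA
    rw [map_apply hf.measurable hA, map_apply hf.measurable hgA,
      ← measure_preimage_smul_of_nullMeasurableSet (μ := μ)
        (hf.measurable hA).nullMeasurableSet (e g)]
    congr 1
    ext x
    obtain ⟨x, rfl⟩ := QuotientGroup.mk_surjective x
    simp only [Set.mem_preimage]
    have h1 : f (e g • (x : H ⧸ Γ)) = g • f (x : H ⧸ Γ) := by
      change (QuotientGroup.mk (e.symm (e g * x)) : G ⧸ Δ) = QuotientGroup.mk (g * e.symm x)
      rw [map_mul, ContinuousMulEquiv.symm_apply_apply]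
    rw [h1]

theorem IsCompactlyGeneratedTDLC.of_continuousMulEquiv (e : G ≃ₜ* H)
    (h : IsCompactlyGeneratedTDLC G) : IsCompactlyGeneratedTDLC H := by
  obtain ⟨-, h2, h3, h4, S, hS, hSG⟩ := h
  refine ⟨inferInstance, e.toHomeomorph.symm.isEmbedding.t2Space,
    e.toHomeomorph.totallyDisconnectedSpace, e.toHomeomorph.symm.isClosedEmbedding.locallyCompactSpace,
    e '' S, hS.image e.continuous, ?_⟩
  have h5 : (e : G →* H) '' S = e '' S := rfl
  rw [← h5, ← MonoidHom.map_closure, hSG, ← MonoidHom.range_eq_map]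
  exact MonoidHom.range_eq_top.2 e.surjective

/-- An embedding of topological groups is an isomorphism onto its range. -/
noncomputable def continuousMulEquivRange (f : G →* H) (hf : Topology.IsEmbedding f) :
    G ≃ₜ* f.range where
  __ := f.ofInjective hf.injective
  continuous_toFun := hf.continuous.subtype_mk _
  continuous_invFun := by
    refine (hf.isInducing.continuous_iff).2 (continuous_subtype_val.congr fun x => ?_)
    obtain ⟨g, rfl⟩ := (f.ofInjective hf.injective).surjective x
    exact congrArg f ((f.ofInjective hf.injective).symm_apply_apply g).symm

end Transport

namespace LocalAction

/-- Although -1 is a square in K, it is not one in the prime field, so Kⁿ viewed over the prime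
field has an odd additive involution. By `sign_eq_one_of_affine_of_mul_self` it is not affine over
K, which is why it helps the larger group only. -/
theorem affine_hasLattice {K : Type*} [Field K] [Fintype K] [DecidableEq K] {n : ℕ} (hn : 1 ≤ n)
    (hK : Fintype.card K % 4 = 1) (hp : ringChar K % 4 = 3) :
    HasLattice (N (alternatingGroup (Fin n → K)) ⊤) := by
  have : Fact (ringChar K).Prime := ⟨CharP.char_is_prime K _⟩
  let _ : Algebra (ZMod (ringChar K)) K := ZMod.algebra K (ringChar K)
  have : Nonempty (Fin n) := ⟨⟨0, hn⟩⟩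
  obtain ⟨τ, hτ, hs⟩ := exists_odd_involution hp (Fin n → K)
  exact (isAmple_alternatingGroup (five_le_card_fun hn hK)).hasLattice
    (isEvenPart_translations (odd_card_fun hK) τ hτ hs) le_top
    fun s hs a ha => eq_one_of_mem_translations hs ha

end LocalAction

/-! ### The theorem -/

theorem mainTheorem5 :
    (∃ (G : Type) (_ : Group G) (_ : TopologicalSpace G) (H : Subgroup G),
      IsCompactlyGeneratedTDLC G ∧ IsCompactlyGeneratedTDLC H ∧
      IsClosed (H : Set G) ∧ CompactSpace (G ⧸ H) ∧
      IsSimpleGroup G ∧ IsSimpleGroup H ∧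
      HasLattice G ∧ ¬ HasLattice H) ∧
    (∀ (K : Type) [Field K] [Fintype K] [DecidableEq K] (n : ℕ), 1 ≤ n →
      Fintype.card K % 4 = 1 →
      IsCompactlyGeneratedTDLC (LocalAction.N (alternatingGroup (Fin n → K)) ⊤) ∧
      IsCompactlyGeneratedTDLC
        (LocalAction.N (LocalAction.squareAffine n K) (LocalAction.affine n K)) ∧
      (∃ hle : LocalAction.N (LocalAction.squareAffine n K) (LocalAction.affine n K) ≤
          LocalAction.N (alternatingGroup (Fin n → K)) ⊤,
        Topology.IsClosedEmbedding (Subgroup.inclusion hle) ∧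
        CompactSpace (LocalAction.N (alternatingGroup (Fin n → K)) ⊤ ⧸
          (Subgroup.inclusion hle).range)) ∧
      IsSimpleGroup (LocalAction.N (alternatingGroup (Fin n → K)) ⊤) ∧
      IsSimpleGroup
        (LocalAction.N (LocalAction.squareAffine n K) (LocalAction.affine n K)) ∧
      (ringChar K % 4 = 3 →
        HasLattice (LocalAction.N (alternatingGroup (Fin n → K)) ⊤)) ∧
      ¬ HasLattice
        (LocalAction.N (LocalAction.squareAffine n K) (LocalAction.affine n K))) := by
  -- The existence statement is the family at q = 9, n = 1, where 9 ≡ 1 and 3 ≡ 3 (mod 4). The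
  -- subgroup is the range of the inclusion, and its properties are transported along the
  -- isomorphism onto the range.
  refine and_iff_right_of_imp (fun h2 => ?_) |>.2 ?_
  · have : Fact (Nat.Prime 3) := ⟨Nat.prime_three⟩
    classical
    let _ : Fintype (GaloisField 3 2) := Fintype.ofFinite _
    have hcard : Fintype.card (GaloisField 3 2) = 9 := by
      rw [← Nat.card_eq_fintype_card, GaloisField.card 3 2 two_ne_zero]
      norm_num
    have hchar : ringChar (GaloisField 3 2) = 3 := ringChar.eq _ 3
    obtain ⟨hG, hH, ⟨hle, hemb, hcpt⟩, hGs, hHs, hGl, hHl⟩ :=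
      h2 (GaloisField 3 2) 1 le_rfl (by rw [hcard])
    let e := continuousMulEquivRange (Subgroup.inclusion hle) hemb.isEmbedding
    have := hH.t2Space
    exact ⟨_, inferInstance, inferInstance, (Subgroup.inclusion hle).range, hG,
      hH.of_continuousMulEquiv e, hemb.isClosed_range, hcpt, hGs,
      e.toMulEquiv.isSimpleGroup_congr.1 hHs, hGl (by rw [hchar]),
      fun h => hHl (h.of_continuousMulEquiv e)⟩
  · intro K _ _ _ n hn hK
    have h := LocalAction.isAmple_affine hn hK
    have h' := LocalAction.isAmple_alternatingGroup (LocalAction.five_le_card_fun hn hK)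
    exact ⟨h'.isCompactlyGeneratedTDLC_N, h.isCompactlyGeneratedTDLC_N,
      ⟨h.N_le_N h' le_top, h.isClosedEmbedding_inclusion h' le_top,
        h.compactSpace_quotient h' le_top⟩, h'.isSimpleGroup_N, h.isSimpleGroup_N,
      LocalAction.affine_hasLattice hn hK,
      h.not_hasLattice (fun s => LocalAction.sign_eq_one_of_affine_of_mul_self hK)
        (LocalAction.card_stabilizer_squareAffine_le hn hK)⟩
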